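/- Let $a>0$, $k_0\in\mathbb C$ with $\operatorname{Re}k_0>0$, $\operatorname{Im}k_0>0$, and $\eta\in\mathbb C$ with $\operatorname{Im}\eta\le 0$. Let $\gamma$ be a simple smooth contour joining $0$ to $i\infty$ such that the cuts $\mathcal G_2'=\gamma+k_0$ and $\mathcal G_1'=-\gamma-k_0$ are disjoint and $\mathcal G_2'$ coincides, outside a bounded set, with the curve $\{\sqrt{k_0^2-t^2}:t\ge0\}$ (which goes from $k_0$ to $i\infty$ in the first quadrant). Let $\xi(k)=\sqrt{k_0^2-k^2}$ be the branch on $\mathbb C\setminus(\mathcal G_1'\cup\mathcal G_2')$ with $\xi(0)=k_0$, continued to the cuts from their left shores; left ($L$) and right ($R$) refer to the direction from the finite end of a cut to infinity. Assume that $\eta-i\xi(k)$ has no zeros on $\mathbb C\setminus(\mathcal G_1'\cup\mathcal G_2')$ and that the cuts do not pass through the points $\pm\sqrt{k_0^2+\eta^2}$. For $b\in\gamma$ let $\gamma(b)$ be the part of $\gamma$ between $b$ and $i\infty$, $\mathcal G_2'(b)=\gamma(b)+k_0$, $\mathcal G_1'(b)=-\gamma(b)-k_0$. Put $m(k)=\frac{i\xi+\eta}{i\xi-\eta}$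 and let $\lambda(b)=\frac{1}{2\pi i}\log m(k_0+b)$ be continuous along $\gamma$ with $\lambda(i\infty)=0$. Put $$\tilde M_1=\begin{pmatrix}1&\frac{2i(k_0-k)}{i\xi-\eta}\\0&m\end{pmatrix},\quad \tilde M_2=\begin{pmatrix}m&0\\\frac{2i(k_0+k)}{i\xi-\eta}&1\end{pmatrix},\quad N_1=\begin{pmatrix}1&\frac{-2\eta}{\eta-i\xi}\\0&m\end{pmatrix},\quad N_2=\begin{pmatrix}m&0\\\frac{-2\eta}{\eta-i\xi}&1\end{pmatrix}.$$ Given matrix functions $A_1,A_2$ and $b\in\gamma$, consider the problem of finding a $2\times2$ matrix function $W(k)$ with rows $(W^j_-,W^j_+)$, $j=1,2$, such that: (i) $W$ is regular and $\det W$ has no zeros on the plane cut along $\mathcal G_1'(b)\cup\mathcal G_2'(b)$; (ii) at the interior points of the cuts $W$ has continuous boundary values, with $W_R=W_LA_1$ on $\mathcal G_1'(b)$ and $W_R=W_LA_2$ on $\mathcal G_2'(b)$; (iii) $W^j_-=e^{-ika}(\delta_{j,1}+o(1))$ and $W^j_+=e^{ika}(\delta_{j,2}+o(1))$ as $|k|\to\infty$,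 uniformly in the cut plane; (iv) near $-(k_0+b)$ the functions $W^j_-$ are regular and $W^j_+=O(|k+k_0+b|^{\operatorname{Re}\lambda(b)}+1)$; near $k_0+b$ the functions $W^j_+$ are regular and $W^j_-=O(|k-k_0-b|^{\operatorname{Re}\lambda(b)}+1)$. Suppose that, for all $b\in\gamma$ sufficiently far along $\gamma$, $\hat U(b,\cdot)$ solves this problem with $(A_1,A_2)=(\tilde M_1,\tilde M_2)$ (antisymmetrical case) and $V(b,\cdot)$ solves it with $(A_1,A_2)=(N_1,N_2)$ (symmetrical case). Then, for every $k\in\mathbb C$, $$\lim_{b\to i\infty,\ b\in\gamma}\hat U(b,k)=\lim_{b\to i\infty,\ b\in\gamma}V(b,k)=\Pi(k)=\begin{pmatrix}e^{-iak}&0\\0&e^{iak}\end{pmatrix}.$$ The two limits hold independently of each other, each for every such family. -/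

import Mathlib

open Complex Filter Topology Set Asymptotics

noncomputable section

namespace ImpedanceStrip

/-- `2 × 2` complex matrices. Column `0` carries the index `-`, column `1` the index `+`. -/
abbrev Mat := Matrix (Fin 2) (Fin 2) ℂ

/-- The point `√(k₀² - t²)` of the undeformed contour (principal branch). For `Re k₀, Im k₀ > 0` the
curve `t ↦ √(k₀² - t²)`, `t ≥ 0`, lies in the first quadrant and goes from `k₀` to `i∞`. -/
def undeformed (k₀ : ℂ) (t : ℝ) : ℂ := (k₀ ^ 2 - (t : ℂ) ^ 2) ^ (1 / 2 : ℂ)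

/-- The parametrized cut in the lower half-plane, starting from its finite end. -/
def curve₁ (k₀ : ℂ) (γ : ℝ → ℂ) (s : ℝ) : ℂ := -γ s - k₀

/-- The parametrized cut in the upper half-plane, starting from its finite end. -/
def curve₂ (k₀ : ℂ) (γ : ℝ → ℂ) (s : ℝ) : ℂ := γ s + k₀

/-- The shortened cut `-γ(b) - k₀` for `b = γ t`; `t = 0` gives the full cut. -/
def cut₁ (k₀ : ℂ) (γ : ℝ → ℂ) (t : ℝ) : Set ℂ := curve₁ k₀ γ '' Ici t

/-- The shortened cut `γ(b) + k₀` for `b = γ t`; `t = 0` gives the full cut. -/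
def cut₂ (k₀ : ℂ) (γ : ℝ → ℂ) (t : ℝ) : Set ℂ := curve₂ k₀ γ '' Ici t

/-- The plane cut along the two shortened cuts. -/
def cutPlane (k₀ : ℂ) (γ : ℝ → ℂ) (t : ℝ) : Set ℂ := (cut₁ k₀ γ t ∪ cut₂ k₀ γ t)ᶜ

/-- Boundary value of `f` on the left shore of the curve `c` at `c s`: the limit of `f` along
all approaches to `c s` through the points to the left of `c` (displaced along the normal). -/
def HasLeftValue {E : Type*} [TopologicalSpace E] (c : ℝ → ℂ) (f : ℂ → E) (s : ℝ) (l : E) : Prop :=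
  Tendsto (fun p : ℝ × ℝ => f (c p.1 + (p.2 : ℂ) * (I * deriv c p.1))) (𝓝 s ×ˢ 𝓝[>] 0) (𝓝 l)

/-- Boundary value of `f` on the right shore of the curve `c` at `c s`. -/
def HasRightValue {E : Type*} [TopologicalSpace E] (c : ℝ → ℂ) (f : ℂ → E) (s : ℝ) (l : E) : Prop :=
  Tendsto (fun p : ℝ × ℝ => f (c p.1 + (p.2 : ℂ) * (I * deriv c p.1))) (𝓝 s ×ˢ 𝓝[<] 0) (𝓝 l)

/-- `γ` is an admissible contour: a simple smooth arc from `0` to `i∞`, such that the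
cuts `γ + k₀` and `-γ - k₀` are disjoint and are obtained from the undeformed ones
by a deformation in a bounded region. -/
structure IsContour (k₀ : ℂ) (γ : ℝ → ℂ) : Prop where
  start : γ 0 = 0
  continuousOn : ContinuousOn γ (Ici 0)
  contDiffOn : ContDiffOn ℝ 1 γ (Ioi 0)
  deriv_ne_zero : ∀ t : ℝ, 0 < t → deriv γ t ≠ 0
  injOn : InjOn γ (Ici 0)
  disjoint : Disjoint (cut₁ k₀ γ 0) (cut₂ k₀ γ 0)
  tail : ∀ᶠ t : ℝ in atTop, γ t + k₀ = undeformed k₀ t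

/-- `ξ` is the branch of `√(k₀² - k²)` on the plane with the full cuts that equals `k₀` at `k = 0`,
continued to the left shores of the cuts. -/
structure IsRoot (k₀ : ℂ) (γ : ℝ → ℂ) (ξ : ℂ → ℂ) : Prop where
  sq : ∀ k, ξ k ^ 2 = k₀ ^ 2 - k ^ 2
  continuousOn : ContinuousOn ξ (cutPlane k₀ γ 0)
  zero : ξ 0 = k₀
  left₁ : ∀ s : ℝ, 0 < s → HasLeftValue (curve₁ k₀ γ) ξ s (ξ (curve₁ k₀ γ s))
  left₂ : ∀ s : ℝ, 0 < s → HasLeftValue (curve₂ k₀ γ) ξ s (ξ (curve₂ k₀ γ s))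

/-- The zeros of `η - i ξ` do not belong to the plane with the full cuts, and the cuts do
not pass through the points `± √(k₀² + η²)`. -/
structure AvoidsZeros (k₀ η : ℂ) (γ : ℝ → ℂ) (ξ : ℂ → ℂ) : Prop where
  off_cut : ∀ k ∈ cutPlane k₀ γ 0, η - I * ξ k ≠ 0
  on_cut : ∀ t : ℝ, 0 ≤ t → (γ t + k₀) ^ 2 ≠ k₀ ^ 2 + η ^ 2

/-- The nontrivial eigenvalue `m` of the connection matrices. -/
def mEig (η : ℂ) (ξ : ℂ → ℂ) (k : ℂ) : ℂ := (I * ξ k + η) / (I * ξ k - η)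

/-- `lam t` is the exponent `λ(b) = log m(b) / (2πi)`, `b = γ t`: it is continuous
along `γ` and vanishes at `i∞`. -/
structure IsExponent (k₀ η : ℂ) (γ : ℝ → ℂ) (ξ : ℂ → ℂ) (lam : ℝ → ℂ) : Prop where
  continuousOn : ContinuousOn lam (Ici 0)
  exp_eq : ∀ t : ℝ, 0 ≤ t → exp (2 * Real.pi * I * lam t) = mEig η ξ (curve₂ k₀ γ t)
  tendsto : Tendsto lam atTop (𝓝 0)

/-- Connection matrix on the lower cut, antisymmetrical case. -/
def M₁ (k₀ η : ℂ) (ξ : ℂ → ℂ) (k : ℂ) : Mat :=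
  !![1, 2 * I * (k₀ - k) / (I * ξ k - η); 0, (I * ξ k + η) / (I * ξ k - η)]

/-- Connection matrix on the upper cut, antisymmetrical case. -/
def M₂ (k₀ η : ℂ) (ξ : ℂ → ℂ) (k : ℂ) : Mat :=
  !![(I * ξ k + η) / (I * ξ k - η), 0; 2 * I * (k₀ + k) / (I * ξ k - η), 1]

/-- Connection matrix on the lower cut, symmetrical case. -/
def N₁ (η : ℂ) (ξ : ℂ → ℂ) (k : ℂ) : Mat :=
  !![1, -2 * η / (η - I * ξ k); 0, (η + I * ξ k) / (I * ξ k - η)]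

/-- Connection matrix on the upper cut, symmetrical case. -/
def N₂ (η : ℂ) (ξ : ℂ → ℂ) (k : ℂ) : Mat :=
  !![(η + I * ξ k) / (I * ξ k - η), 0; -2 * η / (η - I * ξ k), 1]

/-- `W` solves the Riemann--Hilbert problem with connection matrices `A₁`, `A₂` on the cuts that
are shortened to the ends `± (k₀ + b)`, `b = γ t`. -/
structure IsSolution (a : ℝ) (k₀ : ℂ) (γ : ℝ → ℂ) (lam : ℝ → ℂ) (A₁ A₂ : ℂ → Mat) (t : ℝ)
    (W : ℂ → Mat) : Prop where
  /-- `W` is regular on the cut plane. -/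
  regular : ∀ i j, DifferentiableOn ℂ (fun k => W k i j) (cutPlane k₀ γ t)
  /-- The determinant has no zeros on the cut plane. -/
  det_ne_zero : ∀ k ∈ cutPlane k₀ γ t, (W k).det ≠ 0
  /-- `W_R = W_L A₁` on the lower cut. -/
  jump₁ : ∀ s : ℝ, t < s → ∃ L R : Mat, HasLeftValue (curve₁ k₀ γ) W s L ∧
    HasRightValue (curve₁ k₀ γ) W s R ∧ R = L * A₁ (curve₁ k₀ γ s)
  /-- `W_R = W_L A₂` on the upper cut. -/
  jump₂ : ∀ s : ℝ, t < s → ∃ L R : Mat, HasLeftValue (curve₂ k₀ γ) W s L ∧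
    HasRightValue (curve₂ k₀ γ) W s R ∧ R = L * A₂ (curve₂ k₀ γ s)
  /-- `W_-^j = e^{-ika} (δ_{j,1} + o(1))` at infinity, uniformly in the cut plane. -/
  growth_minus : ∀ j : Fin 2, Tendsto (fun k => W k j 0 * exp (I * k * a))
    (Bornology.cobounded ℂ ⊓ 𝓟 (cutPlane k₀ γ t)) (𝓝 (if j = 0 then 1 else 0))
  /-- `W_+^j = e^{ika} (δ_{j,2} + o(1))` at infinity, uniformly in the cut plane. -/
  growth_plus : ∀ j : Fin 2, Tendsto (fun k => W k j 1 * exp (-I * k * a))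
    (Bornology.cobounded ℂ ⊓ 𝓟 (cutPlane k₀ γ t)) (𝓝 (if j = 1 then 1 else 0))
  /-- `W_-` is regular near the end `-(k₀ + b)` of the lower cut. -/
  end₁_minus : ∀ j : Fin 2, ∃ g : ℂ → ℂ, AnalyticAt ℂ g (curve₁ k₀ γ t) ∧
    ∀ᶠ k in 𝓝[cutPlane k₀ γ t] (curve₁ k₀ γ t), W k j 0 = g k
  /-- `W_+` grows no faster than `|k + (k₀ + b)|^{Re λ(b)}` plus a bounded term there. -/
  end₁_plus : ∀ j : Fin 2, (fun k => W k j 1) =O[𝓝[cutPlane k₀ γ t] (curve₁ k₀ γ t)]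
    fun k => ‖k - curve₁ k₀ γ t‖ ^ (lam t).re + 1
  /-- `W_+` is regular near the end `k₀ + b` of the upper cut. -/
  end₂_plus : ∀ j : Fin 2, ∃ g : ℂ → ℂ, AnalyticAt ℂ g (curve₂ k₀ γ t) ∧
    ∀ᶠ k in 𝓝[cutPlane k₀ γ t] (curve₂ k₀ γ t), W k j 1 = g k
  /-- `W_-` grows no faster than `|k - (k₀ + b)|^{Re λ(b)}` plus a bounded term there. -/
  end₂_minus : ∀ j : Fin 2, (fun k => W k j 0) =O[𝓝[cutPlane k₀ γ t] (curve₂ k₀ γ t)]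
    fun k => ‖k - curve₂ k₀ γ t‖ ^ (lam t).re + 1

/-- The matrix `Π(k) = diag (e^{-iak}, e^{iak})`. -/
def PiMat (a : ℝ) (k : ℂ) : Mat := !![exp (-I * a * k), 0; 0, exp (I * a * k)]

end ImpedanceStrip

end

/-! Fix one row of a solution and strip the exponentials: `p(k) = W_-(k) e^{iak}`, `y(k) = W_+(-k)
e^{iak}`. The connection matrices leave `W_-` without a jump on the lower cut and `W_+` without a
jump on the upper one, so both `p` and `y` are analytic off the upper cut alone and tend to the
constants `δ` at infinity (`IsSolution.exists_pair`). Across that cut `p_R = m p_L + B / (iξ - η) ·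
e^{2iak} y(-k)`, and the same holds with `p` and `y` exchanged. When the end `e = k₀ + b` is far up,
`m - 1 = O(1/|k|)` and `e^{2iak}` is exponentially small on the cut, so the jumps nearly vanish and
`p`, `y` should be nearly constant.

To make this quantitative without singular integrals, one solves the jump locally. In a half-strip
around the cut, `r = (p - q) / exp(λ̂ Log(k² - e²))`, with `q` an explicit particular solution and
`λ̂` the continued exponent, has no jump. The tip is a removable singularity, so `r` is analytic
(`IsScalarSolution.exists_regularization`). Moreover `p - r = O((Im k)^{-3/4}) (|p| + |y(-k)|)`
(`exists_forall_norm_sub_le`). Thus `p` outside the half-strip and `r` inside form an almost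
analytic whole with a common limit `c` at infinity, and Cauchy's formula gives `|p - c| ≤ ε N`,
where `N` bounds `p` and `y` off the half-strip (`norm_sub_le_of_cousin`, `eventually_norm_sub_le`).
The same bound for `y` lets `N` be absorbed (`eventually_pair_norm_sub_le`).

A fixed `k` and its negative eventually lie below the half-strip, which gives the pointwise limit.
The two cases differ only in the entire function `B`, of at most linear growth. -/

namespace ImpedanceStrip

/-! ### Analytic continuation across a cut, and limits along dense sets -/

open scoped Interval

/-- Morera: a rectangle crossed by the line is split along it. In each half Cauchy's theorem needs
differentiability in the open rectangle only, and continuity up to the boundary. -/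
theorem differentiableOn_ball_of_off_horizontal_line {f : ℂ → ℂ} {c : ℂ} {r b : ℝ}
    (hc : ContinuousOn f (Metric.ball c r))
    (hd : ∀ z ∈ Metric.ball c r, z.im ≠ b → DifferentiableAt ℂ f z) :
    DifferentiableOn ℂ f (Metric.ball c r) := by
  refine (isConservativeOn_and_continuousOn_iff_isDifferentiableOn Metric.isOpen_ball).1 ⟨?_, hc⟩
  intro z w hzw
  rw [← add_eq_zero_iff_eq_neg, wedgeIntegral_add_wedgeIntegral_eq]
  have hzw' : ([[z.re, w.re]] ×ℂ [[z.im, w.im]]) ⊆ Metric.ball c r := hzw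
  -- a rectangle whose interior misses the line
  have key : ∀ z w : ℂ, ([[z.re, w.re]] ×ℂ [[z.im, w.im]]) ⊆ Metric.ball c r →
      b ∉ Ioo (min z.im w.im) (max z.im w.im) →
      (∫ x : ℝ in z.re..w.re, f (x + z.im * I)) - (∫ x : ℝ in z.re..w.re, f (x + w.im * I)) +
      I • (∫ y : ℝ in z.im..w.im, f (w.re + y * I)) -
      I • (∫ y : ℝ in z.im..w.im, f (z.re + y * I)) = 0 := by
    intro z w h hb
    refine integral_boundary_rect_eq_zero_of_continuousOn_of_differentiableOn f z w (hc.mono h) ?_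
    intro k hk
    refine (hd k (h ?_) ?_).differentiableWithinAt
    · exact ⟨Ioo_subset_Icc_self hk.1, Ioo_subset_Icc_self hk.2⟩
    · rintro rfl
      exact hb hk.2
  by_cases hb : b ∈ Ioo (min z.im w.im) (max z.im w.im)
  · have hb' : b ∈ [[z.im, w.im]] := Ioo_subset_Icc_self hb
    have h1 := key z (w.re + b * I) (by
      refine Subset.trans ?_ hzw'
      rintro k ⟨hk1, hk2⟩
      simp only [mem_preimage, add_re, ofReal_re, mul_re, I_re, mul_zero, ofReal_im, I_im, mul_one,
        sub_self, add_zero, add_im, mul_im, zero_add] at hk1 hk2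
      exact ⟨hk1, uIcc_subset_uIcc_left hb' hk2⟩) (by
      simp only [add_im, ofReal_im, mul_im, ofReal_re, I_im, mul_one, I_re, mul_zero, add_zero,
        zero_add]
      rintro ⟨h1, h2⟩
      rcases le_total z.im b with h | h
      · simp [h] at h2
      · simp [h] at h1)
    have h2 := key (z.re + b * I) w (by
      refine Subset.trans ?_ hzw'
      rintro k ⟨hk1, hk2⟩
      simp only [mem_preimage, add_re, ofReal_re, mul_re, I_re, mul_zero, ofReal_im, I_im, mul_one,
        sub_self, add_zero, add_im, mul_im, zero_add] at hk1 hk2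
      exact ⟨hk1, uIcc_subset_uIcc_right hb' hk2⟩) (by
      simp only [add_im, ofReal_im, mul_im, ofReal_re, I_im, mul_one, I_re, mul_zero, add_zero,
        zero_add]
      rintro ⟨h1, h2⟩
      rcases le_total w.im b with h | h
      · simp [h] at h2
      · simp [h] at h1)
    simp only [add_re, ofReal_re, mul_re, I_re, mul_zero, ofReal_im, I_im, mul_one,
        sub_self, add_zero, add_im, mul_im, zero_add] at h1 h2
    have hv : ∀ x ∈ [[z.re, w.re]], ∀ y₁ ∈ [[z.im, w.im]], ∀ y₂ ∈ [[z.im, w.im]],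
        IntervalIntegrable (fun y : ℝ => f (x + y * I)) MeasureTheory.volume y₁ y₂ := by
      intro x hx y₁ h₁ y₂ h₂
      refine ContinuousOn.intervalIntegrable (hc.comp (by fun_prop) ?_)
      intro y hy
      refine hzw' ⟨?_, ?_⟩
      · simpa using hx
      · simpa using (uIcc_subset_uIcc h₁ h₂) hy
    rw [← intervalIntegral.integral_add_adjacent_intervals
        (hv w.re right_mem_uIcc _ left_mem_uIcc _ hb') (hv w.re right_mem_uIcc _ hb' _ right_mem_uIcc),
      ← intervalIntegral.integral_add_adjacent_intervals
        (hv z.re left_mem_uIcc _ left_mem_uIcc _ hb') (hv z.re left_mem_uIcc _ hb' _ right_mem_uIcc)]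
    simp only [smul_add]
    linear_combination h1 + h2
  · exact key z w hzw' hb

/-- Painlevé's theorem for a set on which `Im k²` is constant. -/
theorem differentiableOn_extendFrom {f : ℂ → ℂ} {Ω S : Set ℂ} {b : ℝ} (hΩ : IsOpen Ω)
    (hS : IsClosed S) (hdense : Dense Sᶜ) (hsub : ∀ k ∈ Ω ∩ S, 0 < k.im ∧ (k ^ 2).im = b)
    (hd : DifferentiableOn ℂ f (Ω \ S))
    (hl : ∀ k ∈ Ω ∩ S, ∃ l, Tendsto f (𝓝[Sᶜ] k) (𝓝 l)) :
    DifferentiableOn ℂ (extendFrom Sᶜ f) Ω ∧ ∀ k ∈ Ω \ S, extendFrom Sᶜ f k = f k := by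
  have hopen : IsOpen (Ω \ S) := hΩ.sdiff hS
  have hlim : ∀ k ∈ Ω \ S, Tendsto f (𝓝[Sᶜ] k) (𝓝 (f k)) := by
    intro k hk
    have := (hd.differentiableAt (hopen.mem_nhds hk)).continuousAt
    exact this.tendsto.mono_left nhdsWithin_le_nhds
  have heq : ∀ k ∈ Ω \ S, extendFrom Sᶜ f k = f k := fun k hk =>
    extendFrom_eq (hdense k) (hlim k hk)
  have hcont : ContinuousOn (extendFrom Sᶜ f) Ω := by
    refine continuousOn_extendFrom (fun k _ => hdense k) ?_
    intro k hk
    by_cases hkS : k ∈ S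
    · exact hl k ⟨hk, hkS⟩
    · exact ⟨_, hlim k ⟨hk, hkS⟩⟩
  have hdiff : ∀ k ∈ Ω \ S, DifferentiableAt ℂ (extendFrom Sᶜ f) k := by
    intro k hk
    refine (hd.differentiableAt (hopen.mem_nhds hk)).congr_of_eventuallyEq ?_
    filter_upwards [hopen.mem_nhds hk] with k' hk' using heq k' hk'
  refine ⟨?_, heq⟩
  intro k₁ hk₁
  by_cases hkS : k₁ ∈ S
  swap
  · exact (hdiff k₁ ⟨hk₁, hkS⟩).differentiableWithinAt
  obtain ⟨him, hb⟩ := hsub k₁ ⟨hk₁, hkS⟩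
  -- the local inverse of `k ↦ k ^ 2` in the upper half-plane
  set φ : ℂ → ℂ := fun w => I * (-w) ^ (1 / 2 : ℂ) with hφ
  have hslit : ∀ k : ℂ, 0 < k.im → -(k ^ 2) ∈ slitPlane := by
    intro k hk
    rw [mem_slitPlane_iff]
    by_cases hre : k.re = 0
    · left
      simp [pow_two, hre]
      exact hk.ne'
    · right
      simp [pow_two]
      rintro h
      have : k.re * k.im = 0 := by linarith
      rcases mul_eq_zero.1 this with h | h
      · exact hre h
      · exact hk.ne' h
  have hφsq : ∀ k : ℂ, 0 < k.im → φ (k ^ 2) = k := by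
    intro k hk
    have h1 : -(k ^ 2) = (-I * k) ^ 2 := by
      rw [mul_pow]; simp
    have h2 : (-I * k).arg ∈ Ioc (-(Real.pi / 2)) (Real.pi / 2) := by
      have : 0 < (-I * k).re := by simpa using hk
      have := Complex.abs_arg_lt_pi_div_two_iff.2 (Or.inl this)
      exact ⟨(abs_lt.1 this).1, (abs_lt.1 this).2.le⟩
    simp only [hφ]
    rw [h1]
    have h3 : ((-I * k) ^ 2) ^ (1 / 2 : ℂ) = -I * k := by
      have := Complex.pow_cpow_nat_inv (x := -I * k) (n := 2) (by norm_num)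
        (by have := h2.1; push_cast; linarith) (by have := h2.2; push_cast; linarith)
      simpa using this
    rw [h3, ← mul_assoc]
    simp
  have hφd : ∀ w : ℂ, -w ∈ slitPlane → DifferentiableAt ℂ φ w := by
    intro w hw
    refine DifferentiableAt.const_mul ?_ I
    exact (differentiableAt_id.neg).cpow_const hw
  have hφc : ContinuousAt φ (k₁ ^ 2) := (hφd _ (hslit _ him)).continuousAt
  have hφsq' : ∀ w : ℂ, φ w ^ 2 = w := by
    intro w
    simp only [hφ, mul_pow, I_sq]
    rw [← Complex.cpow_nat_mul]
    simp
  have hev : ∀ᶠ w in 𝓝 (k₁ ^ 2), φ w ∈ Ω ∧ -w ∈ slitPlane := by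
    refine Filter.Eventually.and ?_ ?_
    · apply hφc
      rw [hφsq _ him]
      exact hΩ.mem_nhds hk₁
    · exact (continuous_neg.continuousAt (x := k₁ ^ 2)).eventually
        (isOpen_slitPlane.mem_nhds (hslit _ him))
  obtain ⟨r, hr, hball⟩ := Metric.eventually_nhds_iff_ball.1 hev
  -- In the coordinate `w = k²` the exceptional set lies on the line `Im w = b`.
  have hG : DifferentiableOn ℂ (fun w => extendFrom Sᶜ f (φ w)) (Metric.ball (k₁ ^ 2) r) := by
    refine differentiableOn_ball_of_off_horizontal_line (b := b) ?_ ?_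
    · intro w hw
      have h := hball w hw
      exact ((hcont.continuousAt (hΩ.mem_nhds h.1)).comp
        (hφd w h.2).continuousAt).continuousWithinAt
    · intro w hw hwb
      have h := hball w hw
      refine DifferentiableAt.comp w (hdiff _ ⟨h.1, ?_⟩) (hφd w h.2)
      intro hSw
      have := (hsub _ ⟨h.1, hSw⟩).2
      rw [hφsq'] at this
      exact hwb this
  have hG' : DifferentiableAt ℂ (fun w => extendFrom Sᶜ f (φ w)) (k₁ ^ 2) :=
    hG.differentiableAt (Metric.ball_mem_nhds _ hr)
  have hcomp : DifferentiableAt ℂ (fun k => extendFrom Sᶜ f (φ (k ^ 2))) k₁ :=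
    DifferentiableAt.comp (g := fun w => extendFrom Sᶜ f (φ w)) (f := fun k : ℂ => k ^ 2) k₁ hG'
      (by fun_prop)
  refine (hcomp.congr_of_eventuallyEq ?_).differentiableWithinAt
  have : ∀ᶠ k : ℂ in 𝓝 k₁, 0 < k.im :=
    Complex.continuous_im.continuousAt.eventually (lt_mem_nhds him)
  filter_upwards [this] with k hk
  rw [hφsq k hk]

/-- A limit at infinity along a dense subset is a limit at infinity. -/
theorem tendsto_cobounded_of_dense {f : ℂ → ℂ} {A Ω : Set ℂ} {c : ℂ}
    (hΩ : IsOpen Ω) (hdense : Dense A) (hcont : ContinuousOn f Ω)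
    (h : Tendsto f (Bornology.cobounded ℂ ⊓ 𝓟 (Ω ∩ A)) (𝓝 c)) :
    Tendsto f (Bornology.cobounded ℂ ⊓ 𝓟 Ω) (𝓝 c) := by
  -- Closed neighbourhoods are used because membership then passes to the limit along the dense set.
  rw [(closed_nhds_basis c).tendsto_right_iff]
  rintro C ⟨hC, hCc⟩
  have h1 := h.eventually hC
  rw [eventually_inf_principal] at h1 ⊢
  obtain ⟨R, -, hR⟩ := (Metric.hasBasis_cobounded_compl_closedBall (0 : ℂ)).eventually_iff.1 h1
  rw [(Metric.hasBasis_cobounded_compl_closedBall (0 : ℂ)).eventually_iff]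
  refine ⟨R, trivial, fun k hk hkΩ => ?_⟩
  have hne : (𝓝[A] k).NeBot := mem_closure_iff_nhdsWithin_neBot.1 (hdense k)
  refine hCc.mem_of_tendsto
    ((hcont.continuousAt (hΩ.mem_nhds hkΩ)).tendsto.mono_left (nhdsWithin_le_nhds (s := A))) ?_
  have hopen : (Metric.closedBall (0 : ℂ) R)ᶜ ∈ 𝓝 k :=
    Metric.isClosed_closedBall.isOpen_compl.mem_nhds hk
  filter_upwards [nhdsWithin_le_nhds hopen, nhdsWithin_le_nhds (hΩ.mem_nhds hkΩ),
    self_mem_nhdsWithin] with k' h1 h2 h3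
  exact hR h1 ⟨h2, h3⟩

/-! ### A Cauchy integral estimate for a half-strip -/

theorem norm_integral_add_mul_integral_inv_le {g : ℂ → ℂ} {φ : ℝ → ℂ} {z B : ℂ} {a b M : ℝ}
    (hab : a ≤ b) (hφ : Continuous φ) (hg : ∀ x ∈ Icc a b, ContinuousAt g (φ x))
    (hz : ∀ x ∈ Icc a b, φ x ≠ z) (hM : ∀ x ∈ Icc a b, ‖g (φ x) + B * (φ x - z)⁻¹‖ ≤ M) :
    ‖(∫ x in a..b, g (φ x)) + B * ∫ x in a..b, (φ x - z)⁻¹‖ ≤ M * (b - a) := by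
  have h1 : IntervalIntegrable (fun x => g (φ x)) MeasureTheory.volume a b := by
    refine ContinuousOn.intervalIntegrable fun x hx => ?_
    rw [uIcc_of_le hab] at hx
    exact ((hg x hx).comp hφ.continuousAt).continuousWithinAt
  have h2 : IntervalIntegrable (fun x => (φ x - z)⁻¹) MeasureTheory.volume a b := by
    refine ContinuousOn.intervalIntegrable fun x hx => ?_
    rw [uIcc_of_le hab] at hx
    have : ContinuousAt (fun x => φ x - z) x := by fun_prop
    exact (this.inv₀ (sub_ne_zero.2 (hz x hx))).continuousWithinAt
  rw [← intervalIntegral.integral_const_mul, ← intervalIntegral.integral_add h1 (h2.const_mul B)]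
  have := intervalIntegral.norm_integral_le_of_norm_le_const (a := a) (b := b) (C := M)
    (f := fun x => g (φ x) + B * (φ x - z)⁻¹) (by
      intro x hx
      rw [uIoc_of_le hab] at hx
      exact hM x (Ioc_subset_Icc_self hx))
  rwa [abs_of_nonneg (by linarith)] at this

/-- Applied on each side of a large square around `z`, this replaces the exact value `2πi` of the
contour integral of `1/(k - z)`: only a positive lower bound is needed. -/
theorem le_im_mul_integral_inv {φ : ℝ → ℂ} {z e : ℂ} {a b m : ℝ}
    (hab : a ≤ b) (hφ : Continuous φ) (hz : ∀ x ∈ Icc a b, φ x ≠ z)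
    (hm : ∀ x ∈ Icc a b, m ≤ (e * (φ x - z)⁻¹).im) :
    m * (b - a) ≤ (e * ∫ x in a..b, (φ x - z)⁻¹).im := by
  have h2 : IntervalIntegrable (fun x => e * (φ x - z)⁻¹) MeasureTheory.volume a b := by
    refine ContinuousOn.intervalIntegrable fun x hx => ?_
    rw [uIcc_of_le hab] at hx
    have : ContinuousAt (fun x => φ x - z) x := by fun_prop
    exact (continuousAt_const.mul (this.inv₀ (sub_ne_zero.2 (hz x hx)))).continuousWithinAt
  rw [← intervalIntegral.integral_const_mul]
  have h3 := Complex.imCLM.intervalIntegral_comp_comm h2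
  simp only [imCLM_apply] at h3
  rw [← h3]
  have h4 : IntervalIntegrable (fun x => (e * (φ x - z)⁻¹).im) MeasureTheory.volume a b :=
    ⟨imCLM.integrable_comp h2.1, imCLM.integrable_comp h2.2⟩
  have := intervalIntegral.integral_mono_on hab
    (intervalIntegrable_const (μ := MeasureTheory.volume) (c := m)) h4 hm
  simpa [mul_comm] using this

/-- Evaluate both factors at the smaller argument. The product of a decay measured from the bottom
of the half-strip and a Cauchy kernel measured from `z` is thereby integrable with a bound
independent of both positions. -/
theorem rpow_mul_inv_le {s t : ℝ} (hs : 1 ≤ s) (ht : 1 ≤ t) :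
    s ^ (-(1 / 2) : ℝ) * t⁻¹ ≤ s ^ (-(3 / 2) : ℝ) + t ^ (-(3 / 2) : ℝ) := by
  have hs0 : 0 < s := by linarith
  have ht0 : 0 < t := by linarith
  have e1 : ∀ {x : ℝ}, 0 < x → x ^ (-(3 / 2) : ℝ) = x ^ (-(1 / 2) : ℝ) * x⁻¹ := by
    intro x hx
    rw [← Real.rpow_neg_one x, ← Real.rpow_add hx]
    norm_num
  rcases le_total s t with h | h
  · have : t⁻¹ ≤ s⁻¹ := inv_anti₀ hs0 h
    calc _ ≤ s ^ (-(1 / 2) : ℝ) * s⁻¹ := by gcongr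
      _ = s ^ (-(3 / 2) : ℝ) := (e1 hs0).symm
      _ ≤ _ := le_add_of_nonneg_right (by positivity)
  · have : s ^ (-(1 / 2) : ℝ) ≤ t ^ (-(1 / 2) : ℝ) :=
      Real.rpow_le_rpow_of_nonpos ht0 h (by norm_num)
    calc _ ≤ t ^ (-(1 / 2) : ℝ) * t⁻¹ := by gcongr
      _ = t ^ (-(3 / 2) : ℝ) := (e1 ht0).symm
      _ ≤ _ := le_add_of_nonneg_left (by positivity)

/-- The integral `∫ (1 + |x|) ^ (-3/2) dx`. -/
noncomputable def japaneseConst : ℝ := ∫ x : ℝ, (1 + ‖x‖) ^ (-(3 / 2) : ℝ)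

theorem integrable_japanese : MeasureTheory.Integrable fun x : ℝ => (1 + ‖x‖) ^ (-(3 / 2) : ℝ) :=
  integrable_one_add_norm (by norm_num)

theorem japaneseConst_nonneg : 0 ≤ japaneseConst :=
  MeasureTheory.integral_nonneg fun x => by positivity

theorem intervalIntegral_japanese_le {a b c : ℝ} (hab : a ≤ b) :
    ∫ x in a..b, (1 + ‖x - c‖) ^ (-(3 / 2) : ℝ) ≤ japaneseConst := by
  rw [intervalIntegral.integral_of_le hab, japaneseConst,
    ← MeasureTheory.integral_sub_right_eq_self (fun x : ℝ => (1 + ‖x‖) ^ (-(3 / 2) : ℝ)) c]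
  exact MeasureTheory.setIntegral_le_integral (integrable_japanese.comp_sub_right c)
    (Eventually.of_forall fun x => by positivity)

theorem norm_integral_le_japanese {u : ℝ → ℂ} {a b c d ε : ℝ} (hab : a ≤ b) (hε : 0 ≤ ε)
    (hu : ∀ x ∈ Icc a b, ‖u x‖ ≤
      ε * ((1 + ‖x - c‖) ^ (-(3 / 2) : ℝ) + (1 + ‖x - d‖) ^ (-(3 / 2) : ℝ))) :
    ‖∫ x in a..b, u x‖ ≤ 2 * japaneseConst * ε := by
  have hi : ∀ c : ℝ, IntervalIntegrable (fun x : ℝ => (1 + ‖x - c‖) ^ (-(3 / 2) : ℝ))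
      MeasureTheory.volume a b := fun c =>
    (integrable_japanese.comp_sub_right c).intervalIntegrable
  have h1 := intervalIntegral.norm_integral_le_of_norm_le (μ := MeasureTheory.volume) hab
    (f := u) (g := fun x => ε * ((1 + ‖x - c‖) ^ (-(3 / 2) : ℝ) + (1 + ‖x - d‖) ^ (-(3 / 2) : ℝ)))
    (Eventually.of_forall fun x hx => hu x (Ioc_subset_Icc_self hx))
    (((hi c).add (hi d)).const_mul ε)
  rw [intervalIntegral.integral_const_mul, intervalIntegral.integral_add (hi c) (hi d)] at h1
  refine h1.trans ?_
  have h2 := intervalIntegral_japanese_le (c := c) hab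
  have h3 := intervalIntegral_japanese_le (c := d) hab
  nlinarith

/-- The closed half-strip of half-width `w` above the height `Y`. -/
def halfStrip (w Y : ℝ) : Set ℂ := {k | |k.re| ≤ w ∧ Y ≤ k.im}

/-- The complement of the interior of `halfStrip w Y`. -/
def coHalfStrip (w Y : ℝ) : Set ℂ := {k | ¬ (|k.re| < w ∧ Y < k.im)}

/-- Cauchy's theorem on four rectangles: below, left and right of the half-strip for `g`, and the
truncated half-strip for `h`. The common edges carry `g - h`. -/
theorem integral_boundary_halfStrip {g h : ℂ → ℂ} {w Y X : ℝ} (hw : 0 < w) (hwX : w ≤ X)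
    (hYX : |Y| ≤ X)
    (hg : ∀ k ∈ coHalfStrip w Y, DifferentiableAt ℂ g k)
    (hh : ∀ k ∈ halfStrip w Y, DifferentiableAt ℂ h k) :
    (∫ x : ℝ in -X..X, g (x + (-X : ℝ) * I)) - (∫ x : ℝ in -X..-w, g (x + X * I))
      - (∫ x : ℝ in -w..w, h (x + X * I)) - (∫ x : ℝ in w..X, g (x + X * I))
      + I * (∫ y : ℝ in -X..X, g (X + y * I)) - I * (∫ y : ℝ in -X..X, g ((-X : ℝ) + y * I))
      = (∫ x : ℝ in -w..w, (g (x + Y * I) - h (x + Y * I)))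
        - I * (∫ y : ℝ in Y..X, (g ((-w : ℝ) + y * I) - h ((-w : ℝ) + y * I)))
        + I * (∫ y : ℝ in Y..X, (g (w + y * I) - h (w + y * I))) := by
  obtain ⟨hY1, hY2⟩ := abs_le.1 hYX
  have rect : ∀ {f : ℂ → ℂ} (a b y₁ y₂ : ℝ), a ≤ b → y₁ ≤ y₂ →
      (∀ k : ℂ, a ≤ k.re → k.re ≤ b → y₁ ≤ k.im → k.im ≤ y₂ → DifferentiableAt ℂ f k) →
      (∫ x : ℝ in a..b, f (x + y₁ * I)) - (∫ x : ℝ in a..b, f (x + y₂ * I))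
      + I * (∫ y : ℝ in y₁..y₂, f (b + y * I)) - I * (∫ y : ℝ in y₁..y₂, f (a + y * I)) = 0 := by
    intro f a b y₁ y₂ hab hy hf
    have := integral_boundary_rect_eq_zero_of_differentiableOn f (a + y₁ * I) (b + y₂ * I) (by
      intro k hk
      simp only [add_re, ofReal_re, mul_re, I_re, mul_zero, ofReal_im, I_im, mul_one,
        sub_self, add_zero, add_im, mul_im, zero_add, uIcc_of_le hab, uIcc_of_le hy] at hk
      exact (hf k hk.1.1 hk.1.2 hk.2.1 hk.2.2).differentiableWithinAt)
    simpa using this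
  have b1 := rect (f := g) (-X) X (-X) Y (by linarith) (by linarith) (fun k _ _ _ h4 =>
    hg k fun h => by linarith [h.2])
  have b2 := rect (f := g) (-X) (-w) Y X (by linarith) (by linarith) (fun k _ h2 _ _ =>
    hg k fun h => by linarith [(abs_lt.1 h.1).1])
  have b3 := rect (f := g) w X Y X (by linarith) (by linarith) (fun k h1 _ _ _ =>
    hg k fun h => by linarith [(abs_lt.1 h.1).2])
  have b4 := rect (f := h) (-w) w Y X (by linarith) (by linarith) (fun k h1 h2 h3 _ =>
    hh k ⟨abs_le.2 ⟨h1, h2⟩, h3⟩)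
  have hgH : ∀ (y a b : ℝ), a ≤ b → (∀ x ∈ Icc a b, (x : ℂ) + y * I ∈ coHalfStrip w Y) →
      IntervalIntegrable (fun x : ℝ => g (x + y * I)) MeasureTheory.volume a b := by
    intro y a b hab hx
    refine ContinuousOn.intervalIntegrable fun x hx' => ?_
    rw [uIcc_of_le hab] at hx'
    exact (ContinuousAt.comp (g := g) (f := fun x : ℝ => (x : ℂ) + y * I)
      (hg _ (hx x hx')).continuousAt (by fun_prop)).continuousWithinAt
  have hgV : ∀ (x a b : ℝ), a ≤ b → (∀ y ∈ Icc a b, (x : ℂ) + y * I ∈ coHalfStrip w Y) →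
      IntervalIntegrable (fun y : ℝ => g (x + y * I)) MeasureTheory.volume a b := by
    intro y a b hab hx
    refine ContinuousOn.intervalIntegrable fun x hx' => ?_
    rw [uIcc_of_le hab] at hx'
    exact (ContinuousAt.comp (g := g) (f := fun x : ℝ => (y : ℂ) + x * I)
      (hg _ (hx x hx')).continuousAt (by fun_prop)).continuousWithinAt
  have hhH : ∀ (y a b : ℝ), a ≤ b → (∀ x ∈ Icc a b, (x : ℂ) + y * I ∈ halfStrip w Y) →
      IntervalIntegrable (fun x : ℝ => h (x + y * I)) MeasureTheory.volume a b := by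
    intro y a b hab hx
    refine ContinuousOn.intervalIntegrable fun x hx' => ?_
    rw [uIcc_of_le hab] at hx'
    exact (ContinuousAt.comp (g := h) (f := fun x : ℝ => (x : ℂ) + y * I)
      (hh _ (hx x hx')).continuousAt (by fun_prop)).continuousWithinAt
  have hhV : ∀ (x a b : ℝ), a ≤ b → (∀ y ∈ Icc a b, (x : ℂ) + y * I ∈ halfStrip w Y) →
      IntervalIntegrable (fun y : ℝ => h (x + y * I)) MeasureTheory.volume a b := by
    intro y a b hab hx
    refine ContinuousOn.intervalIntegrable fun x hx' => ?_
    rw [uIcc_of_le hab] at hx'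
    exact (ContinuousAt.comp (g := h) (f := fun x : ℝ => (y : ℂ) + x * I)
      (hh _ (hx x hx')).continuousAt (by fun_prop)).continuousWithinAt
  have m1 : ∀ x y : ℝ, y ≤ Y → (x : ℂ) + y * I ∈ coHalfStrip w Y := by
    intro x y hy h
    have := h.2
    simp at this
    linarith
  have m2 : ∀ x y : ℝ, w ≤ |x| → (x : ℂ) + y * I ∈ coHalfStrip w Y := by
    intro x y hy h
    have := h.1
    simp at this
    linarith
  have m3 : ∀ x y : ℝ, |x| ≤ w → Y ≤ y → (x : ℂ) + y * I ∈ halfStrip w Y := by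
    intro x y hx hy
    constructor
    · simpa using hx
    · simpa using hy
  have aw : w ≤ |(-w)| := by rw [abs_neg]; exact le_abs_self w
  have aX : w ≤ |X| := hwX.trans (le_abs_self X)
  have aX' : w ≤ |(-X)| := by rw [abs_neg]; exact aX
  have haw : |w| ≤ w := (abs_of_pos hw).le
  have haw' : |(-w)| ≤ w := by rw [abs_neg]; exact haw
  rw [intervalIntegral.integral_sub (hgH Y (-w) w (by linarith) fun x _ => m1 x Y le_rfl)
      (hhH Y (-w) w (by linarith) fun x hx => m3 x Y (abs_le.2 hx) le_rfl),
    intervalIntegral.integral_sub (hgV (-w) Y X hY2 fun y _ => m2 _ _ aw)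
      (hhV (-w) Y X hY2 fun y hy => m3 _ _ haw' hy.1),
    intervalIntegral.integral_sub (hgV w Y X hY2 fun y _ => m2 _ _ (le_abs_self w))
      (hhV w Y X hY2 fun y hy => m3 _ _ haw hy.1)]
  have s1 := intervalIntegral.integral_add_adjacent_intervals
    (hgV X (-X) Y hY1 fun y _ => m2 _ _ aX) (hgV X Y X hY2 fun y _ => m2 _ _ aX)
  have s2 := intervalIntegral.integral_add_adjacent_intervals
    (hgV (-X) (-X) Y hY1 fun y _ => m2 _ _ aX') (hgV (-X) Y X hY2 fun y _ => m2 _ _ aX')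
  have s3 := intervalIntegral.integral_add_adjacent_intervals
    (hgH Y (-X) (-w) (by linarith) fun x _ => m1 _ _ le_rfl)
    (hgH Y (-w) w (by linarith) fun x _ => m1 _ _ le_rfl)
  have s4 := intervalIntegral.integral_add_adjacent_intervals
    (hgH Y (-X) w (by linarith) fun x _ => m1 _ _ le_rfl)
    (hgH Y w X (by linarith) fun x _ => m1 _ _ le_rfl)
  linear_combination b1 + b2 + b3 + b4 - I * s1 + I * s2 - s3 - s4

theorem exists_norm_le_of_tendsto_cobounded {f : ℂ → ℂ} {S : Set ℂ} {c : ℂ}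
    (h : Tendsto f (Bornology.cobounded ℂ ⊓ 𝓟 S) (𝓝 c)) {ε : ℝ} (hε : 0 < ε) :
    ∃ R : ℝ, ∀ k ∈ S, R < ‖k‖ → ‖f k - c‖ ≤ ε := by
  have h1 := h.eventually (Metric.closedBall_mem_nhds c hε)
  rw [eventually_inf_principal] at h1
  obtain ⟨R, -, hR⟩ := (Metric.hasBasis_cobounded_compl_closedBall (0 : ℂ)).eventually_iff.1 h1
  refine ⟨R, fun k hk hkR => ?_⟩
  have := hR (x := k) (by simpa using hkR) hk
  simpa [dist_eq_norm] using this

/-- If functions regular outside and inside a half-strip have the same limit `c` at infinity and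
differ little on its boundary, then both are close to `c` away from the boundary. Here `A` is the
value at `z` of the one that is regular at `z`; `g` and `h` are the difference quotients. -/
theorem norm_sub_le_of_cousin {p r g h : ℂ → ℂ} {A c z : ℂ} {w Y ε : ℝ} (hw : 0 < w) (hε : 0 ≤ ε)
    (hg : ∀ k ∈ coHalfStrip w Y, DifferentiableAt ℂ g k)
    (hh : ∀ k ∈ halfStrip w Y, DifferentiableAt ℂ h k)
    (hpg : ∀ k ∈ coHalfStrip w Y, p k - A = (k - z) * g k)
    (hrh : ∀ k ∈ halfStrip w Y, r k - A = (k - z) * h k)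
    (hp : Tendsto p (Bornology.cobounded ℂ ⊓ 𝓟 (coHalfStrip w Y)) (𝓝 c))
    (hr : Tendsto r (Bornology.cobounded ℂ ⊓ 𝓟 (halfStrip w Y)) (𝓝 c))
    (hδ : ∀ k ∈ halfStrip w Y ∩ coHalfStrip w Y,
      ‖p k - r k‖ ≤ ε * (1 + (k.im - Y)) ^ (-(1 / 2) : ℝ))
    (hz : ∀ k ∈ halfStrip w Y ∩ coHalfStrip w Y, 1 ≤ ‖k - z‖) :
    ‖A - c‖ ≤ 2 * (2 * w + 8 * japaneseConst) * ε := by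
  have hJ := japaneseConst_nonneg
  -- the integral along the boundary of the half-strip
  have hgh : ∀ k ∈ halfStrip w Y ∩ coHalfStrip w Y,
      ‖g k - h k‖ = ‖p k - r k‖ * ‖k - z‖⁻¹ := by
    intro k hk
    have h0 : 0 < ‖k - z‖ := by linarith [hz k hk]
    have : p k - r k = (k - z) * (g k - h k) := by
      linear_combination hpg k hk.2 - hrh k hk.1
    rw [this, norm_mul]
    field_simp
  have hbot : ‖∫ x : ℝ in -w..w, (g (x + Y * I) - h (x + Y * I))‖ ≤ 2 * w * ε := by
    have := intervalIntegral.norm_integral_le_of_norm_le_const (a := -w) (b := w) (C := ε)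
      (f := fun x : ℝ => g (x + Y * I) - h (x + Y * I)) (by
        intro x hx
        rw [uIoc_of_le (by linarith)] at hx
        have hk : (x : ℂ) + Y * I ∈ halfStrip w Y ∩ coHalfStrip w Y := by
          constructor
          · constructor
            · simpa using abs_le.2 (Ioc_subset_Icc_self hx)
            · simp
          · intro h
            have := h.2
            simp at this
        rw [hgh _ hk]
        have h1 := hδ _ hk
        have h2 := hz _ hk
        have h3 : (((x : ℂ) + Y * I).im - Y) = 0 := by simp
        rw [h3, add_zero, Real.one_rpow, mul_one] at h1
        have h4 := inv_le_one_of_one_le₀ h2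
        calc _ ≤ ε * 1 := mul_le_mul h1 h4 (by positivity) hε
          _ = ε := mul_one _)
    rw [abs_of_nonneg (by linarith)] at this
    linarith
  have hver : ∀ (v X : ℝ), |v| = w → Y ≤ X →
      ‖∫ y : ℝ in Y..X, (g (v + y * I) - h (v + y * I))‖ ≤ 2 * japaneseConst * (2 * ε) := by
    intro v X hv hX
    refine norm_integral_le_japanese (c := Y) (d := z.im) hX (by linarith) ?_
    intro y hy
    have hk : (v : ℂ) + y * I ∈ halfStrip w Y ∩ coHalfStrip w Y := by
      constructor
      · constructor
        · simpa using hv.le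
        · simpa using hy.1
      · intro h
        have := h.1
        simp at this
        linarith
    have h0 : ((v : ℂ) + y * I).im = y := by simp
    have h1 := hδ _ hk
    have h2 := hz _ hk
    rw [h0] at h1
    have h3 : ‖y - z.im‖ ≤ ‖(v : ℂ) + y * I - z‖ := by
      have := Complex.abs_im_le_norm ((v : ℂ) + y * I - z)
      simpa using this
    -- The distance to `z` is at least `1` and at least `|y - Im z|`, hence at least half of their
    -- sum.
    have h4 : ‖(v : ℂ) + y * I - z‖⁻¹ ≤ 2 * (1 + ‖y - z.im‖)⁻¹ := by
      have hpos : 0 < 1 + ‖y - z.im‖ := by positivity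
      rw [← div_eq_mul_inv, inv_eq_one_div, div_le_div_iff₀ (by linarith) hpos]
      linarith
    have h5 : ‖y - Y‖ = y - Y := by
      rw [Real.norm_eq_abs, abs_of_nonneg (by linarith [hy.1])]
    rw [hgh _ hk]
    have h6 := rpow_mul_inv_le (s := 1 + ‖y - Y‖) (t := 1 + ‖y - z.im‖) (by simp) (by simp)
    calc _ ≤ (ε * (1 + ‖y - Y‖) ^ (-(1 / 2) : ℝ)) * (2 * (1 + ‖y - z.im‖)⁻¹) := by
          rw [h5]
          exact mul_le_mul h1 h4 (by positivity) (by have := hy.1; positivity)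
      _ = 2 * ε * ((1 + ‖y - Y‖) ^ (-(1 / 2) : ℝ) * (1 + ‖y - z.im‖)⁻¹) := by ring
      _ ≤ _ := mul_le_mul_of_nonneg_left h6 (by linarith)
  -- it remains to let the outer square grow
  refine le_of_forall_pos_le_add fun ε' hε' => ?_
  -- On the outer square `|k - z| ≥ X / 2`, so an error `ε'/32` becomes `ε'/(16X)` in the integrand
  -- and `ε'/2` over the perimeter `8X`.
  obtain ⟨R₁, hR₁⟩ := exists_norm_le_of_tendsto_cobounded hp (show 0 < ε' / 32 by linarith)
  obtain ⟨R₂, hR₂⟩ := exists_norm_le_of_tendsto_cobounded hr (show 0 < ε' / 32 by linarith)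
  obtain ⟨X, hX⟩ : ∃ X : ℝ, |R₁| + |R₂| + w + |Y| + 2 * ‖z‖ + 1 ≤ X := ⟨_, le_rfl⟩
  have e1 := abs_nonneg R₁
  have e2 := abs_nonneg R₂
  have e3 := abs_nonneg Y
  have e4 := norm_nonneg z
  have e5 := le_abs_self R₁
  have e6 := le_abs_self R₂
  have hX0 : 0 < X := by linarith
  have hzX : 2 * ‖z‖ ≤ X := by linarith
  have hYX := (le_abs_self Y).trans (show |Y| ≤ X by linarith)
  have hzre := abs_le.1 (Complex.abs_re_le_norm z)
  have hzim := abs_le.1 (Complex.abs_im_le_norm z)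
  have key := integral_boundary_halfStrip hw (show w ≤ X by linarith) (show |Y| ≤ X by linarith)
    hg hh
  have far : ∀ k : ℂ, X ≤ ‖k‖ → X / 2 ≤ ‖k - z‖ := fun k hk => by
    have := norm_sub_norm_le k z
    linarith
  have farne : ∀ k : ℂ, X ≤ ‖k‖ → k ≠ z := fun k hk h => by
    have := far k hk
    rw [h, sub_self, norm_zero] at this
    linarith
  have bound : ∀ (f q : ℂ → ℂ) (k : ℂ), X ≤ ‖k‖ → f k - A = (k - z) * q k → ‖f k - c‖ ≤ ε' / 32 →
      ‖q k + (A - c) * (k - z)⁻¹‖ ≤ ε' / (16 * X) := by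
    intro f q k hk hq hf
    have hne : k - z ≠ 0 := sub_ne_zero.2 (farne k hk)
    have : q k + (A - c) * (k - z)⁻¹ = (f k - c) * (k - z)⁻¹ := by
      field_simp
      linear_combination -hq
    rw [this, norm_mul, norm_inv]
    calc _ ≤ (ε' / 32) * (X / 2)⁻¹ :=
          mul_le_mul hf (inv_anti₀ (by linarith) (far k hk)) (by positivity) (by positivity)
      _ = _ := by field_simp; norm_num
  have boundg : ∀ k : ℂ, X ≤ ‖k‖ → k ∈ coHalfStrip w Y →
      ‖g k + (A - c) * (k - z)⁻¹‖ ≤ ε' / (16 * X) := fun k hk hk' =>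
    bound p g k hk (hpg k hk') (hR₁ k hk' (by linarith))
  have boundh : ∀ k : ℂ, X ≤ ‖k‖ → k ∈ halfStrip w Y →
      ‖h k + (A - c) * (k - z)⁻¹‖ ≤ ε' / (16 * X) := fun k hk hk' =>
    bound r h k hk (hrh k hk') (hR₂ k hk' (by linarith))
  have nre : ∀ x y : ℝ, |x| = X → X ≤ ‖(x : ℂ) + y * I‖ := fun x y hx => by
    have := Complex.abs_re_le_norm ((x : ℂ) + y * I)
    simp at this
    linarith
  have nim : ∀ x y : ℝ, |y| = X → X ≤ ‖(x : ℂ) + y * I‖ := fun x y hx => by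
    have := Complex.abs_im_le_norm ((x : ℂ) + y * I)
    simp at this
    linarith
  have aX : |X| = X := abs_of_pos hX0
  have aX' : |(-X)| = X := by rw [abs_neg, aX]
  -- Since `2‖z‖ ≤ X`, the point `z` is at distance at least `X/2` from each side, and `|k - z|² ≤ 2
  -- (3X/2)² = 9X²/2` on the square.
  have low : ∀ s q : ℝ, X / 2 ≤ s → 0 < q → q ≤ 9 * X ^ 2 / 2 → 1 / (9 * X) ≤ s / q := by
    intro s q hs hq hq'
    rw [div_le_div_iff₀ (by positivity) hq]
    nlinarith
  have nsq : ∀ x y : ℝ, |x| ≤ X → |y| ≤ X → X ≤ ‖(x : ℂ) + y * I‖ →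
      0 < normSq ((x : ℂ) + y * I - z) ∧ normSq ((x : ℂ) + y * I - z) ≤ 9 * X ^ 2 / 2 := by
    intro x y hx hy hk
    refine ⟨normSq_pos.2 (sub_ne_zero.2 (farne _ hk)), ?_⟩
    rw [normSq_apply]
    simp only [sub_re, add_re, ofReal_re, mul_re, I_re, mul_zero, ofReal_im, I_im, mul_one,
        sub_self, add_zero, sub_im, add_im, mul_im, zero_add]
    obtain ⟨h1, h2⟩ := abs_le.1 hx
    obtain ⟨h3, h4⟩ := abs_le.1 hy
    have h5 : (x - z.re) ^ 2 ≤ (3 * X / 2) ^ 2 := sq_le_sq' (by linarith) (by linarith)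
    have h6 : (y - z.im) ^ 2 ≤ (3 * X / 2) ^ 2 := sq_le_sq' (by linarith) (by linarith)
    nlinarith
  have imTop : ∀ x ∈ Icc (-X) X, 1 / (9 * X) ≤ ((-1 : ℂ) * ((x : ℂ) + X * I - z)⁻¹).im := by
    intro x hx
    obtain ⟨h1, h2⟩ := nsq x X (abs_le.2 hx) aX.le (nim x X aX)
    have := low (X - z.im) _ (by linarith) h1 h2
    rw [neg_one_mul, neg_im, inv_im, ← neg_div]
    convert this using 2
    simp
  have imBot : ∀ x ∈ Icc (-X) X, 1 / (9 * X) ≤ ((1 : ℂ) * ((x : ℂ) + (-X : ℝ) * I - z)⁻¹).im := by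
    intro x hx
    obtain ⟨h1, h2⟩ := nsq x (-X) (abs_le.2 hx) aX'.le (nim x (-X) aX')
    have := low (X + z.im) _ (by linarith) h1 h2
    rw [one_mul, inv_im]
    convert this using 2
    simp
    ring
  have imRight : ∀ y ∈ Icc (-X) X, 1 / (9 * X) ≤ (I * ((X : ℂ) + y * I - z)⁻¹).im := by
    intro y hy
    obtain ⟨h1, h2⟩ := nsq X y aX.le (abs_le.2 hy) (nre X y aX)
    have := low (X - z.re) _ (by linarith) h1 h2
    simpa [inv_re] using this
  have imLeft : ∀ y ∈ Icc (-X) X, 1 / (9 * X) ≤ (-I * (((-X : ℝ) : ℂ) + y * I - z)⁻¹).im := by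
    intro y hy
    obtain ⟨h1, h2⟩ := nsq (-X) y aX'.le (abs_le.2 hy) (nre (-X) y aX')
    have := low (X + z.re) _ (by linarith) h1 h2
    have h3 : (-I * (((-X : ℝ) : ℂ) + y * I - z)⁻¹).im = - (((-X : ℝ) : ℂ) + y * I - z)⁻¹.re := by
      simp
    rw [h3, inv_re, ← neg_div]
    convert this using 2
    simp
    ring
  have cH : ∀ y : ℝ, Continuous fun x : ℝ => (x : ℂ) + y * I := fun y => by fun_prop
  have cV : ∀ x : ℝ, Continuous fun y : ℝ => (x : ℂ) + y * I := fun y => by fun_prop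
  have coBot : ∀ x y : ℝ, y ≤ Y → (x : ℂ) + y * I ∈ coHalfStrip w Y := by
    intro x y hy h
    have := h.2
    simp at this
    linarith
  have coSide : ∀ x y : ℝ, w ≤ |x| → (x : ℂ) + y * I ∈ coHalfStrip w Y := by
    intro x y hy h
    have := h.1
    simp at this
    linarith
  have inTop : ∀ x ∈ Icc (-w) w, (x : ℂ) + X * I ∈ halfStrip w Y := by
    intro x hx
    constructor
    · simpa using abs_le.2 hx
    · simpa using hYX
  have hwX : w ≤ X := by linarith
  have hXX : -X ≤ X := by linarith
  have subL : Icc (-X) (-w) ⊆ Icc (-X) X := Icc_subset_Icc_right (by linarith)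
  have subM : Icc (-w) w ⊆ Icc (-X) X := Icc_subset_Icc (by linarith) hwX
  have subR : Icc w X ⊆ Icc (-X) X := Icc_subset_Icc_left (by linarith)
  have seg : ∀ (q : ℂ → ℂ) (φ : ℝ → ℂ) (e : ℂ) (a b : ℝ), ‖e‖ = 1 → a ≤ b → Continuous φ →
      (∀ x ∈ Icc a b, DifferentiableAt ℂ q (φ x)) → (∀ x ∈ Icc a b, X ≤ ‖φ x‖) →
      (∀ x ∈ Icc a b, ‖q (φ x) + (A - c) * (φ x - z)⁻¹‖ ≤ ε' / (16 * X)) →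
      (∀ x ∈ Icc a b, 1 / (9 * X) ≤ (e * (φ x - z)⁻¹).im) →
      ∃ J : ℂ, ‖e * (∫ x in a..b, q (φ x)) + (A - c) * J‖ ≤ ε' / (16 * X) * (b - a) ∧
        1 / (9 * X) * (b - a) ≤ J.im := by
    intro q φ e a b he hab hφ hq hfar hM hm
    refine ⟨e * ∫ x in a..b, (φ x - z)⁻¹, ?_, le_im_mul_integral_inv hab hφ
      (fun x hx => farne _ (hfar x hx)) hm⟩
    have := norm_integral_add_mul_integral_inv_le hab hφ (fun x hx => (hq x hx).continuousAt)
      (fun x hx => farne _ (hfar x hx)) hM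
    have h2 : e * (∫ x in a..b, q (φ x)) + (A - c) * (e * ∫ x in a..b, (φ x - z)⁻¹) =
        e * ((∫ x in a..b, q (φ x)) + (A - c) * ∫ x in a..b, (φ x - z)⁻¹) := by ring
    rw [h2, norm_mul, he, one_mul]
    exact this
  -- The factors `1, -1, I, -I` orient the square counterclockwise. Its top side has three pieces
  -- because `h` replaces `g` inside the half-strip.
  obtain ⟨J₁, hJ₁, hJ₁'⟩ := seg g (fun x : ℝ => (x : ℂ) + (-X : ℝ) * I) 1 (-X) X (by simp) hXX
    (cH _) (fun x _ => hg _ (coBot _ _ (by linarith [(abs_le.1 (show |Y| ≤ X by linarith)).1])))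
    (fun x _ => nim _ _ aX')
    (fun x _ => boundg _ (nim _ _ aX')
      (coBot _ _ (by linarith [(abs_le.1 (show |Y| ≤ X by linarith)).1]))) imBot
  obtain ⟨J₂, hJ₂, hJ₂'⟩ := seg g (fun x : ℝ => (x : ℂ) + X * I) (-1) (-X) (-w) (by simp)
    (by linarith) (cH _)
    (fun x hx => hg _ (coSide _ _ (le_abs.2 (Or.inr (by linarith [hx.2])))))
    (fun x _ => nim _ _ aX)
    (fun x hx => boundg _ (nim _ _ aX) (coSide _ _ (le_abs.2 (Or.inr (by linarith [hx.2])))))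
    (fun x hx => imTop x (subL hx))
  obtain ⟨J₃, hJ₃, hJ₃'⟩ := seg h (fun x : ℝ => (x : ℂ) + X * I) (-1) (-w) w (by simp)
    (by linarith) (cH _) (fun x hx => hh _ (inTop x hx)) (fun x _ => nim _ _ aX)
    (fun x hx => boundh _ (nim _ _ aX) (inTop x hx)) (fun x hx => imTop x (subM hx))
  obtain ⟨J₄, hJ₄, hJ₄'⟩ := seg g (fun x : ℝ => (x : ℂ) + X * I) (-1) w X (by simp)
    (by linarith) (cH _)
    (fun x hx => hg _ (coSide _ _ (le_abs.2 (Or.inl hx.1))))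
    (fun x _ => nim _ _ aX)
    (fun x hx => boundg _ (nim _ _ aX) (coSide _ _ (le_abs.2 (Or.inl hx.1))))
    (fun x hx => imTop x (subR hx))
  obtain ⟨J₅, hJ₅, hJ₅'⟩ := seg g (fun y : ℝ => (X : ℂ) + y * I) I (-X) X (by simp) hXX
    (cV _) (fun x _ => hg _ (coSide _ _ (by rw [aX]; exact hwX)))
    (fun x _ => nre _ _ aX)
    (fun x _ => boundg _ (nre _ _ aX) (coSide _ _ (by rw [aX]; exact hwX))) imRight
  obtain ⟨J₆, hJ₆, hJ₆'⟩ := seg g (fun y : ℝ => ((-X : ℝ) : ℂ) + y * I) (-I) (-X) X (by simp) hXX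
    (cV _) (fun x _ => hg _ (coSide _ _ (by rw [aX']; exact hwX)))
    (fun x _ => nre _ _ aX')
    (fun x _ => boundg _ (nre _ _ aX') (coSide _ _ (by rw [aX']; exact hwX))) imLeft
  set S₁ := ∫ x : ℝ in -X..X, g (x + (-X : ℝ) * I)
  set S₂ := ∫ x : ℝ in -X..-w, g (x + X * I)
  set S₃ := ∫ x : ℝ in -w..w, h (x + X * I)
  set S₄ := ∫ x : ℝ in w..X, g (x + X * I)
  set S₅ := ∫ y : ℝ in -X..X, g (X + y * I)
  set S₆ := ∫ y : ℝ in -X..X, g ((-X : ℝ) + y * I)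
  set D₁ := ∫ x : ℝ in -w..w, (g (x + Y * I) - h (x + Y * I))
  set D₂ := ∫ y : ℝ in Y..X, (g ((-w : ℝ) + y * I) - h ((-w : ℝ) + y * I))
  set D₃ := ∫ y : ℝ in Y..X, (g (w + y * I) - h (w + y * I))
  have hD₂ : ‖D₂‖ ≤ _ := hver (-w) X (by rw [abs_neg, abs_of_pos hw]) hYX
  have hD₃ : ‖D₃‖ ≤ _ := hver w X (abs_of_pos hw) hYX
  have htot : (A - c) * (J₁ + J₂ + J₃ + J₄ + J₅ + J₆) =
      (1 * S₁ + (A - c) * J₁) + (-1 * S₂ + (A - c) * J₂) + (-1 * S₃ + (A - c) * J₃)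
      + (-1 * S₄ + (A - c) * J₄) + (I * S₅ + (A - c) * J₅) + (-I * S₆ + (A - c) * J₆)
      - D₁ + I * D₂ - I * D₃ := by
    linear_combination -key
  have hle : ‖(A - c) * (J₁ + J₂ + J₃ + J₄ + J₅ + J₆)‖ ≤
      ε' / (16 * X) * (8 * X) + (2 * w + 8 * japaneseConst) * ε := by
    rw [htot]
    have i2 : ‖I * D₂‖ = ‖D₂‖ := by simp
    have i3 : ‖I * D₃‖ = ‖D₃‖ := by simp
    refine (norm_sub_le _ _).trans ?_
    refine (add_le_add_left (norm_add_le _ _) _).trans ?_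
    refine (add_le_add_left (add_le_add_left (norm_sub_le _ _) _) _).trans ?_
    have := norm_add₃_le (a := (1 * S₁ + (A - c) * J₁)) (b := (-1 * S₂ + (A - c) * J₂))
      (c := (-1 * S₃ + (A - c) * J₃))
    have t1 := norm_add_le ((1 * S₁ + (A - c) * J₁) + (-1 * S₂ + (A - c) * J₂)
      + (-1 * S₃ + (A - c) * J₃)) (-1 * S₄ + (A - c) * J₄)
    have t2 := norm_add_le ((1 * S₁ + (A - c) * J₁) + (-1 * S₂ + (A - c) * J₂)
      + (-1 * S₃ + (A - c) * J₃) + (-1 * S₄ + (A - c) * J₄)) (I * S₅ + (A - c) * J₅)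
    have t3 := norm_add_le ((1 * S₁ + (A - c) * J₁) + (-1 * S₂ + (A - c) * J₂)
      + (-1 * S₃ + (A - c) * J₃) + (-1 * S₄ + (A - c) * J₄) + (I * S₅ + (A - c) * J₅))
      (-I * S₆ + (A - c) * J₆)
    rw [i2, i3]
    linarith
  -- Perimeter `8X` times the lower bound `1/(9X)`.
  have hJtot : 8 / 9 ≤ ‖J₁ + J₂ + J₃ + J₄ + J₅ + J₆‖ := by
    have h1 := (le_abs_self _).trans (Complex.abs_im_le_norm (J₁ + J₂ + J₃ + J₄ + J₅ + J₆))
    simp only [add_im] at h1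
    have h2 : 1 / (9 * X) * (8 * X) = 8 / 9 := by field_simp
    linarith
  rw [norm_mul] at hle
  have h3 : ε' / (16 * X) * (8 * X) = ε' / 2 := by field_simp; norm_num
  rw [h3] at hle
  have h4 : ‖A - c‖ * (8 / 9) ≤ ‖A - c‖ * ‖J₁ + J₂ + J₃ + J₄ + J₅ + J₆‖ :=
    mul_le_mul_of_nonneg_left hJtot (norm_nonneg _)
  have h5 : 0 ≤ (2 * w + 8 * japaneseConst) * ε := by positivity
  nlinarith

/-- The difference quotient has a removable singularity at `z`. -/
theorem differentiableAt_dslope_of_eventually {f : ℂ → ℂ} {z k : ℂ}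
    (hz : ∀ᶠ k in 𝓝 z, DifferentiableAt ℂ f k) (hk : DifferentiableAt ℂ f k) :
    DifferentiableAt ℂ (dslope f z) k := by
  rcases eq_or_ne k z with rfl | h
  · exact ((differentiableOn_dslope (s := {k | DifferentiableAt ℂ f k}) hz).2
      fun k hk => hk.differentiableWithinAt).differentiableAt hz
  · exact (differentiableAt_dslope_of_ne h).2 hk

/-- With `A = p z`, the quotient of `p` is regular at `z` as a `dslope`, while that of `r` is
regular because its domain does not contain `z`. The inside version exchanges these roles. -/
theorem norm_sub_le_of_cousin_of_outside {p r : ℂ → ℂ} {c z : ℂ} {w Y ε : ℝ} (hw : 0 < w)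
    (hε : 0 ≤ ε)
    (hpd : ∀ k ∈ coHalfStrip w Y, DifferentiableAt ℂ p k)
    (hrd : ∀ k ∈ halfStrip w Y, DifferentiableAt ℂ r k)
    (hp : Tendsto p (Bornology.cobounded ℂ ⊓ 𝓟 (coHalfStrip w Y)) (𝓝 c))
    (hr : Tendsto r (Bornology.cobounded ℂ ⊓ 𝓟 (halfStrip w Y)) (𝓝 c))
    (hδ : ∀ k ∈ halfStrip w Y ∩ coHalfStrip w Y,
      ‖p k - r k‖ ≤ ε * (1 + (k.im - Y)) ^ (-(1 / 2) : ℝ))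
    (hz : ∀ k ∈ halfStrip w Y ∩ coHalfStrip w Y, 1 ≤ ‖k - z‖) (hzs : z ∉ halfStrip w Y)
    (hpz : ∀ᶠ k in 𝓝 z, DifferentiableAt ℂ p k) :
    ‖p z - c‖ ≤ 2 * (2 * w + 8 * japaneseConst) * ε := by
  refine norm_sub_le_of_cousin (g := dslope p z) (h := fun k => (r k - p z) / (k - z)) hw hε ?_ ?_
    ?_ ?_ hp hr hδ hz
  · intro k hk
    exact differentiableAt_dslope_of_eventually hpz (hpd k hk)
  · intro k hk
    have : k - z ≠ 0 := sub_ne_zero.2 fun h => hzs (h ▸ hk)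
    have := hrd k hk
    fun_prop (disch := assumption)
  · intro k _
    simpa using (sub_smul_dslope p z k).symm
  · intro k hk
    have : k - z ≠ 0 := sub_ne_zero.2 fun h => hzs (h ▸ hk)
    field_simp

theorem norm_sub_le_of_cousin_of_inside {p r : ℂ → ℂ} {c z : ℂ} {w Y ε : ℝ} (hw : 0 < w)
    (hε : 0 ≤ ε)
    (hpd : ∀ k ∈ coHalfStrip w Y, DifferentiableAt ℂ p k)
    (hrd : ∀ k ∈ halfStrip w Y, DifferentiableAt ℂ r k)
    (hp : Tendsto p (Bornology.cobounded ℂ ⊓ 𝓟 (coHalfStrip w Y)) (𝓝 c))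
    (hr : Tendsto r (Bornology.cobounded ℂ ⊓ 𝓟 (halfStrip w Y)) (𝓝 c))
    (hδ : ∀ k ∈ halfStrip w Y ∩ coHalfStrip w Y,
      ‖p k - r k‖ ≤ ε * (1 + (k.im - Y)) ^ (-(1 / 2) : ℝ))
    (hz : ∀ k ∈ halfStrip w Y ∩ coHalfStrip w Y, 1 ≤ ‖k - z‖) (hzs : z ∉ coHalfStrip w Y)
    (hrz : ∀ᶠ k in 𝓝 z, DifferentiableAt ℂ r k) :
    ‖r z - c‖ ≤ 2 * (2 * w + 8 * japaneseConst) * ε := by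
  refine norm_sub_le_of_cousin (g := fun k => (p k - r z) / (k - z)) (h := dslope r z) hw hε ?_ ?_
    ?_ ?_ hp hr hδ hz
  · intro k hk
    have : k - z ≠ 0 := sub_ne_zero.2 fun h => hzs (h ▸ hk)
    have := hpd k hk
    fun_prop (disch := assumption)
  · intro k hk
    exact differentiableAt_dslope_of_eventually hrz (hrd k hk)
  · intro k hk
    have : k - z ≠ 0 := sub_ne_zero.2 fun h => hzs (h ▸ hk)
    field_simp
  · intro k _
    simpa using (sub_smul_dslope r z k).symm

/-! ### Geometry of the undeformed contour and its normal coordinates -/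

section Curve

variable {k₀ : ℂ}

theorem sq_im_pos (hre : 0 < k₀.re) (him : 0 < k₀.im) : 0 < (k₀ ^ 2).im := by
  simp only [pow_two, mul_im]
  positivity

theorem undeformed_sq (k₀ : ℂ) (t : ℝ) : undeformed k₀ t ^ 2 = k₀ ^ 2 - (t : ℂ) ^ 2 := by
  rw [undeformed, ← Complex.cpow_nat_mul]
  simp

theorem base_im (k₀ : ℂ) (t : ℝ) : (k₀ ^ 2 - (t : ℂ) ^ 2).im = (k₀ ^ 2).im := by
  rw [sub_im, ← ofReal_pow, ofReal_im, sub_zero]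

theorem base_re (k₀ : ℂ) (t : ℝ) : (k₀ ^ 2 - (t : ℂ) ^ 2).re = (k₀ ^ 2).re - t ^ 2 := by
  rw [sub_re, ← ofReal_pow, ofReal_re]

theorem base_mem_slitPlane (hB : 0 < (k₀ ^ 2).im) (t : ℝ) : k₀ ^ 2 - (t : ℂ) ^ 2 ∈ slitPlane := by
  rw [mem_slitPlane_iff, base_im]
  exact Or.inr hB.ne'

theorem undeformed_re_pos (hB : 0 < (k₀ ^ 2).im) (t : ℝ) : 0 < (undeformed k₀ t).re := by
  have h0 : k₀ ^ 2 - (t : ℂ) ^ 2 ≠ 0 := slitPlane_ne_zero (base_mem_slitPlane hB t)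
  have h1 : undeformed k₀ t ≠ 0 := by
    intro h
    have := undeformed_sq k₀ t
    rw [h] at this
    exact h0 (by simpa using this.symm)
  rw [undeformed, cpow_def_of_ne_zero h0, exp_re]
  refine mul_pos (Real.exp_pos _) (Real.cos_pos_of_mem_Ioo ?_)
  have : (Complex.log (k₀ ^ 2 - (t : ℂ) ^ 2) * (1 / 2)).im = (k₀ ^ 2 - (t : ℂ) ^ 2).arg / 2 := by
    rw [show (1 / 2 : ℂ) = ((1 / 2 : ℝ) : ℂ) by push_cast; rfl, im_mul_ofReal, log_im]
    ring
  rw [this]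
  have h2 := arg_lt_pi_iff.2 (Or.inr (by rw [base_im]; exact hB.ne') :
    0 ≤ (k₀ ^ 2 - (t : ℂ) ^ 2).re ∨ (k₀ ^ 2 - (t : ℂ) ^ 2).im ≠ 0)
  have h3 := neg_pi_lt_arg (k₀ ^ 2 - (t : ℂ) ^ 2)
  constructor <;> linarith

theorem undeformed_re_mul_im (k₀ : ℂ) (t : ℝ) :
    2 * ((undeformed k₀ t).re * (undeformed k₀ t).im) = (k₀ ^ 2).im := by
  have h := congrArg Complex.im (undeformed_sq k₀ t)
  rw [base_im, pow_two, mul_im] at h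
  linarith

theorem undeformed_re_sq_sub (k₀ : ℂ) (t : ℝ) :
    (undeformed k₀ t).re ^ 2 - (undeformed k₀ t).im ^ 2 = (k₀ ^ 2).re - t ^ 2 := by
  have h := congrArg Complex.re (undeformed_sq k₀ t)
  rw [base_re, pow_two, mul_re] at h
  linarith

theorem undeformed_im_pos (hB : 0 < (k₀ ^ 2).im) (t : ℝ) : 0 < (undeformed k₀ t).im := by
  have h1 := undeformed_re_mul_im k₀ t
  have h2 := undeformed_re_pos hB t
  by_contra! h
  nlinarith

theorem undeformed_ne_zero (hB : 0 < (k₀ ^ 2).im) (t : ℝ) : undeformed k₀ t ≠ 0 := by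
  intro h
  have := undeformed_re_pos hB t
  simp [h] at this

theorem tendsto_undeformed_im (hB : 0 < (k₀ ^ 2).im) :
    Tendsto (fun t => (undeformed k₀ t).im) atTop atTop := by
  rw [tendsto_atTop]
  intro M
  filter_upwards [eventually_ge_atTop (|M| + |(k₀ ^ 2).re| + 1)] with t ht
  have h1 := undeformed_re_sq_sub k₀ t
  have h2 := undeformed_im_pos hB t
  have h3 := le_abs_self M
  have h4 := le_abs_self (k₀ ^ 2).re
  have h5 := abs_nonneg M
  have h6 := abs_nonneg (k₀ ^ 2).re
  have h7 : |M| ≤ (undeformed k₀ t).im := by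
    refine abs_le_of_sq_le_sq' ?_ h2.le |>.2
    nlinarith [sq_nonneg (undeformed k₀ t).re]
  linarith

/-- The product of the real and imaginary parts is constant along the contour, which is a branch of
a hyperbola. -/
theorem tendsto_undeformed_re (hB : 0 < (k₀ ^ 2).im) :
    Tendsto (fun t => (undeformed k₀ t).re) atTop (𝓝 0) := by
  have h : (fun t => (undeformed k₀ t).re) =
      fun t => ((k₀ ^ 2).im / 2) * ((undeformed k₀ t).im)⁻¹ := by
    funext t
    have h1 := undeformed_re_mul_im k₀ t
    have h2 := undeformed_im_pos hB t
    field_simp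
    linarith
  rw [h]
  simpa using (tendsto_inv_atTop_zero.comp (tendsto_undeformed_im hB)).const_mul ((k₀ ^ 2).im / 2)

theorem hasDerivAt_undeformed (hB : 0 < (k₀ ^ 2).im) (s : ℝ) :
    HasDerivAt (undeformed k₀) (-(s : ℂ) / undeformed k₀ s) s := by
  have h1 : HasDerivAt (fun w : ℂ => k₀ ^ 2 - w ^ 2) (-(2 * (s : ℂ))) (s : ℂ) := by
    have := (hasDerivAt_pow 2 (s : ℂ)).const_sub (k₀ ^ 2)
    simpa using this
  have h2 : HasDerivAt (undeformed k₀) _ s :=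
    (h1.cpow_const (c := (1 / 2 : ℂ)) (base_mem_slitPlane hB s)).comp_ofReal
  convert h2 using 1
  have h0 := undeformed_ne_zero hB s
  have h3 : (k₀ ^ 2 - (s : ℂ) ^ 2) ^ (1 / 2 - 1 : ℂ) = (undeformed k₀ s)⁻¹ := by
    rw [cpow_sub _ _ (slitPlane_ne_zero (base_mem_slitPlane hB s)), cpow_one]
    change undeformed k₀ s / _ = _
    rw [← undeformed_sq]
    field_simp
  rw [h3]
  field_simp

theorem contDiff_undeformed (hB : 0 < (k₀ ^ 2).im) : ContDiff ℝ 2 (undeformed k₀) := by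
  rw [contDiff_iff_contDiffAt]
  intro s
  have h1 : ContDiff ℝ 2 fun t : ℝ => k₀ ^ 2 - (t : ℂ) ^ 2 := by
    have : ContDiff ℝ 2 fun t : ℝ => (t : ℂ) := Complex.ofRealCLM.contDiff
    fun_prop
  have h2 : ContDiffAt ℂ 2 (fun w : ℂ => w ^ (1 / 2 : ℂ)) (k₀ ^ 2 - (s : ℂ) ^ 2) := by
    have : AnalyticAt ℂ (fun w : ℂ => w ^ (1 / 2 : ℂ)) (k₀ ^ 2 - (s : ℂ) ^ 2) :=
      analyticAt_id.cpow analyticAt_const (base_mem_slitPlane hB s)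
    exact this.contDiffAt
  exact (h2.restrict_scalars ℝ).comp s h1.contDiffAt

/-- The displacement of the undeformed contour along its normal. -/
noncomputable def tube (c : ℝ → ℂ) (p : ℝ × ℝ) : ℂ := c p.1 + (p.2 : ℂ) * (I * deriv c p.1)

theorem deriv_undeformed (hB : 0 < (k₀ ^ 2).im) (s : ℝ) :
    deriv (undeformed k₀) s = -(s : ℂ) / undeformed k₀ s := (hasDerivAt_undeformed hB s).deriv

theorem continuous_undeformed (hB : 0 < (k₀ ^ 2).im) : Continuous (undeformed k₀) :=
  (contDiff_undeformed hB).continuous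

theorem tube_undeformed (hB : 0 < (k₀ ^ 2).im) :
    tube (undeformed k₀) = fun p : ℝ × ℝ =>
      undeformed k₀ p.1 + (p.2 : ℂ) * (I * (-(p.1 : ℂ) / undeformed k₀ p.1)) := by
  funext p
  rw [tube, deriv_undeformed hB]

theorem continuous_tube_undeformed (hB : 0 < (k₀ ^ 2).im) : Continuous (tube (undeformed k₀)) := by
  rw [tube_undeformed hB]
  have h1 : Continuous fun p : ℝ × ℝ => undeformed k₀ p.1 :=
    (continuous_undeformed hB).comp continuous_fst
  have h2 : Continuous fun p : ℝ × ℝ => -(p.1 : ℂ) / undeformed k₀ p.1 :=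
    Continuous.div (by fun_prop) h1 fun p => undeformed_ne_zero hB _
  fun_prop

/-- Normal coordinates are a local chart because the derivative at `(s, 0)` is multiplication by the
tangent `-s/κ(s)`, nonzero for `s > 0`. Hence limits along normal approaches control a full
neighbourhood. -/
theorem map_tube_undeformed (hB : 0 < (k₀ ^ 2).im) {s : ℝ} (hs : 0 < s) :
    map (tube (undeformed k₀)) (𝓝 (s, 0)) = 𝓝 (undeformed k₀ s) := by
  have hc := contDiff_undeformed hB
  have h1 : ContDiff ℝ 1 (deriv (undeformed k₀)) := by
    have : ContDiff ℝ (1 + 1) (undeformed k₀) := hc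
    exact (contDiff_succ_iff_deriv.1 this).2.2
  have h2 : ContDiff ℝ 1 (tube (undeformed k₀)) := by
    unfold tube
    have e1 : ContDiff ℝ 1 fun p : ℝ × ℝ => undeformed k₀ p.1 :=
      (hc.of_le (by norm_num)).comp contDiff_fst
    have e2 : ContDiff ℝ 1 fun p : ℝ × ℝ => deriv (undeformed k₀) p.1 := h1.comp contDiff_fst
    have e3 : ContDiff ℝ 1 fun p : ℝ × ℝ => (p.2 : ℂ) :=
      Complex.ofRealCLM.contDiff.comp contDiff_snd
    fun_prop
  have hst := (h2.contDiffAt (x := (s, 0))).hasStrictFDerivAt (by norm_num)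
  have := hst.map_nhds_eq_of_surj ?_
  · rw [this]
    simp [tube]
  -- the derivative is multiplication by the tangent vector
  rw [LinearMap.range_eq_top]
  set d := deriv (undeformed k₀) s with hd
  have hd0 : d ≠ 0 := by
    rw [hd, deriv_undeformed hB]
    exact div_ne_zero (by simpa using hs.ne') (undeformed_ne_zero hB s)
  have hfd : ∀ v : ℝ × ℝ, fderiv ℝ (tube (undeformed k₀)) (s, 0) v = d * (v.1 + v.2 * I) := by
    intro v
    have hcd : HasFDerivAt (undeformed k₀) _ s :=
      (hasDerivAt_undeformed hB s).hasFDerivAt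
    have e1 := HasFDerivAt.comp (s, (0 : ℝ)) (f := Prod.fst) hcd (hasFDerivAt_fst (𝕜 := ℝ) (p := (s, (0 : ℝ))))
    have e2 : HasFDerivAt (deriv (undeformed k₀)) _ s :=
      ((h1.differentiable (by norm_num)) s).hasFDerivAt
    have e3 := HasFDerivAt.comp (s, (0 : ℝ)) (f := Prod.fst) e2 (hasFDerivAt_fst (𝕜 := ℝ) (p := (s, (0 : ℝ))))
    have e4 : HasFDerivAt (fun p : ℝ × ℝ => (p.2 : ℂ)) _ (s, (0 : ℝ)) :=
      Complex.ofRealCLM.hasFDerivAt.comp (s, (0 : ℝ)) hasFDerivAt_snd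
    have e5 := e1.add (e4.mul (e3.const_mul I))
    have e6 : HasFDerivAt (tube (undeformed k₀)) _ (s, (0 : ℝ)) := e5
    rw [e6.fderiv]
    simp [hd, deriv_undeformed hB]
    ring
  intro w
  refine ⟨((w / d).re, (w / d).im), ?_⟩
  have := hfd ((w / d).re, (w / d).im)
  simp only [re_add_im] at this
  change fderiv ℝ (tube (undeformed k₀)) (s, 0) _ = w
  rw [this]
  field_simp

end Curve

/-! ### Boundary values on the two shores -/

section BoundaryValues

variable {E : Type*} [TopologicalSpace E]

theorem HasLeftValue.congr_curve {c c' : ℝ → ℂ} {f : ℂ → E} {s : ℝ} {l : E} (h : c =ᶠ[𝓝 s] c')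
    (hf : HasLeftValue c f s l) : HasLeftValue c' f s l := by
  refine Tendsto.congr' ?_ hf
  have h1 : ∀ᶠ p : ℝ × ℝ in 𝓝 s ×ˢ 𝓝[>] 0, c p.1 = c' p.1 ∧ deriv c p.1 = deriv c' p.1 :=
    tendsto_fst.eventually (h.and h.deriv)
  filter_upwards [h1] with p hp
  rw [hp.1, hp.2]

theorem HasRightValue.congr_curve {c c' : ℝ → ℂ} {f : ℂ → E} {s : ℝ} {l : E} (h : c =ᶠ[𝓝 s] c')
    (hf : HasRightValue c f s l) : HasRightValue c' f s l := by
  refine Tendsto.congr' ?_ hf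
  have h1 : ∀ᶠ p : ℝ × ℝ in 𝓝 s ×ˢ 𝓝[<] 0, c p.1 = c' p.1 ∧ deriv c p.1 = deriv c' p.1 :=
    tendsto_fst.eventually (h.and h.deriv)
  filter_upwards [h1] with p hp
  rw [hp.1, hp.2]

/-- The map `k ↦ -k` is a rotation, so it carries the left shore to the left shore. -/
theorem HasLeftValue.comp_neg {c : ℝ → ℂ} {f : ℂ → E} {s : ℝ} {l : E}
    (hf : HasLeftValue (fun s => -c s) f s l) : HasLeftValue c (fun k => f (-k)) s l := by
  refine Tendsto.congr (fun p => ?_) hf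
  rw [deriv.fun_neg]
  congr 1
  ring

theorem HasRightValue.comp_neg {c : ℝ → ℂ} {f : ℂ → E} {s : ℝ} {l : E}
    (hf : HasRightValue (fun s => -c s) f s l) : HasRightValue c (fun k => f (-k)) s l := by
  refine Tendsto.congr (fun p => ?_) hf
  rw [deriv.fun_neg]
  congr 1
  ring

/-- A function with equal boundary values on both shores has a limit at the cut. -/
theorem tendsto_nhdsWithin_of_left_right {c : ℝ → ℂ} {f : ℂ → E} {s : ℝ} {l : E} {S : Set ℂ}
    (hmap : map (tube c) (𝓝 (s, 0)) = 𝓝 (c s)) (hS : ∀ᶠ s' in 𝓝 s, c s' ∈ S)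
    (hL : HasLeftValue c f s l) (hR : HasRightValue c f s l) :
    Tendsto f (𝓝[Sᶜ] (c s)) (𝓝 l) := by
  intro N hN
  rw [mem_map, mem_nhdsWithin_iff_eventually, ← hmap, eventually_map]
  have h1 : ∀ᶠ p : ℝ × ℝ in 𝓝 s ×ˢ 𝓝[>] 0, f (tube c p) ∈ N := hL hN
  have h2 : ∀ᶠ p : ℝ × ℝ in 𝓝 s ×ˢ 𝓝[<] 0, f (tube c p) ∈ N := hR hN
  have h3 : ∀ᶠ p : ℝ × ℝ in 𝓝 s ×ˢ pure (0 : ℝ), tube c p ∈ S := by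
    rw [prod_pure, eventually_map]
    filter_upwards [hS] with s' hs'
    simpa [tube] using hs'
  -- Zero displacement lands on the cut itself, which is excluded from the limit.
  have h4 : 𝓝 (s, (0 : ℝ)) = 𝓝 s ×ˢ 𝓝[>] 0 ⊔ (𝓝 s ×ˢ 𝓝[<] 0 ⊔ 𝓝 s ×ˢ pure (0 : ℝ)) := by
    rw [nhds_prod_eq, ← prod_sup, ← prod_sup, ← nhdsLT_sup_nhdsGE (0 : ℝ)]
    congr 1
    rw [← Ioi_insert, nhdsWithin_insert]
    ac_rfl
  rw [h4, eventually_sup, eventually_sup]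
  refine ⟨?_, ?_, ?_⟩
  · filter_upwards [h1] with p hp _ using hp
  · filter_upwards [h2] with p hp _ using hp
  · filter_upwards [h3] with p hp h using absurd hp h

theorem tendsto_tube_prod {c : ℝ → ℂ} {s : ℝ} {l : Filter ℝ} (hl : l ≤ 𝓝 0)
    (hc : ContinuousAt (tube c) (s, 0)) : Tendsto (tube c) (𝓝 s ×ˢ l) (𝓝 (c s)) := by
  have : tube c (s, 0) = c s := by simp [tube]
  rw [← this]
  refine hc.tendsto.mono_left ?_
  rw [nhds_prod_eq]
  exact prod_mono_right _ hl

theorem hasLeftValue_of_continuousAt {c : ℝ → ℂ} {f : ℂ → E} {s : ℝ}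
    (hc : ContinuousAt (tube c) (s, 0)) (hf : ContinuousAt f (c s)) :
    HasLeftValue c f s (f (c s)) :=
  hf.tendsto.comp (tendsto_tube_prod nhdsWithin_le_nhds hc)

theorem hasRightValue_of_continuousAt {c : ℝ → ℂ} {f : ℂ → E} {s : ℝ}
    (hc : ContinuousAt (tube c) (s, 0)) (hf : ContinuousAt f (c s)) :
    HasRightValue c f s (f (c s)) :=
  hf.tendsto.comp (tendsto_tube_prod nhdsWithin_le_nhds hc)

/-- Left boundary values are continuous along the cut. -/
theorem continuousOn_of_hasLeftValue [RegularSpace E] {c : ℝ → ℂ} {f : ℂ → E} {v : ℝ → E}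
    {J : Set ℝ} (hJ : IsOpen J) (h : ∀ s ∈ J, HasLeftValue c f s (v s)) : ContinuousOn v J := by
  intro s hs
  refine ContinuousAt.continuousWithinAt ?_
  rw [ContinuousAt, (closed_nhds_basis (v s)).tendsto_right_iff]
  rintro C ⟨hC, hCc⟩
  have h1 : ∀ᶠ p : ℝ × ℝ in 𝓝 s ×ˢ 𝓝[>] 0, f (tube c p) ∈ C := h s hs hC
  filter_upwards [h1.curry, hJ.mem_nhds hs] with s' hs' hs'J
  refine hCc.mem_of_tendsto ?_ hs'
  have h2 : Tendsto (fun p => f (tube c p)) (𝓝 s' ×ˢ 𝓝[>] 0) (𝓝 (v s')) := h s' hs'J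
  exact h2.comp (tendsto_const_nhds.prodMk tendsto_id)

/-- In the coordinate `k²` the contour is a horizontal ray running to the left, since `κ κ' = -s`.
Its left side is therefore below it and its right side above, the sides on which `Complex.log` has
different limits. -/
theorem tendsto_sq_sub_left {k₀ : ℂ} (hB : 0 < (k₀ ^ 2).im) {s t : ℝ} (hs : 0 < s) :
    Tendsto (fun p => tube (undeformed k₀) p ^ 2 - undeformed k₀ t ^ 2) (𝓝 s ×ˢ 𝓝[>] 0)
      (𝓝[{w | w.im < 0}] (((t ^ 2 - s ^ 2 : ℝ)) : ℂ)) ∧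
    Tendsto (fun p => tube (undeformed k₀) p ^ 2 - undeformed k₀ t ^ 2) (𝓝 s ×ˢ 𝓝[<] 0)
      (𝓝[{w | 0 ≤ w.im}] (((t ^ 2 - s ^ 2 : ℝ)) : ℂ)) := by
  have hct := continuous_tube_undeformed hB
  have him : ∀ p : ℝ × ℝ, (tube (undeformed k₀) p ^ 2 - undeformed k₀ t ^ 2).im =
      -(p.2 * p.1) * (2 - p.2 * p.1 * (k₀ ^ 2).im / normSq (undeformed k₀ p.1 ^ 2)) := by
    intro p
    have h0 := undeformed_ne_zero hB p.1
    have h1 : tube (undeformed k₀) p ^ 2 - undeformed k₀ t ^ 2 =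
        undeformed k₀ p.1 ^ 2 - undeformed k₀ t ^ 2 - ((2 * (p.2 * p.1) : ℝ) : ℂ) * I
          - ((p.2 ^ 2 * p.1 ^ 2 : ℝ) : ℂ) * (undeformed k₀ p.1 ^ 2)⁻¹ := by
      rw [tube_undeformed hB]
      push_cast
      field_simp
      ring_nf
      rw [I_sq]
      ring
    rw [h1, sub_im, sub_im, sub_im, im_ofReal_mul, im_ofReal_mul, inv_im, I_im, undeformed_sq,
      undeformed_sq, base_im, base_im]
    ring
  have hpos : ∀ᶠ p : ℝ × ℝ in 𝓝 (s, 0),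
      0 < 2 - p.2 * p.1 * (k₀ ^ 2).im / normSq (undeformed k₀ p.1 ^ 2) := by
    have hc : ContinuousAt (fun p : ℝ × ℝ =>
        2 - p.2 * p.1 * (k₀ ^ 2).im / normSq (undeformed k₀ p.1 ^ 2)) (s, 0) := by
      have h1 : Continuous fun p : ℝ × ℝ => undeformed k₀ p.1 :=
        (continuous_undeformed hB).comp continuous_fst
      have h2 : Continuous fun p : ℝ × ℝ => p.2 * p.1 * (k₀ ^ 2).im /
          normSq (undeformed k₀ p.1 ^ 2) :=
        Continuous.div (by fun_prop) (continuous_normSq.comp (h1.pow 2)) fun p =>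
          (normSq_pos.2 (pow_ne_zero 2 (undeformed_ne_zero hB _))).ne'
      exact (continuous_const.sub h2).continuousAt
    refine hc.eventually (lt_mem_nhds ?_)
    simp
  have hspos : ∀ᶠ p : ℝ × ℝ in 𝓝 (s, 0), 0 < p.1 :=
    continuous_fst.continuousAt.eventually (lt_mem_nhds hs)
  have hlim : ∀ l : Filter ℝ, l ≤ 𝓝 0 →
      Tendsto (fun p => tube (undeformed k₀) p ^ 2 - undeformed k₀ t ^ 2) (𝓝 s ×ˢ l)
        (𝓝 (((t ^ 2 - s ^ 2 : ℝ)) : ℂ)) := by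
    intro l hl
    have h1 := ((tendsto_tube_prod (c := undeformed k₀) (s := s) hl hct.continuousAt).pow 2).sub_const
      (undeformed k₀ t ^ 2)
    convert h1 using 2
    rw [undeformed_sq, undeformed_sq]
    push_cast
    ring
  have hle : ∀ l : Filter ℝ, l ≤ 𝓝 0 → 𝓝 s ×ˢ l ≤ 𝓝 (s, (0 : ℝ)) := by
    intro l hl
    rw [nhds_prod_eq]
    exact prod_mono_right _ hl
  constructor
  · refine tendsto_nhdsWithin_iff.2 ⟨hlim _ nhdsWithin_le_nhds, ?_⟩
    have h2 : ∀ᶠ p : ℝ × ℝ in 𝓝 s ×ˢ 𝓝[>] 0, 0 < p.2 :=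
      tendsto_snd.eventually self_mem_nhdsWithin
    filter_upwards [hle _ nhdsWithin_le_nhds hpos, hle _ nhdsWithin_le_nhds hspos, h2]
      with p h3 h4 h5
    simp only [him]
    have := mul_pos (mul_pos h5 h4) h3
    linarith
  · refine tendsto_nhdsWithin_iff.2 ⟨hlim _ nhdsWithin_le_nhds, ?_⟩
    have h2 : ∀ᶠ p : ℝ × ℝ in 𝓝 s ×ˢ 𝓝[<] 0, p.2 < 0 :=
      tendsto_snd.eventually self_mem_nhdsWithin
    filter_upwards [hle _ nhdsWithin_le_nhds hpos, hle _ nhdsWithin_le_nhds hspos, h2]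
      with p h3 h4 h5
    simp only [him]
    have := mul_pos (mul_pos (neg_pos.2 h5) h4) h3
    linarith

/-- `Log (k² - e²)`, whose cuts are the shortened undeformed contour that ends at `e` and its
mirror image. -/
noncomputable def cutLog (e k : ℂ) : ℂ := Complex.log (k ^ 2 - e ^ 2)

/-- The jump `2πi` from left to right is what makes `exp (λ̂ · cutLog)` acquire the factor `exp (2πi
λ̂) = m`. -/
theorem hasValue_cutLog {k₀ : ℂ} (hB : 0 < (k₀ ^ 2).im) {s t : ℝ} (ht : 0 ≤ t) (hs : t < s) :
    HasLeftValue (undeformed k₀) (cutLog (undeformed k₀ t)) s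
      ((Real.log (s ^ 2 - t ^ 2) : ℂ) - Real.pi * I) ∧
    HasRightValue (undeformed k₀) (cutLog (undeformed k₀ t)) s
      ((Real.log (s ^ 2 - t ^ 2) : ℂ) + Real.pi * I) := by
  obtain ⟨h1, h2⟩ := tendsto_sq_sub_left hB (t := t) (ht.trans_lt hs)
  have hneg : t ^ 2 - s ^ 2 < 0 := by nlinarith
  have hn : ‖((t ^ 2 - s ^ 2 : ℝ) : ℂ)‖ = s ^ 2 - t ^ 2 := by
    rw [norm_real, Real.norm_eq_abs, abs_of_neg hneg]
    ring
  constructor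
  · have h3 := Complex.tendsto_log_nhdsWithin_im_neg_of_re_neg_of_im_zero
      (z := ((t ^ 2 - s ^ 2 : ℝ) : ℂ)) (by rwa [ofReal_re]) (by rw [ofReal_im])
    rw [hn] at h3
    exact h3.comp h1
  · have h3 := Complex.tendsto_log_nhdsWithin_im_nonneg_of_re_neg_of_im_zero
      (z := ((t ^ 2 - s ^ 2 : ℝ) : ℂ)) (by rwa [ofReal_re]) (by rw [ofReal_im])
    rw [hn] at h3
    exact h3.comp h2

end BoundaryValues

/-! ### The shortened cut as a closed set with dense complement -/

section Ray

variable {k₀ : ℂ}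

/-- The part of the undeformed contour beyond the parameter `t`. -/
noncomputable def ray (k₀ : ℂ) (t : ℝ) : Set ℂ := undeformed k₀ '' Ici t

theorem mem_ray_of_sq_eq (hB : 0 < (k₀ ^ 2).im) {k : ℂ} {s t : ℝ} (hk : 0 < k.im) (hs : t ≤ s)
    (h : k ^ 2 = k₀ ^ 2 - (s : ℂ) ^ 2) : k ∈ ray k₀ t := by
  refine ⟨s, hs, ?_⟩
  rw [← undeformed_sq, sq_eq_sq_iff_eq_or_eq_neg] at h
  rcases h with h | h
  · exact h.symm
  · have := undeformed_im_pos hB s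
    rw [h, neg_im] at hk
    linarith

theorem mem_ray_iff (hB : 0 < (k₀ ^ 2).im) {k : ℂ} {t : ℝ} (ht : 0 ≤ t) :
    k ∈ ray k₀ t ↔ 0 ≤ k.im ∧ (k ^ 2).im = (k₀ ^ 2).im ∧ (k ^ 2).re ≤ (k₀ ^ 2).re - t ^ 2 := by
  constructor
  · rintro ⟨s, hs, rfl⟩
    refine ⟨(undeformed_im_pos hB s).le, ?_, ?_⟩
    · rw [undeformed_sq, base_im]
    · rw [undeformed_sq, base_re]
      have : t ≤ s := hs
      nlinarith
  · rintro ⟨h1, h2, h3⟩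
    have him : 0 < k.im := by
      refine lt_of_le_of_ne h1 fun h => ?_
      rw [pow_two, mul_im, ← h] at h2
      linarith
    have hs : 0 ≤ (k₀ ^ 2).re - (k ^ 2).re := by nlinarith
    refine mem_ray_of_sq_eq hB him (Real.le_sqrt_of_sq_le (by linarith) :
      t ≤ Real.sqrt ((k₀ ^ 2).re - (k ^ 2).re)) ?_
    apply Complex.ext
    · rw [base_re, Real.sq_sqrt hs]
      ring
    · rw [base_im, h2]

theorem isClosed_ray (hB : 0 < (k₀ ^ 2).im) {t : ℝ} (ht : 0 ≤ t) : IsClosed (ray k₀ t) := by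
  have : ray k₀ t = {k | 0 ≤ k.im} ∩ {k | (k ^ 2).im = (k₀ ^ 2).im} ∩
      {k | (k ^ 2).re ≤ (k₀ ^ 2).re - t ^ 2} := by
    ext k
    rw [mem_ray_iff hB ht]
    simp [and_assoc]
  rw [this]
  refine IsClosed.inter (IsClosed.inter ?_ ?_) ?_
  · exact isClosed_le continuous_const continuous_im
  · exact isClosed_eq (by fun_prop) continuous_const
  · exact isClosed_le (by fun_prop) continuous_const

theorem sq_im_of_mem_ray (hB : 0 < (k₀ ^ 2).im) {k : ℂ} {t : ℝ} (hk : k ∈ ray k₀ t) :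
    0 < k.im ∧ (k ^ 2).im = (k₀ ^ 2).im := by
  obtain ⟨s, -, rfl⟩ := hk
  exact ⟨undeformed_im_pos hB s, by rw [undeformed_sq, base_im]⟩

/-- A horizontal displacement changes `Im k² = 2 Re k Im k` as soon as `Im k ≠ 0`, and `b ≠ 0`
forces this. -/
theorem dense_sq_im_ne {b : ℝ} (hb : b ≠ 0) : Dense {k : ℂ | (k ^ 2).im ≠ b} := by
  intro k
  by_cases hk : (k ^ 2).im = b
  swap
  · exact subset_closure hk
  have him : k.im ≠ 0 := by
    intro h
    rw [pow_two, mul_im, h] at hk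
    simp at hk
    exact hb hk.symm
  have h1 : Tendsto (fun δ : ℝ => k + δ) (𝓝[≠] 0) (𝓝 k) := by
    have : Continuous fun δ : ℝ => k + (δ : ℂ) := by fun_prop
    have := this.tendsto 0
    simp only [ofReal_zero, add_zero] at this
    exact this.mono_left nhdsWithin_le_nhds
  refine mem_closure_of_tendsto h1 ?_
  filter_upwards [self_mem_nhdsWithin] with δ hδ h
  rw [pow_two, mul_im] at h hk
  simp only [add_re, ofReal_re, add_im, ofReal_im, add_zero] at h
  have : δ * k.im = 0 := by linarith
  rcases mul_eq_zero.1 this with h | h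
  · exact hδ h
  · exact him h

theorem dense_compl_ray (hB : 0 < (k₀ ^ 2).im) (t : ℝ) : Dense (ray k₀ t)ᶜ :=
  (dense_sq_im_ne hB.ne').mono fun k (hk : (k ^ 2).im ≠ _) h => hk (sq_im_of_mem_ray hB h).2

theorem differentiableAt_cutLog (hB : 0 < (k₀ ^ 2).im) {k : ℂ} {t : ℝ} (ht : 0 ≤ t)
    (hk : 0 < k.im) (hkr : k ∉ ray k₀ t) :
    DifferentiableAt ℂ (cutLog (undeformed k₀ t)) k := by
  have : k ^ 2 - undeformed k₀ t ^ 2 ∈ slitPlane := by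
    by_contra h
    rw [mem_slitPlane_iff] at h
    push Not at h
    apply hkr
    rw [mem_ray_iff hB ht]
    rw [undeformed_sq, sub_re, sub_im, base_re, base_im] at h
    exact ⟨hk.le, by linarith [h.2], by linarith [h.1]⟩
  exact DifferentiableAt.clog (by fun_prop) this

theorem undeformed_im_mono (hB : 0 < (k₀ ^ 2).im) {s t : ℝ} (ht : 0 ≤ t) (hs : t ≤ s) :
    (undeformed k₀ t).im ≤ (undeformed k₀ s).im := by
  by_contra! h
  have h1 := undeformed_re_mul_im k₀ t
  have h2 := undeformed_re_mul_im k₀ s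
  have h3 := undeformed_re_sq_sub k₀ t
  have h4 := undeformed_re_sq_sub k₀ s
  have h5 := undeformed_im_pos hB s
  have h6 := undeformed_re_pos hB s
  have h7 := undeformed_re_pos hB t
  have h8 : (undeformed k₀ t).re ≤ (undeformed k₀ s).re := by
    by_contra! h'
    nlinarith
  nlinarith

theorem undeformed_re_anti (hB : 0 < (k₀ ^ 2).im) {s t : ℝ} (ht : 0 ≤ t) (hs : t ≤ s) :
    (undeformed k₀ s).re ≤ (undeformed k₀ t).re := by
  have h := undeformed_im_mono hB ht hs
  have h1 := undeformed_re_mul_im k₀ t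
  have h2 := undeformed_re_mul_im k₀ s
  have h5 := undeformed_im_pos hB t
  have h6 := undeformed_re_pos hB s
  by_contra! h'
  nlinarith

end Ray

/-! ### The multiplier and the exponent continued off the cut -/

section Multiplier

variable (k₀ η σ : ℂ)

/-- The branch of `√(k₀² - k²)` that is equal to `s` at the point `√(k₀² - s²)` of the contour. -/
noncomputable def zeta (k : ℂ) : ℂ := (k₀ ^ 2 - k ^ 2) ^ (1 / 2 : ℂ)

/-- The analytic continuation of the multiplier of the jump from the cut. -/
noncomputable def mHat (k : ℂ) : ℂ := (I * (σ * zeta k₀ k) + η) / (I * (σ * zeta k₀ k) - η)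

/-- The analytic continuation of the exponent from the cut. -/
noncomputable def lamHat (k : ℂ) : ℂ := Complex.log (mHat k₀ η σ k) / (2 * Real.pi * I)

/-- A function with the multiplicative jump `mHat` across the contour that ends at `e`. -/
noncomputable def cutFactor (e k : ℂ) : ℂ := exp (lamHat k₀ η σ k * cutLog e k)

theorem zeta_sq (k : ℂ) : zeta k₀ k ^ 2 = k₀ ^ 2 - k ^ 2 := by
  rw [zeta, ← Complex.cpow_nat_mul]
  simp

theorem zeta_undeformed {s : ℝ} (hs : 0 < s) : zeta k₀ (undeformed k₀ s) = s := by
  rw [zeta, undeformed_sq]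
  have h1 : k₀ ^ 2 - (k₀ ^ 2 - (s : ℂ) ^ 2) = ((s ^ 2 : ℝ) : ℂ) := by push_cast; ring
  have h2 : (1 / 2 : ℂ) = ((1 / 2 : ℝ) : ℂ) := by push_cast; rfl
  rw [h1, h2, ← ofReal_cpow (by positivity), ← Real.sqrt_eq_rpow, Real.sqrt_sq hs.le]

/-- The properties of the multiplier that hold far up in a vertical strip. -/
structure IsFar (k₀ η σ : ℂ) (C : ℝ) (k : ℂ) : Prop where
  one_le : 1 ≤ k.im
  norm_le : ‖k‖ ≤ 2 * k.im
  re_pos : 0 < (k₀ ^ 2 - k ^ 2).re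
  denom : ‖k‖ / 4 ≤ ‖I * (σ * zeta k₀ k) - η‖
  mHat_sub : ‖mHat k₀ η σ k - 1‖ ≤ 1 / 2
  lamHat_le : ‖lamHat k₀ η σ k‖ ≤ C / ‖k‖
  lamHat_small : ‖lamHat k₀ η σ k‖ ≤ 1 / 4

variable {k₀ η σ}

/-- High in the strip `k` is nearly imaginary, so `k₀² - k²` has positive real part and `|ζ| ≥
|k|/2`. Then `m̂ - 1 = 2η/(iσζ - η)` is at most `8|η|/|k| ≤ 1/8`, and the principal logarithm is at
most `3/2` of it. -/
theorem exists_isFar (hσ : ‖σ‖ = 1) : ∃ C M : ℝ, 0 ≤ C ∧ ∀ k : ℂ, |k.re| < 4 → M ≤ k.im →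
    IsFar k₀ η σ C k := by
  refine ⟨12 * ‖η‖, 64 * ‖η‖ + 2 * ‖k₀‖ + 16, by positivity, fun k hre him => ?_⟩
  have hη := norm_nonneg η
  have hk₀ := norm_nonneg k₀
  have h1 : k.im ≤ ‖k‖ := (le_abs_self _).trans (Complex.abs_im_le_norm k)
  have h2 : ‖k‖ ≤ 2 * k.im := by
    have := Complex.norm_le_abs_re_add_abs_im k
    rw [abs_of_nonneg (show 0 ≤ k.im by linarith)] at this
    linarith
  have hk : 0 < ‖k‖ := by linarith
  have hre' := abs_lt.1 hre
  have h3 : 0 < (k₀ ^ 2 - k ^ 2).re := by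
    have e1 : |(k₀ ^ 2).re| ≤ ‖k₀‖ ^ 2 := by
      rw [← norm_pow]; exact Complex.abs_re_le_norm _
    have e2 := (abs_le.1 e1).1
    have e3 : (k ^ 2).re = k.re ^ 2 - k.im ^ 2 := by rw [pow_two, mul_re]; ring
    rw [sub_re, e3]
    nlinarith
  have h4 : ‖k‖ / 2 ≤ ‖zeta k₀ k‖ := by
    have e1 : ‖zeta k₀ k‖ ^ 2 = ‖k₀ ^ 2 - k ^ 2‖ := by rw [← norm_pow, zeta_sq]
    have e2 : ‖k‖ ^ 2 - ‖k₀‖ ^ 2 ≤ ‖k₀ ^ 2 - k ^ 2‖ := by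
      rw [← norm_pow, ← norm_pow, norm_sub_rev]
      exact norm_sub_norm_le _ _
    refine abs_le_of_sq_le_sq' ?_ (norm_nonneg _) |>.2
    rw [e1]
    nlinarith
  have h5 : ‖k‖ / 4 ≤ ‖I * (σ * zeta k₀ k) - η‖ := by
    have e1 : ‖I * (σ * zeta k₀ k)‖ = ‖zeta k₀ k‖ := by simp [hσ]
    have e2 := norm_sub_norm_le (I * (σ * zeta k₀ k)) η
    rw [e1] at e2
    linarith
  have hne : I * (σ * zeta k₀ k) - η ≠ 0 := norm_pos_iff.1 (by linarith)
  have h6 : mHat k₀ η σ k - 1 = 2 * η / (I * (σ * zeta k₀ k) - η) := by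
    rw [mHat, div_sub_one hne]
    congr 1
    ring
  have h7 : ‖mHat k₀ η σ k - 1‖ ≤ 8 * ‖η‖ / ‖k‖ := by
    rw [h6, norm_div, norm_mul, norm_ofNat, div_le_div_iff₀ (by linarith) hk]
    nlinarith
  have h8 : 8 * ‖η‖ / ‖k‖ ≤ 1 / 8 := by
    rw [div_le_div_iff₀ hk (by norm_num)]
    linarith
  have h9 : ‖lamHat k₀ η σ k‖ ≤ (3 / 2) * ‖mHat k₀ η σ k - 1‖ := by
    have e1 := Complex.norm_log_one_add_half_le_self (z := mHat k₀ η σ k - 1) (by linarith)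
    rw [add_sub_cancel] at e1
    rw [lamHat, norm_div]
    refine le_trans ?_ e1
    refine div_le_self (norm_nonneg _) ?_
    have := Real.pi_gt_three
    simp [abs_of_pos Real.pi_pos]
    linarith
  refine ⟨by linarith, h2, h3, h5, by linarith, ?_, by linarith⟩
  calc _ ≤ (3 / 2) * (8 * ‖η‖ / ‖k‖) := by linarith
    _ = _ := by ring

namespace IsFar

variable {C : ℝ} {k : ℂ}

theorem im_pos (h : IsFar k₀ η σ C k) : 0 < k.im := by linarith [h.one_le]

theorem im_le_norm (_ : IsFar k₀ η σ C k) : k.im ≤ ‖k‖ :=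
  (le_abs_self _).trans (Complex.abs_im_le_norm k)

theorem norm_pos (h : IsFar k₀ η σ C k) : 0 < ‖k‖ := h.im_pos.trans_le h.im_le_norm

theorem denom_ne_zero (h : IsFar k₀ η σ C k) : I * (σ * zeta k₀ k) - η ≠ 0 := by
  refine norm_pos_iff.1 ?_
  have := h.denom
  have := h.norm_pos
  linarith

theorem mHat_mem (h : IsFar k₀ η σ C k) : mHat k₀ η σ k ∈ slitPlane := by
  rw [mem_slitPlane_iff]
  left
  have h1 := (abs_le.1 ((Complex.abs_re_le_norm _).trans h.mHat_sub)).1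
  rw [sub_re, one_re] at h1
  linarith

theorem exp_lamHat (h : IsFar k₀ η σ C k) :
    exp (2 * Real.pi * I * lamHat k₀ η σ k) = mHat k₀ η σ k := by
  rw [lamHat, mul_div_cancel₀, exp_log (slitPlane_ne_zero h.mHat_mem)]
  exact two_pi_I_ne_zero

theorem differentiableAt_zeta (h : IsFar k₀ η σ C k) : DifferentiableAt ℂ (zeta k₀) k :=
  DifferentiableAt.cpow_const (by fun_prop) (mem_slitPlane_iff.2 (Or.inl h.re_pos))

theorem differentiableAt_mHat (h : IsFar k₀ η σ C k) : DifferentiableAt ℂ (mHat k₀ η σ) k := by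
  have h1 := h.differentiableAt_zeta
  have h2 := h.denom_ne_zero
  unfold mHat
  fun_prop (disch := assumption)

theorem differentiableAt_lamHat (h : IsFar k₀ η σ C k) :
    DifferentiableAt ℂ (lamHat k₀ η σ) k :=
  (h.differentiableAt_mHat.clog h.mHat_mem).div_const _

end IsFar

end Multiplier

/-! ### The scalar jump problem and its model solutions -/

theorem norm_cutLog_le (e k : ℂ) :
    ‖cutLog e k‖ ≤ |Real.log ‖k ^ 2 - e ^ 2‖| + Real.pi := by
  refine (Complex.norm_le_abs_re_add_abs_im _).trans ?_
  rw [cutLog, log_re, log_im]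
  gcongr
  exact abs_arg_le_pi _

/-- The inhomogeneous term of the scalar jump condition. -/
noncomputable def coupling (a : ℝ) (k₀ η σ : ℂ) (B y : ℂ → ℂ) (k : ℂ) : ℂ :=
  B k / (I * (σ * zeta k₀ k) - η) * (exp (2 * I * a * k) * y (-k))

/-- A particular solution of the inhomogeneous jump condition on the cut that ends at `e`. -/
noncomputable def particular (a : ℝ) (k₀ η σ : ℂ) (B : ℂ → ℂ) (e : ℂ) (y : ℂ → ℂ) (k : ℂ) : ℂ :=
  if η = 0 then coupling a k₀ η σ B y k * cutLog e k / (2 * Real.pi * I)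
  else -(B k / (2 * η)) * (exp (2 * I * a * k) * y (-k))

/-- One row of the Riemann--Hilbert problem, with both columns made regular off the upper cut
and freed of the exponential factors: `p` is subject to a jump condition that involves `y`. -/
structure IsScalarSolution (a : ℝ) (k₀ η σ : ℂ) (B : ℂ → ℂ) (t : ℝ) (p y : ℂ → ℂ) : Prop where
  diff_left : ∀ k ∉ ray k₀ t, DifferentiableAt ℂ p k
  diff_right : ∀ k ∉ ray k₀ t, DifferentiableAt ℂ y k
  jump : ∀ s, t < s → ∃ l, HasLeftValue (undeformed k₀) p s l ∧
    HasRightValue (undeformed k₀) p s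
      (mHat k₀ η σ (undeformed k₀ s) * l + coupling a k₀ η σ B y (undeformed k₀ s))
  tip : p =O[𝓝[(ray k₀ t)ᶜ] undeformed k₀ t] fun k => ‖k - undeformed k₀ t‖ ^ (-(1 / 4) : ℝ)

/-- The open half-strip in which the regularized function is defined. -/
def farStrip (e : ℂ) : Set ℂ := {k | |k.re| < 4 ∧ e.im - 4 < k.im}

theorem isOpen_farStrip (e : ℂ) : IsOpen (farStrip e) :=
  by
  have h1 : Continuous fun k : ℂ => |k.re| := continuous_re.abs
  exact (isOpen_lt h1 continuous_const).inter (isOpen_lt continuous_const continuous_im)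

/-! ### Removal of the singularity at the end of the cut -/

section Tip

variable {e k : ℂ}

theorem norm_sub_le_norm_sq_sub (he : 1 ≤ e.im) (hk : 0 ≤ k.im) : ‖k - e‖ ≤ ‖k ^ 2 - e ^ 2‖ := by
  have h1 : k ^ 2 - e ^ 2 = (k - e) * (k + e) := by ring
  have h2 : 1 ≤ ‖k + e‖ := by
    have := (le_abs_self _).trans (Complex.abs_im_le_norm (k + e))
    rw [add_im] at this
    linarith
  rw [h1, norm_mul]
  exact le_mul_of_one_le_right (norm_nonneg _) h2

theorem norm_cutLog_le_rpow (he : 1 ≤ e.im) (hk : 0 ≤ k.im) (hne : k ≠ e)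
    (hx : ‖k ^ 2 - e ^ 2‖ ≤ 1) : ‖cutLog e k‖ ≤ 8 * ‖k - e‖ ^ (-(1 / 4) : ℝ) := by
  have h0 : 0 < ‖k - e‖ := norm_pos_iff.2 (sub_ne_zero.2 hne)
  have h1 := norm_sub_le_norm_sq_sub he hk
  have hx0 : 0 < ‖k ^ 2 - e ^ 2‖ := h0.trans_le h1
  have h2 := Real.abs_log_mul_self_rpow_lt _ (1 / 4) hx0 hx (by norm_num)
  have h3 : ‖k ^ 2 - e ^ 2‖ ^ (-(1 / 4) : ℝ) ≤ ‖k - e‖ ^ (-(1 / 4) : ℝ) :=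
    Real.rpow_le_rpow_of_nonpos h0 h1 (by norm_num)
  have h4 : |Real.log ‖k ^ 2 - e ^ 2‖| ≤ 4 * ‖k ^ 2 - e ^ 2‖ ^ (-(1 / 4) : ℝ) := by
    have hp : 0 < ‖k ^ 2 - e ^ 2‖ ^ (1 / 4 : ℝ) := Real.rpow_pos_of_pos hx0 _
    rw [abs_mul, abs_of_pos hp] at h2
    rw [Real.rpow_neg hx0.le, ← div_eq_mul_inv, le_div_iff₀ hp]
    have : (1 : ℝ) / (1 / 4) = 4 := by norm_num
    linarith
  have h5 : 1 ≤ ‖k - e‖ ^ (-(1 / 4) : ℝ) :=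
    Real.one_le_rpow_of_pos_of_le_one_of_nonpos h0 (h1.trans hx) (by norm_num)
  have := norm_cutLog_le e k
  have := Real.pi_lt_four
  linarith

/-- The logarithm is a real logarithm plus an argument bounded by `π`. An exponent of size at most
`1/4` therefore costs a power `-1/4` and a constant `e^{π/4}`. -/
theorem norm_inv_exp_mul_cutLog_le {v : ℂ} (he : 1 ≤ e.im) (hk : 0 ≤ k.im) (hne : k ≠ e)
    (hx : ‖k ^ 2 - e ^ 2‖ ≤ 1) (hv : ‖v‖ ≤ 1 / 4) :
    ‖(exp (v * cutLog e k))⁻¹‖ ≤ Real.exp (Real.pi / 4) * ‖k - e‖ ^ (-(1 / 4) : ℝ) := by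
  have h0 : 0 < ‖k - e‖ := norm_pos_iff.2 (sub_ne_zero.2 hne)
  have h1 := norm_sub_le_norm_sq_sub he hk
  have hx0 : 0 < ‖k ^ 2 - e ^ 2‖ := h0.trans_le h1
  have h3 : ‖k ^ 2 - e ^ 2‖ ^ (-(1 / 4) : ℝ) ≤ ‖k - e‖ ^ (-(1 / 4) : ℝ) :=
    Real.rpow_le_rpow_of_nonpos h0 h1 (by norm_num)
  rw [← Complex.exp_neg]
  refine (Complex.norm_exp_le_exp_norm _).trans ?_
  rw [norm_neg, norm_mul]
  have h4 := norm_cutLog_le e k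
  rw [abs_of_nonpos (Real.log_nonpos hx0.le hx)] at h4
  have h5 : ‖v‖ * ‖cutLog e k‖ ≤
      Real.pi / 4 + Real.log ‖k ^ 2 - e ^ 2‖ * (-(1 / 4) : ℝ) := by
    have := mul_le_mul hv h4 (norm_nonneg _) (by norm_num)
    linarith
  calc _ ≤ Real.exp (Real.pi / 4 + Real.log ‖k ^ 2 - e ^ 2‖ * (-(1 / 4) : ℝ)) :=
        Real.exp_le_exp.2 h5
    _ = Real.exp (Real.pi / 4) * ‖k ^ 2 - e ^ 2‖ ^ (-(1 / 4) : ℝ) := by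
        rw [Real.exp_add, Real.rpow_def_of_pos hx0]
    _ ≤ _ := by gcongr

theorem isLittleO_rpow_inv (e : ℂ) :
    (fun k : ℂ => ‖k - e‖ ^ (-(1 / 2) : ℝ)) =o[𝓝[≠] e] fun k => (k - e)⁻¹ := by
  refine IsLittleO.of_norm_right ?_
  refine isLittleO_of_tendsto' ?_ ?_
  · filter_upwards [self_mem_nhdsWithin] with k hk h
    have : k - e ≠ 0 := sub_ne_zero.2 hk
    simp [this] at h
  · have h1 : Tendsto (fun k : ℂ => ‖k - e‖ ^ (1 / 2 : ℝ)) (𝓝[≠] e) (𝓝 0) := by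
      have : Continuous fun k : ℂ => ‖k - e‖ ^ (1 / 2 : ℝ) :=
        Continuous.rpow_const (by fun_prop) fun _ => Or.inr (by norm_num)
      have := this.tendsto e
      simp only [sub_self, norm_zero] at this
      rw [Real.zero_rpow (by norm_num)] at this
      exact this.mono_left nhdsWithin_le_nhds
    refine h1.congr' ?_
    filter_upwards [self_mem_nhdsWithin] with k hk
    have h2 : 0 < ‖k - e‖ := norm_pos_iff.2 (sub_ne_zero.2 hk)
    rw [norm_inv, div_inv_eq_mul, ← Real.rpow_add_one h2.ne']
    norm_num

/-- A singularity that is weaker than a pole is removable, if the estimate is known on a dense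
set. -/
theorem exists_differentiableOn_of_isBigO {f : ℂ → ℂ} {Ω A : Set ℂ} (hΩ : IsOpen Ω)
    (hA : Dense A) (he : e ∈ Ω) (hf : DifferentiableOn ℂ f (Ω \ {e}))
    (hO : f =O[𝓝[A] e] fun k => ‖k - e‖ ^ (-(1 / 2) : ℝ)) :
    ∃ g : ℂ → ℂ, DifferentiableOn ℂ g Ω ∧ ∀ k ≠ e, g k = f k := by
  refine ⟨Function.update f e (limUnder (𝓝[≠] e) f), ?_, fun k hk => Function.update_of_ne hk _ _⟩
  refine Complex.differentiableOn_update_limUnder_of_isLittleO (hΩ.mem_nhds he) hf ?_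
  have hopen : IsOpen (Ω \ {e}) := hΩ.sdiff isClosed_singleton
  refine IsLittleO.sub ?_ ?_
  · refine IsBigO.trans_isLittleO ?_ (isLittleO_rpow_inv e)
    obtain ⟨C, hC⟩ := hO.bound
    refine IsBigO.of_bound C ?_
    rw [← eventually_nhds_nhdsWithin] at hC
    filter_upwards [nhdsWithin_le_nhds hC, nhdsWithin_le_nhds (hΩ.mem_nhds he),
      self_mem_nhdsWithin] with k h1 h2 h3
    have hne : (𝓝[A] k).NeBot := mem_closure_iff_nhdsWithin_neBot.1 (hA k)
    have hfk : ContinuousAt f k :=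
      (hf.differentiableAt (hopen.mem_nhds ⟨h2, h3⟩)).continuousAt
    have hk0 : ‖k - e‖ ≠ 0 := norm_ne_zero_iff.2 (sub_ne_zero.2 h3)
    have hgk : ContinuousAt (fun k : ℂ => C * ‖‖k - e‖ ^ (-(1 / 2) : ℝ)‖) k := by
      have h4 : ContinuousAt (fun k : ℂ => ‖k - e‖) k := by fun_prop
      exact continuousAt_const.mul (h4.rpow_const (Or.inl hk0)).norm
    exact le_of_tendsto_of_tendsto (hfk.norm.tendsto.mono_left nhdsWithin_le_nhds)
      (hgk.tendsto.mono_left nhdsWithin_le_nhds) h1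
  · rw [isLittleO_const_left]
    right
    have : Tendsto (fun k : ℂ => k - e) (𝓝[≠] e) (𝓝[≠] 0) := by
      refine tendsto_nhdsWithin_iff.2 ⟨?_, ?_⟩
      · have : Continuous fun k : ℂ => k - e := by fun_prop
        have := this.tendsto e
        rw [sub_self] at this
        exact this.mono_left nhdsWithin_le_nhds
      · filter_upwards [self_mem_nhdsWithin] with k hk using sub_ne_zero.2 hk
    exact tendsto_norm_inv_nhdsNE_zero_atTop.comp this

end Tip

/-! ### The regularized function -/

section Regularization

variable {a : ℝ} {k₀ η σ : ℂ} {B : ℂ → ℂ} {C t : ℝ} {p y : ℂ → ℂ}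

/-- The difference of `p` and a particular solution satisfies the homogeneous jump condition, and so
does `cutFactor`; the quotient has no jump. It extends across the interior of the cut by Painlevé's
theorem, and then across the tip since its growth there is weaker than a pole. -/
theorem IsScalarSolution.exists_regularization (hB : 0 < (k₀ ^ 2).im) (hBd : Differentiable ℂ B)
    (ht : 0 ≤ t) (hfar : ∀ k ∈ farStrip (undeformed k₀ t), IsFar k₀ η σ C k)
    (he : undeformed k₀ t ∈ farStrip (undeformed k₀ t))
    (h : IsScalarSolution a k₀ η σ B t p y) :
    ∃ r : ℂ → ℂ, DifferentiableOn ℂ r (farStrip (undeformed k₀ t)) ∧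
      ∀ k ∈ farStrip (undeformed k₀ t), k ∉ ray k₀ t →
        r k = (p k - particular a k₀ η σ B (undeformed k₀ t) y k) /
          cutFactor k₀ η σ (undeformed k₀ t) k := by
  set e := undeformed k₀ t with he_def
  set Ω := farStrip e
  set r₀ : ℂ → ℂ := fun k => (p k - particular a k₀ η σ B e y k) / cutFactor k₀ η σ e k with hr₀
  have hΩ : IsOpen Ω := isOpen_farStrip e
  have hclosed := isClosed_ray hB ht
  have hdense := dense_compl_ray hB t
  have her : e ∈ ray k₀ t := ⟨t, self_mem_Ici, rfl⟩
  have hy : ∀ k ∈ Ω, DifferentiableAt ℂ (fun k => exp (2 * I * a * k) * y (-k)) k := by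
    intro k hk
    have h1 : -k ∉ ray k₀ t := fun h' => by
      have := (sq_im_of_mem_ray hB h').1
      rw [neg_im] at this
      have := (hfar k hk).im_pos
      linarith
    have h2 : DifferentiableAt ℂ (fun k => y (-k)) k :=
      DifferentiableAt.comp k (h.diff_right _ h1) differentiable_neg.differentiableAt
    have h3 : DifferentiableAt ℂ (fun k : ℂ => exp (2 * I * a * k)) k := by fun_prop
    exact h3.mul h2
  have hcd : ∀ k ∈ Ω, DifferentiableAt ℂ (coupling a k₀ η σ B y) k := by
    intro k hk
    have h1 := (hfar k hk).differentiableAt_zeta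
    have h2 := (hfar k hk).denom_ne_zero
    have h3 := hBd k
    refine DifferentiableAt.mul ?_ (hy k hk)
    fun_prop (disch := assumption)
  have hdiff : DifferentiableOn ℂ r₀ (Ω \ ray k₀ t) := by
    intro k hk
    refine DifferentiableAt.differentiableWithinAt ?_
    have h1 := differentiableAt_cutLog hB ht (hfar k hk.1).im_pos hk.2
    have h2 := (hfar k hk.1).differentiableAt_lamHat
    refine DifferentiableAt.div ?_ ((h2.mul h1).cexp) (exp_ne_zero _)
    refine (h.diff_left k hk.2).sub ?_
    unfold particular
    split_ifs
    · exact ((hcd k hk.1).mul h1).div_const _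
    · exact (((hBd k).div_const _).neg).mul (hy k hk.1)
  have hct := continuous_tube_undeformed hB
  -- the jump is removed
  have hlim : ∀ k ∈ (Ω \ {e}) ∩ ray k₀ t, ∃ l, Tendsto r₀ (𝓝[(ray k₀ t)ᶜ] k) (𝓝 l) := by
    rintro _ ⟨⟨hkΩ, hke⟩, s, hs, rfl⟩
    have hst : t < s := by
      refine lt_of_le_of_ne hs ?_
      rintro rfl
      exact hke rfl
    have hf := hfar _ hkΩ
    obtain ⟨l, hL, hR⟩ := h.jump s hst
    obtain ⟨gL, gR⟩ := hasValue_cutLog hB ht hst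
    set κ := undeformed k₀ s with hκ
    set v := lamHat k₀ η σ κ with hv
    have gen : ∀ (L : Filter ℝ) (P Λ : ℂ), L ≤ 𝓝 0 →
        Tendsto (fun x => p (tube (undeformed k₀) x)) (𝓝 s ×ˢ L) (𝓝 P) →
        Tendsto (fun x => cutLog e (tube (undeformed k₀) x)) (𝓝 s ×ˢ L) (𝓝 Λ) →
        Tendsto (fun x => r₀ (tube (undeformed k₀) x)) (𝓝 s ×ˢ L)
          (𝓝 ((P - if η = 0 then coupling a k₀ η σ B y κ * Λ / (2 * Real.pi * I)
            else -(B κ / (2 * η)) * (exp (2 * I * a * κ) * y (-κ))) / exp (v * Λ))) := by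
      intro L P Λ hL0 hP hΛ
      have hT := tendsto_tube_prod (s := s) hL0 hct.continuousAt
      have h1 : Tendsto (fun x => lamHat k₀ η σ (tube (undeformed k₀) x)) (𝓝 s ×ˢ L) (𝓝 v) :=
        hf.differentiableAt_lamHat.continuousAt.tendsto.comp hT
      have h2 : Tendsto (fun x => cutFactor k₀ η σ e (tube (undeformed k₀) x)) (𝓝 s ×ˢ L)
          (𝓝 (exp (v * Λ))) := (h1.mul hΛ).cexp
      refine Tendsto.div (hP.sub ?_) h2 (exp_ne_zero _)
      unfold particular
      split_ifs
      · exact (((hcd _ hkΩ).continuousAt.tendsto.comp hT).mul hΛ).div_const _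
      · have h3 : ContinuousAt (fun k => -(B k / (2 * η)) * (exp (2 * I * a * k) * y (-k))) κ :=
          ((((hBd κ).div_const _).neg).mul (hy κ hkΩ)).continuousAt
        exact h3.tendsto.comp hT
    have r1 := gen _ _ _ nhdsWithin_le_nhds hL gL
    have r2 := gen _ _ _ nhdsWithin_le_nhds hR gR
    have hexp : exp (v * ((Real.log (s ^ 2 - t ^ 2) : ℂ) + Real.pi * I)) =
        mHat k₀ η σ κ * exp (v * ((Real.log (s ^ 2 - t ^ 2) : ℂ) - Real.pi * I)) := by
      rw [← hf.exp_lamHat, ← Complex.exp_add]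
      congr 1
      ring
    have hm0 : mHat k₀ η σ κ ≠ 0 := slitPlane_ne_zero hf.mHat_mem
    have hd0 := hf.denom_ne_zero
    -- Here `q₁`, `q₂` are the left and right values of the particular solution; the factor `m`
    -- cancels between numerator and denominator.
    have hval : ∀ {q₁ q₂ : ℂ}, q₂ = mHat k₀ η σ κ * q₁ + coupling a k₀ η σ B y κ → ∀ Ex : ℂ,
        (mHat k₀ η σ κ * l + coupling a k₀ η σ B y κ - q₂) / (mHat k₀ η σ κ * Ex) =
          (l - q₁) / Ex := by
      intro q₁ q₂ hq Ex
      rw [hq, show mHat k₀ η σ κ * l + coupling a k₀ η σ B y κ -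
        (mHat k₀ η σ κ * q₁ + coupling a k₀ η σ B y κ) = mHat k₀ η σ κ * (l - q₁) by ring,
        mul_div_mul_left _ _ hm0]
    rw [hexp, hval] at r2
    · refine ⟨_, tendsto_nhdsWithin_of_left_right (map_tube_undeformed hB (ht.trans_lt hst)) ?_
        r1 r2⟩
      filter_upwards [lt_mem_nhds hst] with s' hs'
      exact ⟨s', hs'.le, rfl⟩
    -- If `η = 0`, then `m = 1` and the additive jump is supplied by the `2πi` of the logarithm.
    -- Otherwise `q` is the continuous fixed point of `q = m q + coupling`, because `m - 1 = 2η/D`.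
    · split_ifs with hη
      · have hm1 : mHat k₀ η σ κ = 1 := by
          rw [hη, sub_zero] at hd0
          rw [mHat, hη, add_zero, sub_zero, div_self hd0]
        rw [hm1]
        have := two_pi_I_ne_zero
        field_simp
        ring
      · rw [mHat, coupling]
        set D := I * (σ * zeta k₀ κ) - η with hD
        rw [show I * (σ * zeta k₀ κ) + η = D + 2 * η by rw [hD]; ring]
        field_simp
        ring
  obtain ⟨hd1, heq1⟩ := differentiableOn_extendFrom (f := r₀) (Ω := Ω \ {e}) (S := ray k₀ t)
    (b := (k₀ ^ 2).im) (hΩ.sdiff isClosed_singleton) hclosed hdense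
    (fun k hk => sq_im_of_mem_ray hB hk.2)
    (hdiff.mono fun k hk => ⟨hk.1.1, hk.2⟩) hlim
  have hfe := hfar e he
  -- the estimate at the end of the cut
  have hev : ∀ᶠ k in 𝓝[(ray k₀ t)ᶜ] e, k ∈ Ω ∧ ‖k ^ 2 - e ^ 2‖ ≤ 1 ∧ k ≠ e := by
    have h1 : ∀ᶠ k in 𝓝 e, ‖k ^ 2 - e ^ 2‖ < 1 := by
      have : ContinuousAt (fun k : ℂ => ‖k ^ 2 - e ^ 2‖) e := by fun_prop
      exact this.eventually (gt_mem_nhds (by simp))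
    filter_upwards [nhdsWithin_le_nhds (hΩ.mem_nhds he), nhdsWithin_le_nhds h1,
      self_mem_nhdsWithin] with k h1 h2 h3
    exact ⟨h1, h2.le, fun h' => h3 (h' ▸ her)⟩
  have hone : ∀ {f : ℂ → ℂ}, ContinuousAt f e →
      f =O[𝓝[(ray k₀ t)ᶜ] e] fun k => ‖k - e‖ ^ (-(1 / 4) : ℝ) := by
    intro f hf
    have h1 : f =O[𝓝[(ray k₀ t)ᶜ] e] fun _ => (1 : ℝ) :=
      (hf.tendsto.mono_left nhdsWithin_le_nhds).isBigO_one ℝ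
    refine h1.trans (IsBigO.of_bound 1 ?_)
    filter_upwards [hev] with k hk
    have h0 : 0 < ‖k - e‖ := norm_pos_iff.2 (sub_ne_zero.2 hk.2.2)
    have h5 : 1 ≤ ‖k - e‖ ^ (-(1 / 4) : ℝ) :=
      Real.one_le_rpow_of_pos_of_le_one_of_nonpos h0
        ((norm_sub_le_norm_sq_sub hfe.one_le (hfar k hk.1).im_pos.le).trans hk.2.1) (by norm_num)
    rw [norm_one, one_mul]
    exact h5.trans (le_abs_self _)
  have hlog : cutLog e =O[𝓝[(ray k₀ t)ᶜ] e] fun k => ‖k - e‖ ^ (-(1 / 4) : ℝ) := by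
    refine IsBigO.of_bound 8 ?_
    filter_upwards [hev] with k hk
    rw [Real.norm_of_nonneg (by positivity)]
    exact norm_cutLog_le_rpow hfe.one_le (hfar k hk.1).im_pos.le hk.2.2 hk.2.1
  have hinv : (fun k => (cutFactor k₀ η σ e k)⁻¹) =O[𝓝[(ray k₀ t)ᶜ] e]
      fun k => ‖k - e‖ ^ (-(1 / 4) : ℝ) := by
    refine IsBigO.of_bound (Real.exp (Real.pi / 4)) ?_
    filter_upwards [hev] with k hk
    rw [Real.norm_of_nonneg (by positivity)]
    exact norm_inv_exp_mul_cutLog_le hfe.one_le (hfar k hk.1).im_pos.le hk.2.2 hk.2.1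
      (hfar k hk.1).lamHat_small
  have hq : particular a k₀ η σ B e y =O[𝓝[(ray k₀ t)ᶜ] e]
      fun k => ‖k - e‖ ^ (-(1 / 4) : ℝ) := by
    unfold particular
    split_ifs
    · have h1 : (fun k => coupling a k₀ η σ B y k / (2 * Real.pi * I)) =O[𝓝[(ray k₀ t)ᶜ] e]
          fun _ => (1 : ℝ) := by
        have := ((hcd e he).div_const (2 * Real.pi * I)).continuousAt
        exact (this.tendsto.mono_left nhdsWithin_le_nhds).isBigO_one ℝ
      have h2 := h1.mul hlog
      refine h2.congr (fun k => ?_) (fun k => ?_)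
      · ring
      · rw [one_mul]
    · exact hone ((((hBd e).div_const _).neg).mul (hy e he)).continuousAt
  -- A power `-1/4` from the numerator and another from the inverse factor, together still weaker
  -- than a pole.
  have hr₀O : r₀ =O[𝓝[(ray k₀ t)ᶜ] e] fun k => ‖k - e‖ ^ (-(1 / 2) : ℝ) := by
    have h1 := (h.tip.sub hq).mul hinv
    refine h1.congr' (Eventually.of_forall fun k => (div_eq_mul_inv _ _).symm) ?_
    filter_upwards [hev] with k hk
    have h0 : 0 < ‖k - e‖ := norm_pos_iff.2 (sub_ne_zero.2 hk.2.2)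
    rw [← Real.rpow_add h0]
    norm_num
  have hO : extendFrom (ray k₀ t)ᶜ r₀ =O[𝓝[(ray k₀ t)ᶜ] e]
      fun k => ‖k - e‖ ^ (-(1 / 2) : ℝ) := by
    refine hr₀O.congr' ?_ EventuallyEq.rfl
    filter_upwards [hev, self_mem_nhdsWithin] with k hk hk'
    exact (heq1 k ⟨⟨hk.1, hk.2.2⟩, hk'⟩).symm
  obtain ⟨g, hg, hge⟩ := exists_differentiableOn_of_isBigO hΩ hdense he hd1 hO
  refine ⟨g, hg, fun k hk hkr => ?_⟩
  have hke : k ≠ e := fun h' => hkr (h' ▸ her)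
  rw [hge k hke, heq1 k ⟨⟨hk, hke⟩, hkr⟩]

end Regularization

/-! ### The regularization is a small perturbation far up -/

section Estimates

variable {a : ℝ} {k₀ η σ : ℂ} {B : ℂ → ℂ}

/-- The logarithm is at most `4 + 2 log|k|` plus an argument below `4`. With `log|k| ≤ |k|^{1/4}/4`
and `|k|^{1/4} ≥ 16` this is at most `|k|^{1/4}`, uniformly in the tip `e`. -/
theorem exists_forall_norm_cutLog_le : ∃ M : ℝ, ∀ e k : ℂ, M ≤ k.im → 1 ≤ e.im → |e.re| ≤ 1 →
    e.im ≤ k.im + 4 → 1 / 2 ≤ ‖k - e‖ → ‖cutLog e k‖ ≤ ‖k‖ ^ (1 / 4 : ℝ) := by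
  have h1 := (isLittleO_log_rpow_atTop (show (0 : ℝ) < 1 / 4 by norm_num)).bound
    (show (0 : ℝ) < 1 / 4 by norm_num)
  have h2 := (tendsto_rpow_atTop (show (0 : ℝ) < 1 / 4 by norm_num)).eventually_ge_atTop 16
  obtain ⟨M, hM⟩ := (h1.and h2).exists_forall_of_atTop
  refine ⟨max M 5, fun e k hk he hre hek hd => ?_⟩
  have hk5 : 5 ≤ k.im := (le_max_right _ _).trans hk
  have hkn : k.im ≤ ‖k‖ := (le_abs_self _).trans (Complex.abs_im_le_norm k)
  obtain ⟨h3, h4⟩ := hM ‖k‖ (((le_max_left _ _).trans hk).trans hkn)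
  have hen : ‖e‖ ≤ 2 * ‖k‖ := by
    have := Complex.norm_le_abs_re_add_abs_im e
    rw [abs_of_nonneg (show 0 ≤ e.im by linarith)] at this
    linarith
  have hx1 : 1 ≤ ‖k ^ 2 - e ^ 2‖ := by
    have e1 : k ^ 2 - e ^ 2 = (k - e) * (k + e) := by ring
    have e2 : 2 ≤ ‖k + e‖ := by
      have := (le_abs_self _).trans (Complex.abs_im_le_norm (k + e))
      rw [add_im] at this
      linarith
    rw [e1, norm_mul]
    nlinarith
  have hx2 : ‖k ^ 2 - e ^ 2‖ ≤ 5 * ‖k‖ ^ 2 := by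
    have := norm_sub_le (k ^ 2) (e ^ 2)
    rw [norm_pow, norm_pow] at this
    nlinarith [norm_nonneg e]
  have hk0 : 0 < ‖k‖ := by linarith
  have h5 : Real.log ‖k ^ 2 - e ^ 2‖ ≤ 4 + 2 * Real.log ‖k‖ := by
    have := Real.log_le_log (by linarith) hx2
    rw [Real.log_mul (by norm_num) (by positivity), Real.log_pow] at this
    have h6 := Real.log_le_sub_one_of_pos (show (0 : ℝ) < 5 by norm_num)
    push_cast at this
    linarith
  have h6 := norm_cutLog_le e k
  rw [abs_of_nonneg (Real.log_nonneg hx1)] at h6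
  rw [Real.norm_of_nonneg (show 0 ≤ ‖k‖ ^ (1 / 4 : ℝ) by positivity)] at h3
  have h7 := (le_abs_self _).trans h3
  have := Real.pi_lt_four
  linarith

/-- Far up in the strip the regularized function is close to the original one. -/
theorem exists_forall_norm_sub_le (ha : 0 < a) (hσ : ‖σ‖ = 1) {b : ℝ}
    (hb : ∀ k, ‖B k‖ ≤ b * (1 + ‖k‖)) :
    ∃ C M : ℝ, 0 ≤ C ∧ ∀ (e k p : ℂ) (y : ℂ → ℂ), M ≤ k.im → |k.re| < 4 → 1 ≤ e.im → |e.re| ≤ 1 →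
      e.im ≤ k.im + 4 → 1 / 2 ≤ ‖k - e‖ →
      ‖p - (p - particular a k₀ η σ B e y k) / cutFactor k₀ η σ e k‖ ≤
        C * k.im ^ (-(3 / 4) : ℝ) * (‖p‖ + ‖y (-k)‖) := by
  obtain ⟨C, M₁, hC, hfar⟩ := exists_isFar (k₀ := k₀) (η := η) hσ
  obtain ⟨M₂, hlog⟩ := exists_forall_norm_cutLog_le
  have hb0 : 0 ≤ b := by
    have := (norm_nonneg _).trans (hb 0)
    simpa using this
  -- The power `7/4 = 1 + 3/4` absorbs the linear growth of the particular solution and leaves the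
  -- decay `-3/4` that `λ̂ · cutLog` has.
  have t1 := (tendsto_rpow_mul_exp_neg_mul_atTop_nhds_zero (7 / 4) (2 * a) (by linarith)).eventually
    (ge_mem_nhds (show (0 : ℝ) < 1 by norm_num))
  have t2 : ∀ᶠ u : ℝ in atTop, C * u ^ (-(3 / 4) : ℝ) ≤ 1 := by
    have := (tendsto_rpow_neg_atTop (show (0 : ℝ) < 3 / 4 by norm_num)).const_mul C
    rw [mul_zero] at this
    exact this.eventually (ge_mem_nhds (by norm_num))
  obtain ⟨M₃, hM₃⟩ := (t1.and t2).exists_forall_of_atTop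
  -- The first term serves `η = 0`, where the second is `0` by division by zero; the second serves
  -- `η ≠ 0`.
  set Cq : ℝ := 8 * b + b / ‖η‖ with hCq
  have hCq0 : 0 ≤ Cq := by positivity
  refine ⟨2 * C + 6 * Cq, max M₁ (max M₂ M₃), by positivity, ?_⟩
  intro e k p y hk hre he here hek hd
  have hf := hfar k hre ((le_max_left _ _).trans hk)
  have hk' := (le_max_right _ _).trans hk
  have hl := hlog e k ((le_max_left _ _).trans hk') he here hek hd
  obtain ⟨hexp, -⟩ := hM₃ k.im ((le_max_right _ _).trans hk')
  obtain ⟨-, hsm⟩ := hM₃ ‖k‖ (((le_max_right _ _).trans hk').trans hf.im_le_norm)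
  have hk0 := hf.norm_pos
  have him := hf.im_pos
  have hk1 : 1 ≤ ‖k‖ := hf.one_le.trans hf.im_le_norm
  -- the factor
  set X := lamHat k₀ η σ k * cutLog e k with hX
  have hXn : ‖X‖ ≤ C * ‖k‖ ^ (-(3 / 4) : ℝ) := by
    rw [hX, norm_mul]
    calc _ ≤ (C / ‖k‖) * ‖k‖ ^ (1 / 4 : ℝ) :=
          mul_le_mul hf.lamHat_le hl (norm_nonneg _) (by positivity)
      _ = C * (‖k‖ ^ (1 / 4 : ℝ) * ‖k‖ ^ (-1 : ℝ)) := by rw [Real.rpow_neg_one]; ring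
      _ = _ := by rw [← Real.rpow_add hk0]; norm_num
  have hX1 : ‖X‖ ≤ 1 := hXn.trans hsm
  have hG : ‖(cutFactor k₀ η σ e k)⁻¹ - 1‖ ≤ 2 * C * ‖k‖ ^ (-(3 / 4) : ℝ) := by
    rw [cutFactor, ← hX, ← Complex.exp_neg]
    have := Complex.norm_exp_sub_one_le (x := -X) (by rwa [norm_neg])
    rw [norm_neg] at this
    linarith
  have hG3 : ‖(cutFactor k₀ η σ e k)⁻¹‖ ≤ 3 := by
    have h1 := norm_sub_norm_le (cutFactor k₀ η σ e k)⁻¹ 1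
    rw [norm_one] at h1
    linarith
  -- the particular solution
  have hE : ‖exp (2 * I * a * k) * y (-k)‖ = Real.exp (-(2 * a) * k.im) * ‖y (-k)‖ := by
    rw [norm_mul, Complex.norm_exp]
    congr 2
    simp [mul_re, mul_im]
  have hq : ‖particular a k₀ η σ B e y k‖ ≤
      Cq * (‖k‖ * (Real.exp (-(2 * a) * k.im) * ‖y (-k)‖)) := by
    have hBk : ‖B k‖ ≤ b * (2 * ‖k‖) := (hb k).trans (by gcongr; linarith)
    unfold particular
    split_ifs with hη
    · have h1 : ‖coupling a k₀ η σ B y k‖ ≤ 8 * b * (Real.exp (-(2 * a) * k.im) * ‖y (-k)‖) := by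
        rw [coupling, norm_mul, hE, norm_div]
        gcongr
        rw [div_le_iff₀ (norm_pos_iff.2 hf.denom_ne_zero)]
        calc _ ≤ b * (2 * ‖k‖) := hBk
          _ = 8 * b * (‖k‖ / 4) := by ring
          _ ≤ _ := by gcongr; exact hf.denom
      have h2 : ‖cutLog e k‖ ≤ ‖k‖ := by
        refine hl.trans ?_
        calc _ ≤ ‖k‖ ^ (1 : ℝ) := Real.rpow_le_rpow_of_exponent_le hk1 (by norm_num)
          _ = _ := Real.rpow_one _
      have h3 : (1 : ℝ) ≤ ‖(2 * Real.pi * I : ℂ)‖ := by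
        have := Real.pi_gt_three
        simp [abs_of_pos Real.pi_pos]
        linarith
      rw [norm_div]
      refine (div_le_self (norm_nonneg _) h3).trans ?_
      rw [norm_mul]
      calc _ ≤ 8 * b * (Real.exp (-(2 * a) * k.im) * ‖y (-k)‖) * ‖k‖ :=
            mul_le_mul h1 h2 (norm_nonneg _) (by positivity)
        _ = 8 * b * (‖k‖ * (Real.exp (-(2 * a) * k.im) * ‖y (-k)‖)) := by ring
        _ ≤ _ := by
            gcongr
            rw [hCq]
            have : 0 ≤ b / ‖η‖ := by positivity
            linarith
    · rw [norm_mul, hE, norm_neg, norm_div, norm_mul, norm_ofNat]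
      have hη0 : 0 < ‖η‖ := norm_pos_iff.2 hη
      calc _ ≤ b * (2 * ‖k‖) / (2 * ‖η‖) * (Real.exp (-(2 * a) * k.im) * ‖y (-k)‖) := by gcongr
        _ = b / ‖η‖ * (‖k‖ * (Real.exp (-(2 * a) * k.im) * ‖y (-k)‖)) := by
            field_simp
        _ ≤ _ := by
            gcongr
            rw [hCq]
            linarith
  have hqd : ‖k‖ * (Real.exp (-(2 * a) * k.im) * ‖y (-k)‖) ≤
      2 * (k.im ^ (-(3 / 4) : ℝ) * ‖y (-k)‖) := by
    have h1 : k.im * Real.exp (-(2 * a) * k.im) ≤ k.im ^ (-(3 / 4) : ℝ) := by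
      have e1 : k.im = k.im ^ (-(3 / 4) : ℝ) * k.im ^ (7 / 4 : ℝ) := by
        rw [← Real.rpow_add him]
        norm_num
      calc k.im * Real.exp (-(2 * a) * k.im)
          = k.im ^ (-(3 / 4) : ℝ) * (k.im ^ (7 / 4 : ℝ) * Real.exp (-(2 * a) * k.im)) := by
            rw [← mul_assoc, ← e1]
        _ ≤ k.im ^ (-(3 / 4) : ℝ) * 1 := by gcongr
        _ = _ := mul_one _
    calc _ ≤ (2 * k.im) * (Real.exp (-(2 * a) * k.im) * ‖y (-k)‖) := by gcongr; exact hf.norm_le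
      _ = 2 * ((k.im * Real.exp (-(2 * a) * k.im)) * ‖y (-k)‖) := by ring
      _ ≤ _ := by gcongr
  have hmono : ‖k‖ ^ (-(3 / 4) : ℝ) ≤ k.im ^ (-(3 / 4) : ℝ) :=
    Real.rpow_le_rpow_of_nonpos him hf.im_le_norm (by norm_num)
  have hid : p - (p - particular a k₀ η σ B e y k) / cutFactor k₀ η σ e k =
      -(((cutFactor k₀ η σ e k)⁻¹ - 1) * p) +
        particular a k₀ η σ B e y k * (cutFactor k₀ η σ e k)⁻¹ := by
    rw [div_eq_mul_inv]
    ring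
  rw [hid]
  refine (norm_add_le _ _).trans ?_
  rw [norm_neg, norm_mul, norm_mul]
  have hp0 := norm_nonneg p
  have hy0 := norm_nonneg (y (-k))
  have hpow : 0 ≤ k.im ^ (-(3 / 4) : ℝ) := by positivity
  have s1 : ‖(cutFactor k₀ η σ e k)⁻¹ - 1‖ * ‖p‖ ≤ 2 * C * k.im ^ (-(3 / 4) : ℝ) * ‖p‖ := by
    refine mul_le_mul_of_nonneg_right (hG.trans ?_) hp0
    gcongr
  have s2 : ‖particular a k₀ η σ B e y k‖ * ‖(cutFactor k₀ η σ e k)⁻¹‖ ≤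
      Cq * (2 * (k.im ^ (-(3 / 4) : ℝ) * ‖y (-k)‖)) * 3 := by
    refine mul_le_mul (hq.trans ?_) hG3 (norm_nonneg _) (by positivity)
    gcongr
  calc _ ≤ 2 * C * k.im ^ (-(3 / 4) : ℝ) * ‖p‖ +
        Cq * (2 * (k.im ^ (-(3 / 4) : ℝ) * ‖y (-k)‖)) * 3 := add_le_add s1 s2
    _ ≤ _ := by
        have u1 : 0 ≤ C * (k.im ^ (-(3 / 4) : ℝ) * ‖y (-k)‖) := by positivity
        have u2 : 0 ≤ Cq * (k.im ^ (-(3 / 4) : ℝ) * ‖p‖) := by positivity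
        linarith

end Estimates

/-! ### From small jumps to nearly constant functions -/

section Bootstrap

variable {a : ℝ} {k₀ η σ : ℂ} {B : ℂ → ℂ}

/-- The exponent is shared out: `-1/4` gives smallness as the half-strip rises, `-1/2` gives the
decay along its sides needed for the Cauchy integral. -/
theorem rpow_neg_three_quarters_le {u Y : ℝ} (hY : 1 ≤ Y) (hu : Y ≤ u) :
    u ^ (-(3 / 4) : ℝ) ≤ Y ^ (-(1 / 4) : ℝ) * (1 + (u - Y)) ^ (-(1 / 2) : ℝ) := by
  have hu0 : 0 < u := by linarith
  have h1 : u ^ (-(3 / 4) : ℝ) = u ^ (-(1 / 4) : ℝ) * u ^ (-(1 / 2) : ℝ) := by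
    rw [← Real.rpow_add hu0]
    norm_num
  rw [h1]
  refine mul_le_mul ?_ ?_ (by positivity) (by positivity)
  · exact Real.rpow_le_rpow_of_nonpos (by linarith) hu (by norm_num)
  · exact Real.rpow_le_rpow_of_nonpos (by linarith) (by linarith) (by norm_num)

/-- A scalar solution that is bounded by `N` away from the cut is close to its limit at infinity,
up to a small multiple of `N`. -/
theorem eventually_norm_sub_le (hB : 0 < (k₀ ^ 2).im) (ha : 0 < a) (hσ : ‖σ‖ = 1)
    (hBd : Differentiable ℂ B) {b : ℝ} (hb : ∀ k, ‖B k‖ ≤ b * (1 + ‖k‖)) {ε : ℝ} (hε : 0 < ε) :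
    ∀ᶠ t : ℝ in atTop, ∀ (p y : ℂ → ℂ) (c : ℂ) (N : ℝ), IsScalarSolution a k₀ η σ B t p y →
      Tendsto p (Bornology.cobounded ℂ ⊓ 𝓟 (ray k₀ t)ᶜ) (𝓝 c) →
      (∀ z ∈ coHalfStrip 1 ((undeformed k₀ t).im - 1), ‖p z‖ ≤ N ∧ ‖y z‖ ≤ N) →
      ∀ z ∈ coHalfStrip 1 ((undeformed k₀ t).im - 1), ‖p z - c‖ ≤ ε * N := by
  obtain ⟨C₁, M₁, -, hfar⟩ := exists_isFar (k₀ := k₀) (η := η) hσ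
  obtain ⟨C, M₂, hC, hest⟩ := exists_forall_norm_sub_le (k₀ := k₀) (η := η) ha hσ hb
  have hJ := japaneseConst_nonneg
  -- The constant of the Cauchy estimate for half-width `3`, the wider of the two half-strips used.
  -- Dividing by `K + 1` leaves room for the term `‖p z - r z‖`.
  set K : ℝ := 2 * (2 * 3 + 8 * japaneseConst) with hK
  have hK0 : 0 ≤ K := by positivity
  set ε₁ : ℝ := ε / (K + 1) with hε₁
  have hε₁0 : 0 < ε₁ := by positivity
  have him := tendsto_undeformed_im hB
  have hsmall : ∀ᶠ t : ℝ in atTop,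
      2 * C * ((undeformed k₀ t).im - 3) ^ (-(1 / 4) : ℝ) ≤ ε₁ := by
    have h1 := ((tendsto_rpow_neg_atTop (show (0 : ℝ) < 1 / 4 by norm_num)).comp
      (tendsto_atTop_add_const_right _ (-3) him)).const_mul (2 * C)
    rw [mul_zero] at h1
    exact h1.eventually (ge_mem_nhds hε₁0)
  have hre := (tendsto_undeformed_re hB).eventually (gt_mem_nhds (show (0 : ℝ) < 1 / 2 by norm_num))
  filter_upwards [eventually_ge_atTop 0, hsmall, hre,
    him.eventually_ge_atTop (max M₁ (max M₂ 1) + 4)] with t ht hsm hre him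
  intro p y c N hsol hlim hN z hz
  set e := undeformed k₀ t with he
  have hM₁ : M₁ + 4 ≤ e.im := by linarith [le_max_left M₁ (max M₂ 1)]
  have hM₂ : M₂ + 4 ≤ e.im := by
    linarith [le_max_right M₁ (max M₂ 1), le_max_left M₂ 1]
  have he5 : 5 ≤ e.im := by
    linarith [le_max_right M₁ (max M₂ 1), le_max_right M₂ 1]
  have hre0 : 0 < e.re := undeformed_re_pos hB t
  have hfarS : ∀ k ∈ farStrip e, IsFar k₀ η σ C₁ k := fun k hk => hfar k hk.1 (by linarith [hk.2])
  have heS : e ∈ farStrip e := ⟨by rw [abs_of_pos hre0]; linarith, by linarith⟩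
  obtain ⟨r, hrd, hr⟩ := hsol.exists_regularization hB hBd ht hfarS heS
  have hrayc : ∀ k ∈ ray k₀ t, |k.re| < 1 / 2 ∧ e.im ≤ k.im := by
    rintro _ ⟨s, hs, rfl⟩
    have h1 := undeformed_re_anti hB ht hs
    have h2 := undeformed_re_pos hB s
    refine ⟨?_, undeformed_im_mono hB ht hs⟩
    rw [abs_of_pos h2]
    linarith
  have hco : ∀ k ∈ coHalfStrip 1 (e.im - 1), k ∉ ray k₀ t ∧ 1 / 2 ≤ ‖k - e‖ := by
    intro k hk
    refine ⟨fun h => hk ?_, ?_⟩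
    · obtain ⟨h1, h2⟩ := hrayc k h
      exact ⟨by linarith, by linarith⟩
    · by_contra! h
      have h1 := (abs_lt.1 ((Complex.abs_re_le_norm (k - e)).trans_lt h))
      have h2 := (abs_lt.1 ((Complex.abs_im_le_norm (k - e)).trans_lt h))
      rw [sub_re] at h1
      rw [sub_im] at h2
      exact hk ⟨abs_lt.2 ⟨by linarith, by linarith⟩, by linarith⟩
  have hN0 : 0 ≤ N := (norm_nonneg _).trans (hN z hz).1
  have hneg : ∀ k : ℂ, 0 ≤ k.im → -k ∈ coHalfStrip 1 (e.im - 1) := by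
    intro k hk h
    have := h.2
    rw [neg_im] at this
    linarith
  -- the two functions differ little away from the cut
  have hest' : ∀ k ∈ farStrip e, k ∉ ray k₀ t → 1 / 2 ≤ ‖k - e‖ →
      ‖p k - r k‖ ≤ C * k.im ^ (-(3 / 4) : ℝ) * (‖p k‖ + N) := by
    intro k hk hkr hke
    rw [hr k hk hkr]
    refine (hest e k (p k) y (by linarith [hk.2]) hk.1 (by linarith)
      (by rw [abs_of_pos hre0]; linarith) (by linarith [hk.2]) hke).trans ?_
    have h0 := (hfarS k hk).im_pos
    have := (hN (-k) (hneg k h0.le)).2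
    gcongr
  have hδ : ∀ Y : ℝ, e.im - 3 ≤ Y → ∀ k ∈ farStrip e, k ∈ coHalfStrip 1 (e.im - 1) → Y ≤ k.im →
      ‖p k - r k‖ ≤ (ε₁ * N) * (1 + (k.im - Y)) ^ (-(1 / 2) : ℝ) := by
    intro Y hY k hk hkc hYk
    have h1 := hest' k hk (hco k hkc).1 (hco k hkc).2
    have h2 := (hN k hkc).1
    have h3 := rpow_neg_three_quarters_le (show 1 ≤ Y by linarith) hYk
    have h4 : Y ^ (-(1 / 4) : ℝ) ≤ (e.im - 3) ^ (-(1 / 4) : ℝ) :=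
      Real.rpow_le_rpow_of_nonpos (by linarith) hY (by norm_num)
    have h5 : 0 ≤ (1 + (k.im - Y)) ^ (-(1 / 2) : ℝ) :=
      Real.rpow_nonneg (by linarith) _
    calc _ ≤ C * k.im ^ (-(3 / 4) : ℝ) * (N + N) := by
          refine h1.trans ?_
          have h0 := (hfarS k hk).im_pos
          gcongr
      _ ≤ C * ((e.im - 3) ^ (-(1 / 4) : ℝ) * (1 + (k.im - Y)) ^ (-(1 / 2) : ℝ)) * (N + N) := by
          gcongr
          exact h3.trans (by gcongr)
      _ = (2 * C * (e.im - 3) ^ (-(1 / 4) : ℝ)) * N * (1 + (k.im - Y)) ^ (-(1 / 2) : ℝ) := by ring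
      _ ≤ _ := by gcongr
  -- the limit of the regularized function
  have hrlim : Tendsto r (Bornology.cobounded ℂ ⊓ 𝓟 (farStrip e)) (𝓝 c) := by
    refine tendsto_cobounded_of_dense (isOpen_farStrip e) (dense_compl_ray hB t) hrd.continuousOn ?_
    have hp' : Tendsto p (Bornology.cobounded ℂ ⊓ 𝓟 (farStrip e ∩ (ray k₀ t)ᶜ)) (𝓝 c) :=
      hlim.mono_left (inf_le_inf_left _ (principal_mono.2 inter_subset_right))
    have himt : Tendsto (fun k : ℂ => k.im)
        (Bornology.cobounded ℂ ⊓ 𝓟 (farStrip e ∩ (ray k₀ t)ᶜ)) atTop := by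
      refine tendsto_atTop_mono' _ ?_ (((tendsto_norm_cobounded_atTop (E := ℂ)).mono_left
        inf_le_left).atTop_div_const (show (0 : ℝ) < 2 by norm_num))
      have : ∀ᶠ k in Bornology.cobounded ℂ ⊓ 𝓟 (farStrip e ∩ (ray k₀ t)ᶜ),
          k ∈ farStrip e ∩ (ray k₀ t)ᶜ := mem_inf_of_right (mem_principal_self _)
      filter_upwards [this] with k hk
      linarith [(hfarS k hk.1).norm_le]
    have hd : Tendsto (fun k => p k - r k)
        (Bornology.cobounded ℂ ⊓ 𝓟 (farStrip e ∩ (ray k₀ t)ᶜ)) (𝓝 0) := by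
      have h1 := (((tendsto_rpow_neg_atTop (show (0 : ℝ) < 3 / 4 by norm_num)).comp
        himt).const_mul C).mul (hp'.norm.add_const N)
      rw [mul_zero, zero_mul] at h1
      refine squeeze_zero_norm' ?_ h1
      have : ∀ᶠ k in Bornology.cobounded ℂ ⊓ 𝓟 (farStrip e ∩ (ray k₀ t)ᶜ),
          k ∈ farStrip e ∩ (ray k₀ t)ᶜ := mem_inf_of_right (mem_principal_self _)
      filter_upwards [this, himt.eventually_ge_atTop (e.im + 1)] with k hk hk2
      refine hest' k hk.1 hk.2 ?_
      have := (le_abs_self _).trans (Complex.abs_im_le_norm (k - e))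
      rw [sub_im] at this
      linarith
    simpa using hp'.sub hd
  have hclosed := isClosed_ray hB ht
  -- the half-strips
  have hsub : ∀ w : ℝ, w ≤ 3 → halfStrip w (e.im - w) ⊆ farStrip e := by
    intro w hw k hk
    exact ⟨by linarith [hk.1], by linarith [hk.2]⟩
  have hcosub : ∀ w : ℝ, 1 ≤ w → coHalfStrip w (e.im - w) ⊆ coHalfStrip 1 (e.im - 1) := by
    intro w hw k hk h
    exact hk ⟨by linarith [h.1], by linarith [h.2]⟩
  have hpd : ∀ k ∈ coHalfStrip 1 (e.im - 1), DifferentiableAt ℂ p k := fun k hk =>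
    hsol.diff_left k (hco k hk).1
  have hpl : ∀ w : ℝ, 1 ≤ w →
      Tendsto p (Bornology.cobounded ℂ ⊓ 𝓟 (coHalfStrip w (e.im - w))) (𝓝 c) := fun w hw =>
    hlim.mono_left (inf_le_inf_left _ (principal_mono.2 fun k hk => (hco k (hcosub w hw hk)).1))
  have hrl : ∀ w : ℝ, w ≤ 3 →
      Tendsto r (Bornology.cobounded ℂ ⊓ 𝓟 (halfStrip w (e.im - w))) (𝓝 c) := fun w hw =>
    hrlim.mono_left (inf_le_inf_left _ (principal_mono.2 (hsub w hw)))
  have hrda : ∀ k ∈ farStrip e, DifferentiableAt ℂ r k := fun k hk =>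
    hrd.differentiableAt ((isOpen_farStrip e).mem_nhds hk)
  have hεN : 0 ≤ ε₁ * N := by positivity
  have hfin : K * (ε₁ * N) + ε₁ * N = ε * N := by
    rw [hε₁]
    field_simp
  -- The contour is chosen at distance at least `1` from `z`: half-width `3` when `z` lies in the
  -- half-strip of half-width `2`, and half-width `1` otherwise. In the first case the estimate
  -- concerns `r z`, which is then compared with `p z`.
  by_cases hz2 : z ∈ halfStrip 2 (e.im - 2)
  · have h1 := norm_sub_le_of_cousin_of_inside (p := p) (r := r) (c := c) (z := z) (w := 3)
      (Y := e.im - 3) (by norm_num) hεN (fun k hk => hpd k (hcosub 3 (by norm_num) hk))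
      (fun k hk => hrda k (hsub 3 le_rfl hk)) (hpl 3 (by norm_num)) (hrl 3 le_rfl)
      (fun k hk => hδ _ le_rfl k (hsub 3 le_rfl hk.1) (hcosub 3 (by norm_num) hk.2) hk.1.2) (by
        intro k hk
        by_contra! h
        have h1 := (abs_lt.1 ((Complex.abs_re_le_norm (k - z)).trans_lt h))
        have h2 := (abs_lt.1 ((Complex.abs_im_le_norm (k - z)).trans_lt h))
        rw [sub_re] at h1
        rw [sub_im] at h2
        have h3 := abs_le.1 hz2.1
        have h4 := hz2.2
        exact hk.2 ⟨abs_lt.2 ⟨by linarith, by linarith⟩, by linarith⟩)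
      (fun h => h ⟨by linarith [hz2.1], by linarith [hz2.2]⟩) (by
        have : z ∈ farStrip e := hsub 2 (by norm_num) hz2
        filter_upwards [(isOpen_farStrip e).mem_nhds this] with k hk using hrda k hk)
    have h2 := hδ (e.im - 3) le_rfl z (hsub 2 (by norm_num) hz2) hz (by linarith [hz2.2])
    have h3 : (1 + (z.im - (e.im - 3))) ^ (-(1 / 2) : ℝ) ≤ 1 :=
      Real.rpow_le_one_of_one_le_of_nonpos (by linarith [hz2.2]) (by norm_num)
    have h4 : ‖p z - c‖ ≤ ‖p z - r z‖ + ‖r z - c‖ := norm_sub_le_norm_sub_add_norm_sub _ _ _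
    rw [← hK] at h1
    have h5 : ε₁ * N * (1 + (z.im - (e.im - 3))) ^ (-(1 / 2) : ℝ) ≤ ε₁ * N :=
      mul_le_of_le_one_right hεN h3
    linarith
  · have h1 := norm_sub_le_of_cousin_of_outside (p := p) (r := r) (c := c) (z := z) (w := 1)
      (Y := e.im - 1) (by norm_num) hεN hpd
      (fun k hk => hrda k (hsub 1 (by norm_num) hk)) (hpl 1 le_rfl) (hrl 1 (by norm_num))
      (fun k hk => hδ _ (by linarith) k (hsub 1 (by norm_num) hk.1) hk.2 hk.1.2) (by
        intro k hk
        by_contra! h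
        have h1 := (abs_lt.1 ((Complex.abs_re_le_norm (k - z)).trans_lt h))
        have h2 := (abs_lt.1 ((Complex.abs_im_le_norm (k - z)).trans_lt h))
        rw [sub_re] at h1
        rw [sub_im] at h2
        have h3 := abs_le.1 hk.1.1
        have h4 := hk.1.2
        exact hz2 ⟨abs_le.2 ⟨by linarith, by linarith⟩, by linarith⟩)
      (fun h => hz2 ⟨by linarith [h.1], by linarith [h.2]⟩) (by
        filter_upwards [hclosed.isOpen_compl.mem_nhds (hco z hz).1] with k hk
        exact hsol.diff_left k hk)
    have h2 : 2 * (2 * 1 + 8 * japaneseConst) * (ε₁ * N) ≤ K * (ε₁ * N) := by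
      gcongr
      rw [hK]
      linarith
    linarith

theorem isBounded_image_of_tendsto {f : ℂ → ℂ} {S : Set ℂ} {c : ℂ} (hS : IsClosed S)
    (hf : ContinuousOn f S) (h : Tendsto f (Bornology.cobounded ℂ ⊓ 𝓟 S) (𝓝 c)) :
    ∃ N, ∀ z ∈ S, ‖f z‖ ≤ N := by
  obtain ⟨R, hR⟩ := exists_norm_le_of_tendsto_cobounded h one_pos
  obtain ⟨N, hN⟩ := ((isCompact_closedBall (0 : ℂ) R).inter_right hS).exists_bound_of_continuousOn
    (hf.mono inter_subset_right)
  refine ⟨max N (‖c‖ + 1), fun z hz => ?_⟩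
  by_cases hzR : ‖z‖ ≤ R
  · exact (hN z ⟨by simpa using hzR, hz⟩).trans (le_max_left _ _)
  · have h1 := hR z hz (not_le.1 hzR)
    have h2 := norm_sub_norm_le (f z) c
    exact le_trans (by linarith) (le_max_right _ _)

theorem isClosed_coHalfStrip (w Y : ℝ) : IsClosed (coHalfStrip w Y) := by
  have h1 : Continuous fun k : ℂ => |k.re| := continuous_re.abs
  have : coHalfStrip w Y = ({k : ℂ | |k.re| < w} ∩ {k | Y < k.im})ᶜ := rfl
  rw [this]
  exact ((isOpen_lt h1 continuous_const).inter
    (isOpen_lt continuous_const continuous_im)).isClosed_compl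

/-- The a priori bound is self-improving: if `N` is the supremum of both functions off the
half-strip, each differs from its limit by at most `N/2`, so `N ≤ 1 + N/2` and `N ≤ 2`. Finiteness
of `N` comes from the limits at infinity. -/
theorem eventually_pair_norm_sub_le {σ' : ℂ} {B' : ℂ → ℂ} (hB : 0 < (k₀ ^ 2).im) (ha : 0 < a)
    (hσ : ‖σ‖ = 1) (hσ' : ‖σ'‖ = 1) (hBd : Differentiable ℂ B) (hBd' : Differentiable ℂ B')
    {b : ℝ} (hb : ∀ k, ‖B k‖ ≤ b * (1 + ‖k‖)) (hb' : ∀ k, ‖B' k‖ ≤ b * (1 + ‖k‖))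
    {ε : ℝ} (hε : 0 < ε) :
    ∀ᶠ t : ℝ in atTop, ∀ (f h : ℂ → ℂ) (c d : ℂ), ‖c‖ ≤ 1 → ‖d‖ ≤ 1 →
      IsScalarSolution a k₀ η σ B t f h → IsScalarSolution a k₀ η σ' B' t h f →
      Tendsto f (Bornology.cobounded ℂ ⊓ 𝓟 (ray k₀ t)ᶜ) (𝓝 c) →
      Tendsto h (Bornology.cobounded ℂ ⊓ 𝓟 (ray k₀ t)ᶜ) (𝓝 d) →
      ∀ z ∈ coHalfStrip 1 ((undeformed k₀ t).im - 1), ‖f z - c‖ ≤ ε ∧ ‖h z - d‖ ≤ ε := by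
  set ε₁ := min (1 / 2) (ε / 2) with hε₁
  have hε₁0 : 0 < ε₁ := by positivity
  have hre := (tendsto_undeformed_re hB).eventually (gt_mem_nhds (show (0 : ℝ) < 1 by norm_num))
  filter_upwards [eventually_norm_sub_le (η := η) hB ha hσ hBd hb hε₁0,
    eventually_norm_sub_le (η := η) hB ha hσ' hBd' hb' hε₁0, hre, eventually_ge_atTop 0]
    with t h1 h2 hre ht
  intro f h c d hc hd hf hh hfc hhd
  set S := coHalfStrip 1 ((undeformed k₀ t).im - 1) with hS
  have hSr : ∀ k ∈ S, k ∉ ray k₀ t := by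
    rintro _ hk ⟨s, hs, rfl⟩
    have e1 := undeformed_re_anti hB ht hs
    have e2 := undeformed_re_pos hB s
    have e3 := undeformed_im_mono hB ht hs
    exact hk ⟨by rw [abs_of_pos e2]; linarith, by linarith⟩
  have hle : Bornology.cobounded ℂ ⊓ 𝓟 S ≤ Bornology.cobounded ℂ ⊓ 𝓟 (ray k₀ t)ᶜ :=
    inf_le_inf_left _ (principal_mono.2 hSr)
  obtain ⟨N₁, hN₁⟩ := isBounded_image_of_tendsto (isClosed_coHalfStrip _ _)
    (fun k hk => (hf.diff_left k (hSr k hk)).continuousAt.continuousWithinAt) (hfc.mono_left hle)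
  obtain ⟨N₂, hN₂⟩ := isBounded_image_of_tendsto (isClosed_coHalfStrip _ _)
    (fun k hk => (hf.diff_right k (hSr k hk)).continuousAt.continuousWithinAt) (hhd.mono_left hle)
  set A : Set ℝ := (fun z => max ‖f z‖ ‖h z‖) '' S with hA
  have hAb : BddAbove A := by
    refine ⟨max N₁ N₂, ?_⟩
    rintro _ ⟨z, hz, rfl⟩
    exact max_le_max (hN₁ z hz) (hN₂ z hz)
  have hN : ∀ z ∈ S, ‖f z‖ ≤ sSup A ∧ ‖h z‖ ≤ sSup A := fun z hz =>
    max_le_iff.1 (le_csSup hAb ⟨z, hz, rfl⟩)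
  have k1 := h1 f h c (sSup A) hf hfc hN
  have k2 := h2 h f d (sSup A) hh hhd fun z hz => (hN z hz).symm
  intro z hz
  have hpos : 0 ≤ sSup A := (norm_nonneg _).trans (hN z hz).1
  have hhalf : ε₁ * sSup A ≤ 1 / 2 * sSup A := mul_le_mul_of_nonneg_right (min_le_left _ _) hpos
  have hsup : sSup A ≤ 1 + 1 / 2 * sSup A := by
    refine csSup_le ⟨_, z, hz, rfl⟩ ?_
    rintro _ ⟨z', hz', rfl⟩
    have e1 := k1 z' hz'
    have e2 := k2 z' hz'
    have e3 := norm_sub_norm_le (f z') c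
    have e4 := norm_sub_norm_le (h z') d
    exact max_le (by linarith) (by linarith)
  have h3 : ε₁ * sSup A ≤ (ε / 2) * 2 :=
    mul_le_mul (min_le_right _ _) (by linarith) hpos (by positivity)
  exact ⟨(k1 z hz).trans (by linarith), (k2 z hz).trans (by linarith)⟩

end Bootstrap

/-! ### Reduction from two cuts to one -/

/-- Boundary data of two functions in the plane cut along a contour and its mirror image: `u` jumps
across the contour, `w` does not. -/
structure IsShoreData (a : ℝ) (k₀ η σ : ℂ) (B : ℂ → ℂ) (t : ℝ) (u w : ℂ → ℂ) : Prop where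
  diff : ∀ k, k ∉ ray k₀ t → -k ∉ ray k₀ t → DifferentiableAt ℂ w k
  jump : ∀ s, t < s → ∃ l l', HasLeftValue (undeformed k₀) u s l ∧
    HasRightValue (undeformed k₀) u s (mHat k₀ η σ (undeformed k₀ s) * l +
      B (undeformed k₀ s) / (I * (σ * zeta k₀ (undeformed k₀ s)) - η) *
        (exp (2 * I * a * undeformed k₀ s) * l')) ∧
    HasLeftValue (undeformed k₀) w s l' ∧ HasRightValue (undeformed k₀) w s l'
  tip_left : u =O[𝓝[(ray k₀ t)ᶜ] undeformed k₀ t] fun k => ‖k - undeformed k₀ t‖ ^ (-(1 / 4) : ℝ)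
  tip_right : ∃ l, Tendsto w (𝓝[(ray k₀ t)ᶜ] undeformed k₀ t) (𝓝 l)

section Shores

variable {a : ℝ} {k₀ η σ : ℂ} {B : ℂ → ℂ} {t : ℝ} {u w : ℂ → ℂ}

theorem neg_notMem_ray (hB : 0 < (k₀ ^ 2).im) {k : ℂ} (hk : 0 ≤ k.im) : -k ∉ ray k₀ t := by
  intro h
  have := (sq_im_of_mem_ray hB h).1
  rw [neg_im] at this
  linarith

/-- A function without a jump extends across the contour; the extension is reflected. -/
theorem IsShoreData.exists_extension (hB : 0 < (k₀ ^ 2).im) (ht : 0 ≤ t)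
    (h : IsShoreData a k₀ η σ B t u w) :
    ∃ v : ℂ → ℂ, (∀ k ∉ ray k₀ t, DifferentiableAt ℂ v k) ∧
      ∀ k, -k ∉ ray k₀ t → v k = w (-k) := by
  classical
  have hcl := isClosed_ray hB ht
  have hΩ : IsOpen {k : ℂ | -k ∉ ray k₀ t} := hcl.isOpen_compl.preimage continuous_neg
  obtain ⟨hd, heq⟩ := differentiableOn_extendFrom (f := w) (S := ray k₀ t) (b := (k₀ ^ 2).im) hΩ hcl
    (dense_compl_ray hB t) (fun k hk => sq_im_of_mem_ray hB hk.2)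
    (fun k hk => (h.diff k hk.2 hk.1).differentiableWithinAt) (by
      rintro _ ⟨-, s, hs, rfl⟩
      rcases (show t ≤ s from hs).eq_or_lt with rfl | hst
      · exact h.tip_right
      · obtain ⟨-, l', -, -, h1, h2⟩ := h.jump s hst
        refine ⟨l', tendsto_nhdsWithin_of_left_right (map_tube_undeformed hB (ht.trans_lt hst)) ?_
          h1 h2⟩
        filter_upwards [lt_mem_nhds hst] with s' hs'
        exact ⟨s', hs'.le, rfl⟩)
  refine ⟨fun k => if -k ∈ ray k₀ t then extendFrom (ray k₀ t)ᶜ w (-k) else w (-k), ?_, ?_⟩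
  · intro k hk
    have h1 : DifferentiableAt ℂ (fun k => extendFrom (ray k₀ t)ᶜ w (-k)) k := by
      have h2 : DifferentiableAt ℂ (extendFrom (ray k₀ t)ᶜ w) (-k) :=
        hd.differentiableAt (hΩ.mem_nhds (by simpa using hk))
      exact DifferentiableAt.comp k h2 differentiable_neg.differentiableAt
    refine h1.congr_of_eventuallyEq ?_
    filter_upwards [hcl.isOpen_compl.mem_nhds hk] with k' hk'
    split_ifs with h3
    · rfl
    · exact (heq (-k') ⟨by simpa using hk', h3⟩).symm
  · intro k hk
    simp only [if_neg hk]

theorem eventually_tube_im_pos (hB : 0 < (k₀ ^ 2).im) (s : ℝ) {L : Filter ℝ} (hL : L ≤ 𝓝 0) :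
    ∀ᶠ x in 𝓝 s ×ˢ L, 0 < (tube (undeformed k₀) x).im := by
  have h1 := tendsto_tube_prod (s := s) hL (continuous_tube_undeformed hB).continuousAt
  exact h1.eventually (continuous_im.continuousAt.eventually (lt_mem_nhds (undeformed_im_pos hB s)))

theorem IsShoreData.isScalarSolution (hB : 0 < (k₀ ^ 2).im) (ht : 0 ≤ t) {p y : ℂ → ℂ}
    (h : IsShoreData a k₀ η σ B t u w) (hp : ∀ k ∉ ray k₀ t, DifferentiableAt ℂ p k)
    (hy : ∀ k ∉ ray k₀ t, DifferentiableAt ℂ y k) (hpu : ∀ k, -k ∉ ray k₀ t → p k = u k)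
    (hyw : ∀ k, -k ∉ ray k₀ t → y k = w (-k)) : IsScalarSolution a k₀ η σ B t p y := by
  refine ⟨hp, hy, ?_, ?_⟩
  · intro s hs
    obtain ⟨l, l', h1, h2, h3, -⟩ := h.jump s hs
    have hct := continuous_tube_undeformed hB
    -- The point `-κ` lies in the lower half-plane, off the upper cut, so `y` is continuous there
    -- and its value is the common shore value of `w`.
    have hval : y (-undeformed k₀ s) = l' := by
      have hyc : ContinuousAt (fun k => y (-k)) (undeformed k₀ s) := by
        have := (hy _ (neg_notMem_ray (t := t) hB (undeformed_im_pos hB s).le)).continuousAt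
        exact ContinuousAt.comp this continuous_neg.continuousAt
      have e1 : Tendsto (fun x => y (-tube (undeformed k₀) x)) (𝓝 s ×ˢ 𝓝[>] 0)
          (𝓝 (y (-undeformed k₀ s))) := hasLeftValue_of_continuousAt hct.continuousAt hyc
      have e2 : Tendsto (fun x => w (tube (undeformed k₀) x)) (𝓝 s ×ˢ 𝓝[>] 0) (𝓝 l') := h3
      refine tendsto_nhds_unique e1 (e2.congr' ?_)
      -- Points displaced to the left have `Im k² < Im k₀²`, hence are off the cut.
      have e3 := (tendsto_nhdsWithin_iff.1
        (tendsto_sq_sub_left hB (t := t) (ht.trans_lt hs)).1).2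
      filter_upwards [e3] with x hx
      have hxr : tube (undeformed k₀) x ∉ ray k₀ t := by
        intro h'
        have e4 := (sq_im_of_mem_ray hB h').2
        have e5 : (tube (undeformed k₀) x ^ 2 - undeformed k₀ t ^ 2).im < 0 := hx
        rw [sub_im, e4, undeformed_sq, base_im, sub_self] at e5
        exact lt_irrefl _ e5
      have := hyw (-tube (undeformed k₀) x) (by rwa [neg_neg])
      rw [this, neg_neg]
    have key : ∀ {L : Filter ℝ} {v : ℂ}, L ≤ 𝓝 0 →
        Tendsto (fun x => u (tube (undeformed k₀) x)) (𝓝 s ×ˢ L) (𝓝 v) →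
        Tendsto (fun x => p (tube (undeformed k₀) x)) (𝓝 s ×ˢ L) (𝓝 v) := by
      intro L v hL hv
      refine hv.congr' ?_
      filter_upwards [eventually_tube_im_pos hB s hL] with x hx
      exact (hpu _ (neg_notMem_ray hB hx.le)).symm
    refine ⟨l, key nhdsWithin_le_nhds h1, ?_⟩
    rw [coupling, hval]
    exact key nhdsWithin_le_nhds h2
  · refine h.tip_left.congr' ?_ EventuallyEq.rfl
    have : ∀ᶠ k in 𝓝 (undeformed k₀ t), 0 < k.im :=
      continuous_im.continuousAt.eventually (lt_mem_nhds (undeformed_im_pos hB t))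
    filter_upwards [nhdsWithin_le_nhds this] with k hk
    exact (hpu k (neg_notMem_ray hB hk.le)).symm

end Shores

/-! ### The tail of the contour and the sign of the root -/

section Contour

variable {k₀ η : ℂ} {γ : ℝ → ℂ} {ξ : ℂ → ℂ} {T : ℝ}

theorem eventuallyEq_curve₂ (hT : ∀ s, T ≤ s → γ s + k₀ = undeformed k₀ s) {s : ℝ} (hs : T < s) :
    curve₂ k₀ γ =ᶠ[𝓝 s] undeformed k₀ := by
  filter_upwards [lt_mem_nhds hs] with s' hs' using hT s' hs'.le

theorem curve₁_eq_neg (k₀ : ℂ) (γ : ℝ → ℂ) : curve₁ k₀ γ = fun s => -curve₂ k₀ γ s := by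
  funext s
  simp only [curve₁, curve₂]
  ring

theorem eventuallyEq_curve₁ (hT : ∀ s, T ≤ s → γ s + k₀ = undeformed k₀ s) {s : ℝ} (hs : T < s) :
    curve₁ k₀ γ =ᶠ[𝓝 s] fun s => -undeformed k₀ s := by
  rw [curve₁_eq_neg]
  exact (eventuallyEq_curve₂ hT hs).neg

theorem mem_cutPlane_iff (hT : ∀ s, T ≤ s → γ s + k₀ = undeformed k₀ s) {t : ℝ} (ht : T ≤ t)
    (k : ℂ) : k ∈ cutPlane k₀ γ t ↔ k ∉ ray k₀ t ∧ -k ∉ ray k₀ t := by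
  have h2 : cut₂ k₀ γ t = ray k₀ t :=
    image_congr fun s hs => hT s (ht.trans hs)
  have h1 : k ∈ cut₁ k₀ γ t ↔ -k ∈ ray k₀ t := by
    rw [← h2, cut₁, cut₂, curve₁_eq_neg]
    constructor
    · rintro ⟨s, hs, rfl⟩
      exact ⟨s, hs, (neg_neg _).symm⟩
    · rintro ⟨s, hs, h⟩
      exact ⟨s, hs, by simp [h]⟩
  rw [cutPlane, mem_compl_iff, mem_union, h1, h2]
  tauto

/-- Along the tail of a cut, the root on the left shore is `± s`. -/
theorem exists_sign {c : ℝ → ℂ} (hT : 0 ≤ T) (hsq : ∀ k, ξ k ^ 2 = k₀ ^ 2 - k ^ 2)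
    (hc : ∀ s, T < s → c s ^ 2 = undeformed k₀ s ^ 2)
    (hleft : ∀ s : ℝ, 0 < s → HasLeftValue c ξ s (ξ (c s))) :
    ∃ σ : ℂ, ‖σ‖ = 1 ∧ ∀ s, T < s → ξ (c s) = σ * s := by
  have h1 : ContinuousOn (fun s => ξ (c s)) (Ioi T) :=
    continuousOn_of_hasLeftValue isOpen_Ioi fun s hs => hleft s (hT.trans_lt hs)
  have h2 : ContinuousOn (fun s : ℝ => (s : ℂ)) (Ioi T) := by fun_prop
  have h3 : EqOn ((fun s => ξ (c s)) ^ 2) ((fun s : ℝ => (s : ℂ)) ^ 2) (Ioi T) := by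
    intro s hs
    simp only [Pi.pow_apply]
    rw [hsq, hc s hs, undeformed_sq]
    ring
  have h4 : ∀ {s : ℝ}, s ∈ Ioi T → (s : ℂ) ≠ 0 := by
    intro s hs
    have : T < s := hs
    exact_mod_cast (hT.trans_lt this).ne'
  -- A continuous square root of `s²` on a connected half-line has constant sign. Which sign occurs
  -- is immaterial: all estimates use `‖σ‖ = 1` only.
  rcases isPreconnected_Ioi.eq_or_eq_neg_of_sq_eq h1 h2 h3 h4 with h | h
  · exact ⟨1, by simp, fun s hs => by rw [one_mul]; exact h hs⟩
  · exact ⟨-1, by simp, fun s hs => by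
      have := h hs
      simp only [Pi.neg_apply] at this
      rw [this]
      ring⟩

end Contour

/-! ### The columns of a matrix solution at the two cuts -/

section Columns

variable {a : ℝ} {k₀ η σ σ' : ℂ} {γ : ℝ → ℂ} {lam : ℝ → ℂ} {A₁ A₂ : ℂ → Mat} {B : ℂ → ℂ}
  {T t : ℝ} {W : ℂ → Mat}

theorem isBigO_rpow_neg_quarter {x ρ : ℝ} (hx : 0 < x) (hx1 : x ≤ 1) (hρ : -(1 / 4) ≤ ρ) :
    ‖x ^ ρ + 1‖ ≤ 2 * ‖x ^ (-(1 / 4) : ℝ)‖ := by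
  have h1 : x ^ ρ ≤ x ^ (-(1 / 4) : ℝ) := Real.rpow_le_rpow_of_exponent_ge hx hx1 hρ
  have h2 : 1 ≤ x ^ (-(1 / 4) : ℝ) :=
    Real.one_le_rpow_of_pos_of_le_one_of_nonpos hx hx1 (by norm_num)
  rw [Real.norm_of_nonneg (by positivity), Real.norm_of_nonneg (by positivity)]
  linarith

theorem HasLeftValue.entry {c : ℝ → ℂ} {W : ℂ → Mat} {s : ℝ} {L : Mat} (h : HasLeftValue c W s L)
    (i j : Fin 2) : HasLeftValue c (fun k => W k i j) s (L i j) :=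
  tendsto_pi_nhds.1 (tendsto_pi_nhds.1 h i) j

theorem HasRightValue.entry {c : ℝ → ℂ} {W : ℂ → Mat} {s : ℝ} {L : Mat}
    (h : HasRightValue c W s L) (i j : Fin 2) : HasRightValue c (fun k => W k i j) s (L i j) :=
  tendsto_pi_nhds.1 (tendsto_pi_nhds.1 h i) j

/-- The tip estimate and the jump of the first column at the upper cut. -/
theorem IsSolution.isShoreData (hB : 0 < (k₀ ^ 2).im) (hT0 : 0 ≤ T)
    (hT : ∀ s, T ≤ s → γ s + k₀ = undeformed k₀ s) (ht : T < t)
    (hlam : -(1 / 4) ≤ (lam t).re)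
    (hA₂ : ∀ s, T < s → A₂ (undeformed k₀ s) = !![mHat k₀ η σ (undeformed k₀ s), 0;
      B (undeformed k₀ s) / (I * (σ * zeta k₀ (undeformed k₀ s)) - η), 1])
    (h : IsSolution a k₀ γ lam A₁ A₂ t W) (j : Fin 2) :
    IsShoreData a k₀ η σ B t (fun k => W k j 0 * exp (I * k * a))
      (fun k => W k j 1 * exp (-I * k * a)) := by
  have ht0 : 0 ≤ t := hT0.trans ht.le
  have hct := continuous_tube_undeformed hB
  have hcut := mem_cutPlane_iff hT ht.le
  have hopen : IsOpen (cutPlane k₀ γ t) := by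
    have hcl := isClosed_ray hB ht0
    have : cutPlane k₀ γ t = (ray k₀ t)ᶜ ∩ {k | -k ∉ ray k₀ t} := by
      ext k
      exact hcut k
    rw [this]
    exact hcl.isOpen_compl.inter (hcl.isOpen_compl.preimage continuous_neg)
  have hct₂ : curve₂ k₀ γ t = undeformed k₀ t := hT t ht.le
  have hle : 𝓝[(ray k₀ t)ᶜ] undeformed k₀ t ≤ 𝓝[cutPlane k₀ γ t] undeformed k₀ t := by
    refine nhdsWithin_le_of_mem ?_
    have : ∀ᶠ k in 𝓝 (undeformed k₀ t), 0 < k.im :=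
      continuous_im.continuousAt.eventually (lt_mem_nhds (undeformed_im_pos hB t))
    filter_upwards [nhdsWithin_le_nhds this, self_mem_nhdsWithin] with k h1 h2
    exact (hcut k).2 ⟨h2, neg_notMem_ray hB h1.le⟩
  refine ⟨?_, ?_, ?_, ?_⟩
  · intro k h1 h2
    have := (h.regular j 1).differentiableAt (hopen.mem_nhds ((hcut k).2 ⟨h1, h2⟩))
    fun_prop
  · intro s hs
    obtain ⟨L, R, hL, hR, hLR⟩ := h.jump₂ s hs
    have hTs : T < s := ht.trans hs
    rw [show curve₂ k₀ γ s = undeformed k₀ s from hT s hTs.le, hA₂ s hTs] at hLR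
    replace hL := hL.congr_curve (eventuallyEq_curve₂ hT hTs)
    replace hR := hR.congr_curve (eventuallyEq_curve₂ hT hTs)
    set κ := undeformed k₀ s
    have hE : ∀ b : ℂ, ContinuousAt (fun k : ℂ => exp (b * k * a)) κ := fun b => by fun_prop
    have hR0 : R j 0 = L j 0 * mHat k₀ η σ κ + L j 1 * (B κ / (I * (σ * zeta k₀ κ) - η)) := by
      rw [hLR, Matrix.mul_apply, Fin.sum_univ_two]
      simp
    have hR1 : R j 1 = L j 1 := by
      rw [hLR, Matrix.mul_apply, Fin.sum_univ_two]
      simp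
    refine ⟨L j 0 * exp (I * κ * a), L j 1 * exp (-I * κ * a), ?_, ?_, ?_, ?_⟩
    · exact Tendsto.mul (hL.entry j 0) (hasLeftValue_of_continuousAt hct.continuousAt (hE I))
    · have := Tendsto.mul (hR.entry j 0) (hasRightValue_of_continuousAt hct.continuousAt (hE I))
      rw [hR0] at this
      -- The columns are freed of opposite exponentials; their ratio is the small factor `e^{2iaκ}`
      -- of the coupling.
      have h3 : exp (2 * I * a * κ) * (L j 1 * exp (-I * κ * a)) = L j 1 * exp (I * κ * a) := by
        rw [mul_left_comm, ← Complex.exp_add]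
        congr 2
        ring
      have h4 : ∀ q r : ℂ, q * (L j 0 * exp (I * κ * a)) + r * (L j 1 * exp (I * κ * a)) =
          (L j 0 * q + L j 1 * r) * exp (I * κ * a) := fun q r => by ring
      rw [h3, h4]
      exact this
    · exact Tendsto.mul (hL.entry j 1) (hasLeftValue_of_continuousAt hct.continuousAt (hE (-I)))
    · have := Tendsto.mul (hR.entry j 1) (hasRightValue_of_continuousAt hct.continuousAt (hE (-I)))
      rw [hR1] at this
      exact this
  · have h1 := h.end₂_minus j
    rw [hct₂] at h1
    have h2 : (fun k : ℂ => ‖k - undeformed k₀ t‖ ^ (lam t).re + 1)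
        =O[𝓝[(ray k₀ t)ᶜ] undeformed k₀ t] fun k => ‖k - undeformed k₀ t‖ ^ (-(1 / 4) : ℝ) := by
      refine IsBigO.of_bound 2 ?_
      have : ∀ᶠ k in 𝓝 (undeformed k₀ t), ‖k - undeformed k₀ t‖ < 1 := by
        have hc : ContinuousAt (fun k : ℂ => ‖k - undeformed k₀ t‖) (undeformed k₀ t) := by fun_prop
        exact hc.eventually (gt_mem_nhds (by simp))
      filter_upwards [nhdsWithin_le_nhds this, self_mem_nhdsWithin] with k h3 h4
      refine isBigO_rpow_neg_quarter (norm_pos_iff.2 (sub_ne_zero.2 ?_)) h3.le hlam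
      rintro rfl
      exact h4 ⟨t, self_mem_Ici, rfl⟩
    have h3 : (fun k : ℂ => exp (I * k * a)) =O[𝓝[(ray k₀ t)ᶜ] undeformed k₀ t]
        fun _ => (1 : ℝ) := by
      have : ContinuousAt (fun k : ℂ => exp (I * k * a)) (undeformed k₀ t) := by fun_prop
      exact (this.tendsto.mono_left nhdsWithin_le_nhds).isBigO_one ℝ
    have h4 := ((h1.mono hle).trans h2).mul h3
    simpa using h4
  · obtain ⟨g, hg, hgW⟩ := h.end₂_plus j
    rw [hct₂] at hg hgW
    have h1 : ContinuousAt (fun k => g k * exp (-I * k * a)) (undeformed k₀ t) := by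
      have := hg.continuousAt
      fun_prop
    refine ⟨_, (h1.tendsto.mono_left nhdsWithin_le_nhds).congr' ?_⟩
    filter_upwards [hle hgW] with k hk
    rw [hk]

/-- The change of variable `k ↦ -k` together with the exchange of the columns interchanges the
roles of the two cuts. -/
theorem IsSolution.reflect (hB : 0 < (k₀ ^ 2).im) (hT0 : 0 ≤ T)
    (hT : ∀ s, T ≤ s → γ s + k₀ = undeformed k₀ s) (ht : T < t)
    (hlam : -(1 / 4) ≤ (lam t).re)
    (hA₁ : ∀ s, T < s → A₁ (-undeformed k₀ s) =
      !![1, B (undeformed k₀ s) / (I * (σ * zeta k₀ (undeformed k₀ s)) - η);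
        0, mHat k₀ η σ (undeformed k₀ s)])
    (h : IsSolution a k₀ γ lam A₁ A₂ t W) (j : Fin 2) :
    IsShoreData a k₀ η σ B t (fun k => W (-k) j 1 * exp (I * k * a))
      (fun k => W (-k) j 0 * exp (-I * k * a)) := by
  have ht0 : 0 ≤ t := hT0.trans ht.le
  have hct := continuous_tube_undeformed hB
  have hcut := mem_cutPlane_iff hT ht.le
  have hopen : IsOpen (cutPlane k₀ γ t) := by
    have hcl := isClosed_ray hB ht0
    have : cutPlane k₀ γ t = (ray k₀ t)ᶜ ∩ {k | -k ∉ ray k₀ t} := by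
      ext k
      exact hcut k
    rw [this]
    exact hcl.isOpen_compl.inter (hcl.isOpen_compl.preimage continuous_neg)
  have hct₁ : curve₁ k₀ γ t = -undeformed k₀ t := (eventuallyEq_curve₁ hT ht).eq_of_nhds
  have hneg : Tendsto (fun k : ℂ => -k) (𝓝[(ray k₀ t)ᶜ] undeformed k₀ t)
      (𝓝[cutPlane k₀ γ t] (-undeformed k₀ t)) := by
    refine tendsto_nhdsWithin_iff.2
      ⟨(continuous_neg.tendsto _).mono_left nhdsWithin_le_nhds, ?_⟩
    have : ∀ᶠ k in 𝓝 (undeformed k₀ t), 0 < k.im :=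
      continuous_im.continuousAt.eventually (lt_mem_nhds (undeformed_im_pos hB t))
    filter_upwards [nhdsWithin_le_nhds this, self_mem_nhdsWithin] with k h1 h2
    exact (hcut (-k)).2 ⟨neg_notMem_ray hB h1.le, by rwa [neg_neg]⟩
  refine ⟨?_, ?_, ?_, ?_⟩
  · intro k h1 h2
    have := (h.regular j 0).differentiableAt (hopen.mem_nhds ((hcut (-k)).2 ⟨h2, by rwa [neg_neg]⟩))
    have h3 : DifferentiableAt ℂ (fun k => W (-k) j 0) k :=
      DifferentiableAt.comp k this differentiable_neg.differentiableAt
    fun_prop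
  · intro s hs
    obtain ⟨L, R, hL, hR, hLR⟩ := h.jump₁ s hs
    have hTs : T < s := ht.trans hs
    rw [(eventuallyEq_curve₁ hT hTs).eq_of_nhds, hA₁ s hTs] at hLR
    replace hL := (hL.congr_curve (eventuallyEq_curve₁ hT hTs)).comp_neg
    replace hR := (hR.congr_curve (eventuallyEq_curve₁ hT hTs)).comp_neg
    set κ := undeformed k₀ s
    have hE : ∀ b : ℂ, ContinuousAt (fun k : ℂ => exp (b * k * a)) κ := fun b => by fun_prop
    have hR1 : R j 1 = L j 0 * (B κ / (I * (σ * zeta k₀ κ) - η)) + L j 1 * mHat k₀ η σ κ := by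
      rw [hLR, Matrix.mul_apply, Fin.sum_univ_two]
      simp
    have hR0 : R j 0 = L j 0 := by
      rw [hLR, Matrix.mul_apply, Fin.sum_univ_two]
      simp
    refine ⟨L j 1 * exp (I * κ * a), L j 0 * exp (-I * κ * a), ?_, ?_, ?_, ?_⟩
    · exact Tendsto.mul (hL.entry j 1) (hasLeftValue_of_continuousAt hct.continuousAt (hE I))
    · have := Tendsto.mul (hR.entry j 1) (hasRightValue_of_continuousAt hct.continuousAt (hE I))
      rw [hR1] at this
      have h3 : exp (2 * I * a * κ) * (L j 0 * exp (-I * κ * a)) = L j 0 * exp (I * κ * a) := by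
        rw [mul_left_comm, ← Complex.exp_add]
        congr 2
        ring
      have h4 : ∀ q r : ℂ, q * (L j 1 * exp (I * κ * a)) + r * (L j 0 * exp (I * κ * a)) =
          (L j 0 * r + L j 1 * q) * exp (I * κ * a) := fun q r => by ring
      rw [h3, h4]
      exact this
    · exact Tendsto.mul (hL.entry j 0) (hasLeftValue_of_continuousAt hct.continuousAt (hE (-I)))
    · have := Tendsto.mul (hR.entry j 0) (hasRightValue_of_continuousAt hct.continuousAt (hE (-I)))
      rw [hR0] at this
      exact this
  · have h1 := h.end₁_plus j
    rw [hct₁] at h1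
    have h1' : (fun k => W (-k) j 1) =O[𝓝[(ray k₀ t)ᶜ] undeformed k₀ t]
        fun k => ‖k - undeformed k₀ t‖ ^ (lam t).re + 1 := by
      refine (h1.comp_tendsto hneg).congr (fun k => rfl) (fun k => ?_)
      simp only [Function.comp_apply]
      rw [← norm_neg (k - undeformed k₀ t), neg_sub, sub_neg_eq_add, neg_add_eq_sub]
    have h2 : (fun k : ℂ => ‖k - undeformed k₀ t‖ ^ (lam t).re + 1)
        =O[𝓝[(ray k₀ t)ᶜ] undeformed k₀ t] fun k => ‖k - undeformed k₀ t‖ ^ (-(1 / 4) : ℝ) := by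
      refine IsBigO.of_bound 2 ?_
      have : ∀ᶠ k in 𝓝 (undeformed k₀ t), ‖k - undeformed k₀ t‖ < 1 := by
        have hc : ContinuousAt (fun k : ℂ => ‖k - undeformed k₀ t‖) (undeformed k₀ t) := by fun_prop
        exact hc.eventually (gt_mem_nhds (by simp))
      filter_upwards [nhdsWithin_le_nhds this, self_mem_nhdsWithin] with k h3 h4
      refine isBigO_rpow_neg_quarter (norm_pos_iff.2 (sub_ne_zero.2 ?_)) h3.le hlam
      rintro rfl
      exact h4 ⟨t, self_mem_Ici, rfl⟩
    have h3 : (fun k : ℂ => exp (I * k * a)) =O[𝓝[(ray k₀ t)ᶜ] undeformed k₀ t]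
        fun _ => (1 : ℝ) := by
      have : ContinuousAt (fun k : ℂ => exp (I * k * a)) (undeformed k₀ t) := by fun_prop
      exact (this.tendsto.mono_left nhdsWithin_le_nhds).isBigO_one ℝ
    have h4 := (h1'.trans h2).mul h3
    simpa using h4
  · obtain ⟨g, hg, hgW⟩ := h.end₁_minus j
    rw [hct₁] at hg hgW
    have h1 : ContinuousAt (fun k => g (-k) * exp (-I * k * a)) (undeformed k₀ t) := by
      have : ContinuousAt (fun k => g (-k)) (undeformed k₀ t) :=
        ContinuousAt.comp hg.continuousAt continuous_neg.continuousAt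
      fun_prop
    refine ⟨_, (h1.tendsto.mono_left nhdsWithin_le_nhds).congr' ?_⟩
    filter_upwards [hneg.eventually hgW] with k hk
    rw [hk]

end Columns

/-! ### Convergence of the matrix solutions -/

section Convergence

variable {a : ℝ} {k₀ η σ₁ σ₂ : ℂ} {γ : ℝ → ℂ} {lam : ℝ → ℂ} {A₁ A₂ : ℂ → Mat} {B : ℂ → ℂ}
  {T t : ℝ} {W : ℂ → Mat}

/-- A row of a solution yields a pair of functions analytic outside of the upper cut that are
coupled through their jumps. -/
theorem IsSolution.exists_pair (hB : 0 < (k₀ ^ 2).im) (hT0 : 0 ≤ T)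
    (hT : ∀ s, T ≤ s → γ s + k₀ = undeformed k₀ s) (ht : T < t)
    (hlam : -(1 / 4) ≤ (lam t).re)
    (hA₁ : ∀ s, T < s → A₁ (-undeformed k₀ s) =
      !![1, B (undeformed k₀ s) / (I * (σ₁ * zeta k₀ (undeformed k₀ s)) - η);
        0, mHat k₀ η σ₁ (undeformed k₀ s)])
    (hA₂ : ∀ s, T < s → A₂ (undeformed k₀ s) = !![mHat k₀ η σ₂ (undeformed k₀ s), 0;
      B (undeformed k₀ s) / (I * (σ₂ * zeta k₀ (undeformed k₀ s)) - η), 1])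
    (h : IsSolution a k₀ γ lam A₁ A₂ t W) (j : Fin 2) :
    ∃ p y : ℂ → ℂ, IsScalarSolution a k₀ η σ₂ B t p y ∧ IsScalarSolution a k₀ η σ₁ B t y p ∧
      Tendsto p (Bornology.cobounded ℂ ⊓ 𝓟 (ray k₀ t)ᶜ) (𝓝 (if j = 0 then 1 else 0)) ∧
      Tendsto y (Bornology.cobounded ℂ ⊓ 𝓟 (ray k₀ t)ᶜ) (𝓝 (if j = 1 then 1 else 0)) ∧
      (∀ k, -k ∉ ray k₀ t → p k = W k j 0 * exp (I * k * a)) ∧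
      ∀ k, -k ∉ ray k₀ t → y k = W (-k) j 1 * exp (I * k * a) := by
  have ht0 : 0 ≤ t := hT0.trans ht.le
  have D := h.isShoreData hB hT0 hT ht hlam hA₂ j
  have D' := h.reflect hB hT0 hT ht hlam hA₁ j
  obtain ⟨y, hyd, hy⟩ := D.exists_extension hB ht0
  obtain ⟨p, hpd, hp⟩ := D'.exists_extension hB ht0
  have hp' : ∀ k, -k ∉ ray k₀ t → p k = W k j 0 * exp (I * k * a) := by
    intro k hk
    rw [hp k hk, neg_neg, neg_mul_neg]
  have hy' : ∀ k, -k ∉ ray k₀ t → y k = W (-k) j 1 * exp (I * k * a) := by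
    intro k hk
    rw [hy k hk, neg_mul_neg]
  have hcl := isClosed_ray hB ht0
  have hdense : Dense {k : ℂ | -k ∉ ray k₀ t} :=
    (dense_compl_ray hB t).preimage (Homeomorph.neg ℂ).isOpenMap
  have hcut := mem_cutPlane_iff hT ht.le
  refine ⟨p, y, D.isScalarSolution hB ht0 hpd hyd hp' hy, D'.isScalarSolution hB ht0 hyd hpd hy' hp,
    ?_, ?_, hp', hy'⟩
  -- The growth condition is known off both cuts; the extension across the lower one inherits the
  -- limit by density.
  · refine tendsto_cobounded_of_dense hcl.isOpen_compl hdense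
      (fun k hk => (hpd k hk).continuousAt.continuousWithinAt) ?_
    refine ((h.growth_minus j).mono_left (inf_le_inf_left _ (principal_mono.2 fun k hk =>
      (hcut k).2 ⟨hk.1, hk.2⟩))).congr' ?_
    filter_upwards [mem_inf_of_right (mem_principal_self _)] with k hk
    exact (hp' k hk.2).symm
  · refine tendsto_cobounded_of_dense hcl.isOpen_compl hdense
      (fun k hk => (hyd k hk).continuousAt.continuousWithinAt) ?_
    have h1 : Tendsto (fun k : ℂ => -k)
        (Bornology.cobounded ℂ ⊓ 𝓟 ((ray k₀ t)ᶜ ∩ {k : ℂ | -k ∉ ray k₀ t}))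
        (Bornology.cobounded ℂ ⊓ 𝓟 (cutPlane k₀ γ t)) := by
      refine Tendsto.inf tendsto_neg_cobounded (tendsto_principal_principal.2 fun k hk => ?_)
      exact (hcut _).2 ⟨hk.2, by rw [neg_neg]; exact hk.1⟩
    refine ((h.growth_plus j).comp h1).congr' ?_
    filter_upwards [mem_inf_of_right (mem_principal_self _)] with k hk
    rw [hy' k hk.2, Function.comp_apply, neg_mul_neg]

/-- The solutions of the problem with the shortened cuts converge when the ends of the cuts go to
infinity. -/
theorem tendsto_of_isSolution (hB : 0 < (k₀ ^ 2).im) (ha : 0 < a) (hT0 : 0 ≤ T)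
    (hT : ∀ s, T ≤ s → γ s + k₀ = undeformed k₀ s) (hlam : Tendsto lam atTop (𝓝 0))
    (hσ₁ : ‖σ₁‖ = 1) (hσ₂ : ‖σ₂‖ = 1) (hBd : Differentiable ℂ B)
    {b : ℝ} (hb : ∀ k, ‖B k‖ ≤ b * (1 + ‖k‖))
    (hA₁ : ∀ s, T < s → A₁ (-undeformed k₀ s) =
      !![1, B (undeformed k₀ s) / (I * (σ₁ * zeta k₀ (undeformed k₀ s)) - η);
        0, mHat k₀ η σ₁ (undeformed k₀ s)])
    (hA₂ : ∀ s, T < s → A₂ (undeformed k₀ s) = !![mHat k₀ η σ₂ (undeformed k₀ s), 0;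
      B (undeformed k₀ s) / (I * (σ₂ * zeta k₀ (undeformed k₀ s)) - η), 1])
    {U : ℂ → ℂ → Mat} (hU : ∀ᶠ t : ℝ in atTop, IsSolution a k₀ γ lam A₁ A₂ t (U (γ t))) (k : ℂ) :
    Tendsto (fun b => U b k) (map γ atTop) (𝓝 (PiMat a k)) := by
  -- Since `λ(b) → 0`, the tip singularity is eventually no worse than the power `-1/4` that the
  -- regularization allows.
  have hre : ∀ᶠ t in atTop, -(1 / 4) ≤ (lam t).re := by
    have h1 : Tendsto (fun t => (lam t).re) atTop (𝓝 (0 : ℂ).re) :=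
      (continuous_re.tendsto 0).comp hlam
    exact h1.eventually (le_mem_nhds (by norm_num))
  -- the renormalized entries converge
  have key : ∀ (j : Fin 2) (ε : ℝ), 0 < ε → ∀ᶠ t in atTop,
      ‖U (γ t) k j 0 * exp (I * k * a) - (if j = 0 then 1 else 0)‖ ≤ ε ∧
      ‖U (γ t) k j 1 * exp (-(I * k * a)) - (if j = 1 then 1 else 0)‖ ≤ ε := by
    intro j ε hε
    filter_upwards [hU, hre, eventually_gt_atTop T,
      (tendsto_undeformed_im hB).eventually_gt_atTop (|k.im| + 1),
      eventually_pair_norm_sub_le (η := η) hB ha hσ₂ hσ₁ hBd hBd hb hb hε] with t h1 h2 h3 h4 h5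
    -- Applied to both `k` and `-k`: the second column at `k` is read off from `y` at `-k`.
    have him : ∀ z : ℂ, z.im ≤ |k.im| → z ∉ ray k₀ t ∧
        z ∈ coHalfStrip 1 ((undeformed k₀ t).im - 1) := by
      intro z hz
      constructor
      · rintro ⟨s, hs, rfl⟩
        have := undeformed_im_mono hB (hT0.trans h3.le) hs
        linarith
      · rintro ⟨-, h⟩
        linarith
    have hk := him k (le_abs_self _)
    have hk' := him (-k) (by rw [neg_im]; exact neg_le_abs _)
    obtain ⟨p, y, hp, hy, hpl, hyl, hpW, hyW⟩ := h1.exists_pair hB hT0 hT h3 h2 hA₁ hA₂ j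
    have h6 := h5 p y _ _ (by split_ifs <;> simp) (by split_ifs <;> simp) hp hy hpl hyl
    have h7 := (h6 k hk.2).1
    have h8 := (h6 (-k) hk'.2).2
    rw [hpW k hk'.1] at h7
    rw [hyW (-k) (by rw [neg_neg]; exact hk.1), neg_neg, mul_neg, neg_mul] at h8
    exact ⟨h7, h8⟩
  have hlim₀ : ∀ j : Fin 2, Tendsto (fun t => U (γ t) k j 0) atTop
      (𝓝 ((if j = 0 then 1 else 0) * exp (-(I * k * a)))) := by
    intro j
    have h1 : Tendsto (fun t => U (γ t) k j 0 * exp (I * k * a)) atTop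
        (𝓝 (if j = 0 then 1 else 0)) := by
      rw [Metric.nhds_basis_closedBall.tendsto_right_iff]
      intro ε hε
      filter_upwards [key j ε hε] with t ht
      rw [mem_closedBall_iff_norm]
      exact ht.1
    refine (h1.mul_const (exp (-(I * k * a)))).congr fun t => ?_
    rw [mul_assoc, ← Complex.exp_add, add_neg_cancel, Complex.exp_zero, mul_one]
  have hlim₁ : ∀ j : Fin 2, Tendsto (fun t => U (γ t) k j 1) atTop
      (𝓝 ((if j = 1 then 1 else 0) * exp (I * k * a))) := by
    intro j
    have h1 : Tendsto (fun t => U (γ t) k j 1 * exp (-(I * k * a))) atTop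
        (𝓝 (if j = 1 then 1 else 0)) := by
      rw [Metric.nhds_basis_closedBall.tendsto_right_iff]
      intro ε hε
      filter_upwards [key j ε hε] with t ht
      rw [mem_closedBall_iff_norm]
      exact ht.2
    refine (h1.mul_const (exp (I * k * a))).congr fun t => ?_
    rw [mul_assoc, ← Complex.exp_add, neg_add_cancel, Complex.exp_zero, mul_one]
  rw [tendsto_map'_iff]
  have e1 : I * a * k = I * k * a := mul_right_comm _ _ _
  refine tendsto_pi_nhds.2 fun j => tendsto_pi_nhds.2 fun i => ?_
  have h0 := hlim₀ j
  have h1 := hlim₁ j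
  fin_cases j <;> fin_cases i <;> simp [PiMat, e1] at h0 h1 ⊢ <;> assumption

end Convergence

/-- The tail of the contour, together with the signs of the root on the left shores. -/
theorem IsContour.exists_tail {k₀ : ℂ} {γ : ℝ → ℂ} {ξ : ℂ → ℂ} (hγ : IsContour k₀ γ)
    (hξ : IsRoot k₀ γ ξ) :
    ∃ T : ℝ, 0 ≤ T ∧ (∀ s, T ≤ s → γ s + k₀ = undeformed k₀ s) ∧ ∃ σ₁ σ₂ : ℂ, ‖σ₁‖ = 1 ∧ ‖σ₂‖ = 1 ∧
      (∀ s, T < s → ξ (-undeformed k₀ s) = σ₁ * zeta k₀ (undeformed k₀ s)) ∧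
      ∀ s, T < s → ξ (undeformed k₀ s) = σ₂ * zeta k₀ (undeformed k₀ s) := by
  obtain ⟨T₀, hT₀⟩ := eventually_atTop.1 hγ.tail
  set T := max T₀ 0
  have hT0 : 0 ≤ T := le_max_right _ _
  have hT : ∀ s, T ≤ s → γ s + k₀ = undeformed k₀ s := fun s hs => hT₀ s ((le_max_left _ _).trans hs)
  have hc₂ : ∀ s, T < s → curve₂ k₀ γ s = undeformed k₀ s := fun s hs => hT s hs.le
  have hc₁ : ∀ s, T < s → curve₁ k₀ γ s = -undeformed k₀ s := fun s hs =>
    (eventuallyEq_curve₁ hT hs).eq_of_nhds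
  obtain ⟨σ₁, hσ₁, h1⟩ := exists_sign hT0 hξ.sq (fun s hs => by rw [hc₁ s hs, neg_sq]) hξ.left₁
  obtain ⟨σ₂, hσ₂, h2⟩ := exists_sign hT0 hξ.sq (fun s hs => by rw [hc₂ s hs]) hξ.left₂
  refine ⟨T, hT0, hT, σ₁, σ₂, hσ₁, hσ₂, fun s hs => ?_, fun s hs => ?_⟩
  · rw [zeta_undeformed _ (hT0.trans_lt hs), ← h1 s hs, hc₁ s hs]
  · rw [zeta_undeformed _ (hT0.trans_lt hs), ← h2 s hs, hc₂ s hs]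

end ImpedanceStrip

theorem theorem3 (a : ℝ) (ha : 0 < a) (k₀ : ℂ) (hk₀_re : 0 < k₀.re) (hk₀_im : 0 < k₀.im)
    (η : ℂ) (hη : η.im ≤ 0) (γ : ℝ → ℂ) (hγ : ImpedanceStrip.IsContour k₀ γ)
    (ξ : ℂ → ℂ) (hξ : ImpedanceStrip.IsRoot k₀ γ ξ)
    (hz : ImpedanceStrip.AvoidsZeros k₀ η γ ξ)
    (lam : ℝ → ℂ) (hlam : ImpedanceStrip.IsExponent k₀ η γ ξ lam) :
    (∀ U : ℂ → ℂ → ImpedanceStrip.Mat,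
      (∀ᶠ t : ℝ in atTop, ImpedanceStrip.IsSolution a k₀ γ lam
        (ImpedanceStrip.M₁ k₀ η ξ) (ImpedanceStrip.M₂ k₀ η ξ) t (U (γ t))) →
      ∀ k : ℂ, Tendsto (fun b => U b k) (map γ atTop) (𝓝 (ImpedanceStrip.PiMat a k))) ∧
    (∀ V : ℂ → ℂ → ImpedanceStrip.Mat,
      (∀ᶠ t : ℝ in atTop, ImpedanceStrip.IsSolution a k₀ γ lam
        (ImpedanceStrip.N₁ η ξ) (ImpedanceStrip.N₂ η ξ) t (V (γ t))) →
      ∀ k : ℂ, Tendsto (fun b => V b k) (map γ atTop) (𝓝 (ImpedanceStrip.PiMat a k))) := by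
  have hB := ImpedanceStrip.sq_im_pos hk₀_re hk₀_im
  obtain ⟨T, hT0, hT, σ₁, σ₂, hσ₁, hσ₂, h1, h2⟩ := hγ.exists_tail hξ
  constructor
  · intro U hU k
    -- One `B` serves both cuts: at `-κ` on the lower cut, `k₀ - k` becomes `k₀ + κ`.
    refine ImpedanceStrip.tendsto_of_isSolution (η := η) (B := fun k => 2 * I * (k₀ + k))
      (b := 2 * (‖k₀‖ + 1)) hB ha hT0 hT hlam.tendsto hσ₁ hσ₂ (by fun_prop) ?_ ?_ ?_ hU k
    · intro k
      rw [norm_mul, norm_mul, norm_I, Complex.norm_ofNat]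
      nlinarith [norm_add_le k₀ k, norm_nonneg k₀, norm_nonneg k,
        mul_nonneg (norm_nonneg k₀) (norm_nonneg k)]
    · intro s hs
      rw [ImpedanceStrip.M₁, h1 s hs, sub_neg_eq_add, ImpedanceStrip.mHat]
    · intro s hs
      rw [ImpedanceStrip.M₂, h2 s hs, ImpedanceStrip.mHat]
  · intro V hV k
    have hneg : ∀ x : ℂ, -2 * η / (η - x) = 2 * η / (x - η) := fun x => by
      rw [← neg_sub x η, neg_mul, neg_div_neg_eq]
    refine ImpedanceStrip.tendsto_of_isSolution (η := η) (B := fun _ => 2 * η)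
      (b := 2 * ‖η‖) hB ha hT0 hT hlam.tendsto hσ₁ hσ₂ (by fun_prop) ?_ ?_ ?_ hV k
    · intro k
      rw [norm_mul, Complex.norm_ofNat]
      exact le_mul_of_one_le_right (by positivity) (by linarith [norm_nonneg k])
    · intro s hs
      rw [ImpedanceStrip.N₁, h1 s hs, hneg, add_comm η, ImpedanceStrip.mHat]
    · intro s hs
      rw [ImpedanceStrip.N₂, h2 s hs, hneg, add_comm η, ImpedanceStrip.mHat]
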